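/- For a finite alphabet $\Sigma$, an instance of Shortest Superstring is a pair $(S,\ell)$, where $S$ is a finite collection (multiset) of strings over $\Sigma$ and $\ell$ is a non-negative integer; it is a yes-instance if there is a string $s$ over $\Sigma$ of length at most $\ell$ that contains every $x\in S$ as a substring (a contiguous block). Its parameter is the compression $r=\max\{0,\sum_{x\in S}|x|-\ell\}$, the sum being taken with multiplicity. Shortest Superstring admits a kernel of size $O(r^4)$ when parameterized by $r$. That is, there are a constant $C$ and a polynomial $p$ such that for every finite alphabet $\Sigma$ there is an algorithm that, given an instance $(S,\ell)$ over $\Sigma$ with parameter $r$, written as a word of $n$ letters (the strings of $S$, each followed by a separator, and then $\ell$ in binary), computes in at most $p(n)$ steps an instance $(S',\ell')$ over $\Sigma$ such that (i) $(S,\ell)$ is a yes-instance if and only if $(S',\ell')$ is a yes-instance, and (ii) the number of letters of the word that represents $(S',\ell')$ and the parameter $r'$ of $(S',\ell')$ are both at most $C(r^4+1)$. -/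

import Mathlib

/-- A parameterized problem: instances, written as words over a finite alphabet by an injective
encoding, each of them with a parameter and either a yes- or a no-instance. -/
structure ParameterizedProblem where
  /-- the instances -/
  Inst : Type
  /-- the finite alphabet in which instances are written -/
  Letter : Type
  finite_letter : Finite Letter
  /-- the word that represents an instance -/
  encode : Inst → List Letter
  encode_injective : Function.Injective encode
  /-- the parameter of an instance -/
  param : Inst → ℕ
  /-- being a yes-instance -/
  IsYes : Inst → Prop

/-- `P` has a kernelization of size `size` that runs in time `time`: a map from instances to
instances, computed by a (multi-stack) Turing machine within `time n` steps on instances whose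
encoding has `n` letters, that preserves the answer and maps each instance with parameter `k` to
an instance whose encoded length and whose parameter are both at most `size k`. -/
def ParameterizedProblem.AdmitsKernel (P : ParameterizedProblem) (size : ℕ → ℕ)
    (time : Polynomial ℕ) : Prop :=
  ∃ K : P.Inst → P.Inst,
    (∃ M : Turing.TM2ComputableInPolyTime P.encode P.encode K, M.time = time) ∧
    ∀ I : P.Inst,
      (P.IsYes I ↔ P.IsYes (K I)) ∧
      (P.encode (K I)).length ≤ size (P.param I) ∧
      P.param (K I) ≤ size (P.param I)

namespace ShortestSuperstring

/-- `s` is a superstring of the collection `S`: each member of `S` is a substring (a contiguous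
block, `List.IsInfix`) of `s`. -/
def IsSuperstring {A : Type} (s : List A) (S : List (List A)) : Prop :=
  ∀ x ∈ S, x <:+: s

/-- The total length `∑ x ∈ S, |x|`, counted with multiplicity. -/
def totalLength {A : Type} (S : List (List A)) : ℕ :=
  (S.map List.length).sum

/-- An instance `(S, ℓ)` as a word: the strings of `S` one after the other, each followed by the
separator `none`, and then the binary digits of `ℓ`. -/
def encode {A : Type} (I : List (List A) × ℕ) : List (Option (A ⊕ Bool)) :=
  I.1.flatMap (fun x => x.map (fun a => some (Sum.inl a)) ++ [none]) ++
    I.2.bits.map (fun b => some (Sum.inr b))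

theorem bits_injective : Function.Injective Nat.bits := by
  intro m n h
  apply Nat.eq_of_testBit_eq
  intro i
  rw [Nat.testBit_eq_inth, Nat.testBit_eq_inth, h]

theorem string_append_injective {A : Type} : ∀ (x y : List A) (u v : List (Option (A ⊕ Bool))),
    x.map (fun a => some (Sum.inl a)) ++ none :: u = y.map (fun a => some (Sum.inl a)) ++ none :: v →
      x = y ∧ u = v
  | [], [], u, v, h => by simpa using h
  | [], b :: y, u, v, h => by simp at h
  | a :: x, [], u, v, h => by simp at h
  | a :: x, b :: y, u, v, h => by
    simp only [List.map_cons, List.cons_append, List.cons.injEq, Option.some.injEq,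
      Sum.inl.injEq] at h
    obtain ⟨h1, h2⟩ := string_append_injective x y u v h.2
    exact ⟨by rw [h.1, h1], h2⟩

theorem none_mem_of_mem {A : Type} (y : List A) (w : List (Option (A ⊕ Bool))) :
    none ∈ y.map (fun a => some (Sum.inl a)) ++ none :: w := by simp

theorem encode_injective {A : Type} :
    Function.Injective (encode : List (List A) × ℕ → List (Option (A ⊕ Bool))) := by
  rintro ⟨S, m⟩ ⟨T, n⟩ h
  induction S generalizing T with
  | nil =>
    cases T with
    | nil =>
      simp only [encode, List.flatMap_nil, List.nil_append] at h
      have h2 := (List.map_injective_iff.2 (fun a b hab => by simpa using hab)) h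
      rw [bits_injective h2]
    | cons y T =>
      exfalso
      simp only [encode, List.flatMap_nil, List.nil_append, List.flatMap_cons,
        List.append_assoc, List.cons_append] at h
      have h3 := none_mem_of_mem y (T.flatMap
        (fun x => x.map (fun a => some (Sum.inl a)) ++ [none]) ++
          n.bits.map (fun b => some (Sum.inr b)))
      rw [← h] at h3
      simp at h3
  | cons x S ih =>
    cases T with
    | nil =>
      exfalso
      simp only [encode, List.flatMap_nil, List.nil_append, List.flatMap_cons,
        List.append_assoc, List.cons_append] at h
      have h3 := none_mem_of_mem x (S.flatMap
        (fun x => x.map (fun a => some (Sum.inl a)) ++ [none]) ++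
          m.bits.map (fun b => some (Sum.inr b)))
      rw [h] at h3
      simp at h3
    | cons y T =>
      simp only [encode, List.flatMap_cons, List.append_assoc, List.cons_append,
        List.nil_append] at h
      obtain ⟨h1, h2⟩ := string_append_injective _ _ _ _ h
      have h4 := ih T h2
      simp only [Prod.mk.injEq] at h4 ⊢
      exact ⟨by rw [h1, h4.1], h4.2⟩

end ShortestSuperstring

/-- Shortest Superstring over the finite alphabet `A`, parameterized by compression. An instance is
`(S, ℓ)` with `S` a list of strings (repetitions allowed, the order plays no role) and `ℓ` a natural
number; the question is whether `S` has a superstring of length at most `ℓ`; the parameter is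
`r = ∑ x ∈ S, |x| - ℓ`, and `0` if that is negative. -/
def shortestSuperstring (A : Type) [Finite A] : ParameterizedProblem where
  Inst := List (List A) × ℕ
  Letter := Option (A ⊕ Bool)
  finite_letter := inferInstance
  encode := ShortestSuperstring.encode
  encode_injective := ShortestSuperstring.encode_injective
  param := fun I => ShortestSuperstring.totalLength I.1 - I.2
  IsYes := fun I => ∃ s : List A, s.length ≤ I.2 ∧ ShortestSuperstring.IsSuperstring s I.1

/-! ### Structured programs over finitely many stacks -/

namespace StackProg

/-! Strings that occur inside other members can be deleted, so let `T` be factor-free and `r =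
totalLength T - ℓ`. In a superstring of `T` the members start in a definite order, and letters are
saved only by overlaps of consecutive members. Hence the instance is a yes-instance iff some
ordering of `T` has total overlap at least `r`, or, as overlaps are non-negative, iff some path of
distinct members has weight at least `r` in the digraph weighted by `ov`. Such a path may be thinned
out to at most `2 * r` vertices (`exists_short_sublist`).

The answer is yes at once if `r = 0`, if a single overlap reaches `r`, or if a greedy matching of
arcs of positive weight covers at least `2 * r` vertices, since its arcs can be strung together.
Otherwise the set `X` of matched vertices has fewer than `2 * r` members, and distinct strings in
the rest `I` never overlap. A vertex of `I` on a path therefore matters only through its neighbours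
in `X`. For every pair of possible neighbours (one or both may be missing) it suffices to keep the
`2 * r` vertices of `I` that fit best between them: a vertex that is not kept can be exchanged for a
kept one that the path does not use (`exists_path_kept_aux`). This leaves at most `10 * r ^ 3`
strings.

All overlaps are now shorter than `r`, so only the first and the last `r` letters of a string count.
The middle is replaced by a label of logarithmic length, set off by two markers, which keeps the
strings incomparable and creates no new overlaps (`ov_gadget`). A synchronizing block code of length
7 rewrites the markers over two letters of the given alphabet and multiplies all overlaps by 7
(`ov_code`). The result has `O(r ^ 3)` strings of length `O(r)` and parameter `7 * r`. Over an
alphabet with a single letter two strings are always comparable, so the code is never needed there.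

For the running time, structured programs over stacks of numbers are compiled to multi-stack
machines with the same step count (`Run.reach`). On top of them stands a class `PolyTime` of
functions on tree-coded data that is closed under composition, case distinction and folds with
states of polynomial size. The kernelization is one such function on words over an infinite
alphabet, and every finite alphabet is embedded there; this is why one polynomial and one constant
serve all alphabets. -/

/-- The internal stacks. -/
abbrev Reg := Fin 5

/-- The configuration of a structured program: an input stack, an output stack, internal stacks and
two buffers. -/
structure State where
  inp : List ℕ
  out : List ℕ
  stk : Reg → List ℕ
  buf : Option ℕ
  buf2 : Option ℕ

/-- Elementary operations. The source `none` of `pop` is the input stack. -/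
inductive Op
  | pop (k : Option Reg)
  | push (r : Reg)
  | pushc (r : Reg) (n : ℕ)
  | save
  | clear
  | write

/-- Tests on the buffers. -/
inductive Test
  | isSome
  | isConst (n : ℕ)
  | eqBuf

inductive Prog
  | op (o : Op)
  | seq (p q : Prog)
  | ite (t : Test) (p q : Prog)
  | loop (k : Option Reg) (t : Test) (p : Prog)

def State.pop (s : State) : Option Reg → State
  | none => { s with inp := s.inp.tail, buf := s.inp.head? }
  | some r => { s with stk := Function.update s.stk r (s.stk r).tail, buf := (s.stk r).head? }

def Op.apply : Op → State → State
  | .pop k, s => s.pop k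
  | .push r, s => { s with stk := Function.update s.stk r (s.buf.getD 0 :: s.stk r) }
  | .pushc r n, s => { s with stk := Function.update s.stk r (n :: s.stk r) }
  | .save, s => { s with buf2 := s.buf }
  | .clear, s => { s with buf := none, buf2 := none }
  | .write, s => { s with out := s.buf.getD 0 :: s.out }

def Test.holds : Test → State → Bool
  | .isSome, s => s.buf.isSome
  | .isConst n, s => s.buf == some n
  | .eqBuf, s => s.buf == s.buf2

/-- `Run p s t s'`: started in `s`, the program `p` ends in `s'` after `t` steps. -/
inductive Run : Prog → State → ℕ → State → Prop
  | op (o : Op) (s : State) : Run (.op o) s 1 (o.apply s)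
  | seq {p q : Prog} {s₁ s₂ s₃ : State} {t₁ t₂ : ℕ} :
      Run p s₁ t₁ s₂ → Run q s₂ t₂ s₃ → Run (.seq p q) s₁ (t₁ + t₂) s₃
  | ite_true {b : Test} {p q : Prog} {s s' : State} {t : ℕ} :
      b.holds s = true → Run p s t s' → Run (.ite b p q) s (1 + t) s'
  | ite_false {b : Test} {p q : Prog} {s s' : State} {t : ℕ} :
      b.holds s = false → Run q s t s' → Run (.ite b p q) s (1 + t) s'
  | loop_exit {k : Option Reg} {b : Test} {p : Prog} {s : State} :
      b.holds (s.pop k) = false → Run (.loop k b p) s 1 (s.pop k)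
  | loop_step {k : Option Reg} {b : Test} {p : Prog} {s s₁ s₂ : State} {t₁ t₂ : ℕ} :
      b.holds (s.pop k) = true → Run p (s.pop k) t₁ s₁ → Run (.loop k b p) s₁ t₂ s₂ →
        Run (.loop k b p) s (1 + (t₁ + t₂)) s₂

/-! ### Compilation to multi-stack Turing machines -/

/-- All symbol constants of an operation, a test or a program are at most `N`. -/
def Op.Bounded (N : ℕ) : Op → Prop
  | .pushc _ n => n ≤ N
  | _ => True

def Test.Bounded (N : ℕ) : Test → Prop
  | .isConst n => n ≤ N
  | _ => True

def Prog.Bounded (N : ℕ) : Prog → Prop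
  | .op o => o.Bounded N
  | .seq p q => p.Bounded N ∧ q.Bounded N
  | .ite b p q => b.Bounded N ∧ p.Bounded N ∧ q.Bounded N
  | .loop _ b p => b.Bounded N ∧ p.Bounded N

theorem Op.Bounded.mono {M N : ℕ} (h : M ≤ N) : ∀ {o : Op}, o.Bounded M → o.Bounded N
  | .pushc _ _, ho => le_trans ho h
  | .pop _, _ | .push _, _ | .save, _ | .clear, _ | .write, _ => trivial

theorem Test.Bounded.mono {M N : ℕ} (h : M ≤ N) : ∀ {b : Test}, b.Bounded M → b.Bounded N
  | .isConst _, hb => le_trans hb h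
  | .isSome, _ | .eqBuf, _ => trivial

theorem Prog.Bounded.mono {M N : ℕ} (h : M ≤ N) {p : Prog} (hp : p.Bounded M) : p.Bounded N := by
  induction p with
  | op o => exact Op.Bounded.mono h hp
  | seq p q ihp ihq => exact ⟨ihp hp.1, ihq hp.2⟩
  | ite b p q ihp ihq => exact ⟨hp.1.mono h, ihp hp.2.1, ihq hp.2.2⟩
  | loop k b p ihp => exact ⟨hp.1.mono h, ihp hp.2⟩

theorem Prog.exists_bounded (p : Prog) : ∃ N, p.Bounded N := by
  induction p with
  | op o =>
    cases o with
    | pushc r n => exact ⟨n, le_rfl⟩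
    | _ => exact ⟨0, trivial⟩
  | seq p q ihp ihq =>
    obtain ⟨⟨M, hM⟩, ⟨N, hN⟩⟩ := And.intro ihp ihq
    exact ⟨max M N, hM.mono (le_max_left _ _), hN.mono (le_max_right _ _)⟩
  | ite b p q ihp ihq =>
    obtain ⟨⟨M, hM⟩, ⟨N, hN⟩⟩ := And.intro ihp ihq
    obtain ⟨B, hB⟩ : ∃ B, b.Bounded B := by
      cases b with
      | isConst n => exact ⟨n, le_rfl⟩
      | _ => exact ⟨0, trivial⟩
    exact ⟨B + M + N, hB.mono (by omega), hM.mono (by omega), hN.mono (by omega)⟩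
  | loop k b p ihp =>
    obtain ⟨M, hM⟩ := ihp
    obtain ⟨B, hB⟩ : ∃ B, b.Bounded B := by
      cases b with
      | isConst n => exact ⟨n, le_rfl⟩
      | _ => exact ⟨0, trivial⟩
    exact ⟨B + M, hB.mono (by omega), hM.mono (by omega)⟩

/-- The program points of a program. -/
def Prog.Label : Prog → Type
  | .op _ => Unit
  | .seq p q => p.Label ⊕ q.Label
  | .ite _ p q => Option (p.Label ⊕ q.Label)
  | .loop _ _ p => Option p.Label

@[reducible] noncomputable def Prog.fintypeLabel : (p : Prog) → Fintype p.Label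
  | .op _ => inferInstanceAs (Fintype Unit)
  | .seq p q =>
    letI := p.fintypeLabel
    letI := q.fintypeLabel
    inferInstanceAs (Fintype (p.Label ⊕ q.Label))
  | .ite _ p q =>
    letI := p.fintypeLabel
    letI := q.fintypeLabel
    inferInstanceAs (Fintype (Option (p.Label ⊕ q.Label)))
  | .loop _ _ p =>
    letI := p.fintypeLabel
    inferInstanceAs (Fintype (Option p.Label))

def Prog.entry : (p : Prog) → p.Label
  | .op _ => ()
  | .seq p _ => Sum.inl p.entry
  | .ite _ _ _ => none
  | .loop _ _ _ => none

section Compile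

open Turing

variable (N : ℕ) (L : Type) (code : L → ℕ) (dec : ℕ → L)

/-- The stacks of the compiled machine: the internal ones, the input (`false`) and the output. -/
abbrev Stack := Reg ⊕ Bool

/-- Stack alphabets of the compiled machine. -/
abbrev Alph : Stack → Type
  | .inl _ => Fin (N + 1)
  | .inr _ => L

/-- The internal state of the compiled machine: the two buffers. -/
abbrev Bufs := Option (Fin (N + 1)) × Option (Fin (N + 1))

variable {N L}

def popStmt {Λ : Type} (q : TM2.Stmt (Alph N L) Λ (Bufs N)) :
    Option Reg → TM2.Stmt (Alph N L) Λ (Bufs N)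
  | none => .pop (.inr false) (fun v x => (x.map fun a => Fin.ofNat (N + 1) (code a), v.2)) q
  | some r => .pop (.inl r) (fun v x => (x, v.2)) q

def opStmt {Λ : Type} (q : TM2.Stmt (Alph N L) Λ (Bufs N)) : Op → TM2.Stmt (Alph N L) Λ (Bufs N)
  | .pop k => popStmt code q k
  | .push r => .push (.inl r) (fun v => v.1.getD 0) q
  | .pushc r n => .push (.inl r) (fun _ => Fin.ofNat (N + 1) n) q
  | .save => .load (fun v => (v.1, v.1)) q
  | .clear => .load (fun _ => (none, none)) q
  | .write => .push (.inr true) (fun v => dec (v.1.getD 0).val) q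

def testFun : Test → Bufs N → Bool
  | .isSome, v => v.1.isSome
  | .isConst n, v => v.1 == some (Fin.ofNat (N + 1) n)
  | .eqBuf, v => v.1 == v.2

/-- Compilation with explicit continuations: the label function places the program points inside an
ambient machine, and the further label is where control goes afterwards. The body of a loop
continues at the head of that loop. -/
def Prog.compile {Λ : Type} : (p : Prog) → (p.Label → Λ) → Λ → p.Label →
    TM2.Stmt (Alph N L) Λ (Bufs N)
  | .op o, _, ex, _ => opStmt code dec (.goto fun _ => ex) o
  | .seq p q, emb, _, .inl l => p.compile (fun x => emb (.inl x)) (emb (.inr q.entry)) l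
  | .seq _ q, emb, ex, .inr l => q.compile (fun x => emb (.inr x)) ex l
  | .ite b p q, emb, _, none => .branch (testFun b) (.goto fun _ => emb (some (.inl p.entry)))
      (.goto fun _ => emb (some (.inr q.entry)))
  | .ite _ p _, emb, ex, some (.inl l) => p.compile (fun x => emb (some (.inl x))) ex l
  | .ite _ _ q, emb, ex, some (.inr l) => q.compile (fun x => emb (some (.inr x))) ex l
  | .loop k b p, emb, ex, none => popStmt code (.branch (testFun b)
      (.goto fun _ => emb (some p.entry)) (.goto fun _ => ex)) k
  | .loop _ _ p, emb, _, some l => p.compile (fun x => emb (some x)) (emb none) l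

/-- The buffers of the compiled machine that correspond to a state. -/
def State.bufs (s : State) : Bufs N :=
  (s.buf.map (Fin.ofNat (N + 1)), s.buf2.map (Fin.ofNat (N + 1)))

/-- The stacks of the compiled machine that correspond to a state. -/
def State.stacks (s : State) : ∀ k : Stack, List (Alph N L k)
  | .inl r => (s.stk r).map (Fin.ofNat (N + 1))
  | .inr false => s.inp.map dec
  | .inr true => s.out.map dec

variable (N) in
/-- All symbols that occur in a state are at most `N`, and the input symbols are letters. -/
structure State.Good (s : State) : Prop where
  inp : ∀ x ∈ s.inp, x ≤ N ∧ code (dec x) = x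
  stk : ∀ r, ∀ x ∈ s.stk r, x ≤ N
  buf : ∀ x ∈ s.buf, x ≤ N
  buf2 : ∀ x ∈ s.buf2, x ≤ N

variable {code dec}

theorem ofNat_val {x : ℕ} (h : x ≤ N) : (Fin.ofNat (N + 1) x).val = x :=
  Nat.mod_eq_of_lt (by omega)

/-- The machine needs finite stack alphabets, so symbols are reduced modulo `N + 1`. As long as all
symbols are at most `N`, tests on reduced symbols give the same results as tests on the numbers
themselves. -/
theorem ofNat_inj {x y : ℕ} (hx : x ≤ N) (hy : y ≤ N) :
    Fin.ofNat (N + 1) x = Fin.ofNat (N + 1) y ↔ x = y := by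
  rw [Fin.ext_iff, ofNat_val hx, ofNat_val hy]

theorem State.Good.getD {s : State} (h : s.Good N code dec) : s.buf.getD 0 ≤ N := by
  cases hb : s.buf with
  | none => simp
  | some x => exact h.buf x (by simp [hb])

theorem State.Good.pop {s : State} (h : s.Good N code dec) (k : Option Reg) :
    (s.pop k).Good N code dec := by
  cases k with
  | none =>
    exact ⟨fun x hx => h.inp x (List.mem_of_mem_tail hx), h.stk,
      fun x hx => (h.inp x (List.mem_of_mem_head? hx)).1, h.buf2⟩
  | some r =>
    refine ⟨h.inp, fun r' x hx => ?_, fun x hx => h.stk r x (List.mem_of_mem_head? hx), h.buf2⟩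
    by_cases hr : r' = r
    · subst hr
      simp only [State.pop, Function.update_self] at hx
      exact h.stk r' x (List.mem_of_mem_tail hx)
    · simp only [State.pop, Function.update_of_ne hr] at hx
      exact h.stk r' x hx

theorem State.Good.push {s : State} (h : s.Good N code dec) (r : Reg) {n : ℕ} (hn : n ≤ N) :
    ({ s with stk := Function.update s.stk r (n :: s.stk r) } : State).Good N code dec := by
  refine ⟨h.inp, fun r' x hx => ?_, h.buf, h.buf2⟩
  by_cases hr : r' = r
  · subst hr
    simp only [Function.update_self, List.mem_cons] at hx
    rcases hx with rfl | hx
    · exact hn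
    · exact h.stk r' x hx
  · simp only [Function.update_of_ne hr] at hx
    exact h.stk r' x hx

theorem State.Good.apply {s : State} (h : s.Good N code dec) {o : Op} (ho : o.Bounded N) :
    (o.apply s).Good N code dec := by
  cases o with
  | pop k => exact h.pop k
  | push r => exact h.push r h.getD
  | pushc r n => exact h.push r ho
  | save => exact ⟨h.inp, h.stk, h.buf, h.buf⟩
  | clear => exact ⟨h.inp, h.stk, by simp [Op.apply], by simp [Op.apply]⟩
  | write => exact ⟨h.inp, h.stk, h.buf, h.buf2⟩

theorem Run.good {p : Prog} {s s' : State} {t : ℕ} (hr : Run p s t s') (hp : p.Bounded N)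
    (h : s.Good N code dec) : s'.Good N code dec := by
  induction hr with
  | op o s => exact h.apply hp
  | seq _ _ ih₁ ih₂ => exact ih₂ hp.2 (ih₁ hp.1 h)
  | ite_true _ _ ih => exact ih hp.2.1 h
  | ite_false _ _ ih => exact ih hp.2.2 h
  | loop_exit _ => exact h.pop _
  | loop_step _ _ _ ih₁ ih₂ => exact ih₂ hp (ih₁ hp.2 (h.pop _))

theorem State.stacks_update_stk (s : State) (r : Reg) (l : List ℕ) :
    ({ s with stk := Function.update s.stk r l } : State).stacks (N := N) dec =
      Function.update (s.stacks dec) (.inl r) (l.map (Fin.ofNat (N + 1))) := by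
  funext k
  rcases k with r' | b
  · by_cases hr : r' = r
    · subst hr; simp [State.stacks]
    · rw [Function.update_of_ne (by simpa using hr)]
      simp [State.stacks, Function.update_of_ne hr]
  · rw [Function.update_of_ne (by simp)]
    cases b <;> rfl

theorem stepAux_popStmt {Λ : Type} {s : State} (h : s.Good N code dec)
    (q : TM2.Stmt (Alph N L) Λ (Bufs N)) (k : Option Reg) :
    TM2.stepAux (popStmt code q k) s.bufs (s.stacks dec) =
      TM2.stepAux q (s.pop k).bufs ((s.pop k).stacks dec) := by
  cases k with
  | none =>
    simp only [popStmt, TM2.stepAux]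
    congr 1
    · simp only [State.bufs, State.pop, State.stacks, List.head?_map, Option.map_map]
      congr 1
      cases hs : s.inp with
      | nil => rfl
      | cons x l => simp [(h.inp x (by simp [hs])).2]
    · funext k
      rcases k with r | b
      · rw [Function.update_of_ne (by simp)]; rfl
      · cases b
        · simp [State.stacks, State.pop]
        · rw [Function.update_of_ne (by simp)]; rfl
  | some r =>
    simp only [popStmt, TM2.stepAux]
    congr 1
    · simp only [State.bufs, State.pop, State.stacks, List.head?_map]
    · have hs : (s.pop (some r)).stacks (N := N) dec =
          Function.update (s.stacks dec) (.inl r) ((s.stk r).tail.map (Fin.ofNat (N + 1))) := by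
        rw [← State.stacks_update_stk]
        funext k
        rcases k with r' | b
        · rfl
        · cases b <;> rfl
      rw [hs, List.map_tail]
      rfl

theorem stepAux_opStmt {Λ : Type} {s : State} (h : s.Good N code dec)
    (q : TM2.Stmt (Alph N L) Λ (Bufs N)) {o : Op} :
    TM2.stepAux (opStmt code dec q o) s.bufs (s.stacks dec) =
      TM2.stepAux q (o.apply s).bufs ((o.apply s).stacks dec) := by
  cases o with
  | pop k => exact stepAux_popStmt h q k
  | push r =>
    simp only [opStmt, TM2.stepAux, Op.apply]
    rw [State.stacks_update_stk]
    have hb : (s.buf.map (Fin.ofNat (N + 1))).getD 0 = Fin.ofNat (N + 1) (s.buf.getD 0) := by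
      cases s.buf <;> rfl
    simp only [List.map_cons, ← hb]
    rfl
  | pushc r n =>
    simp only [opStmt, TM2.stepAux, Op.apply]
    rw [State.stacks_update_stk]
    rfl
  | save => rfl
  | clear => rfl
  | write =>
    simp only [opStmt, TM2.stepAux, Op.apply]
    congr 1
    funext k
    rcases k with r' | b
    · rw [Function.update_of_ne (by simp)]; rfl
    · cases b
      · rw [Function.update_of_ne (by simp)]; rfl
      · have := h.getD
        simp only [State.bufs, State.stacks, Function.update_self, List.map_cons]
        congr 2
        cases hb : s.buf with
        | none => rfl
        | some x =>
          rw [hb] at this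
          simpa using Nat.mod_eq_of_lt (Nat.lt_succ_of_le this)

theorem testFun_bufs {s : State} (h : s.Good N code dec) {b : Test} (hb : b.Bounded N) :
    testFun b (s.bufs (N := N)) = b.holds s := by
  cases b with
  | isSome => simp [testFun, Test.holds, State.bufs]
  | isConst n =>
    simp only [testFun, Test.holds, State.bufs]
    cases hs : s.buf with
    | none => rfl
    | some x =>
      have hx := h.buf x (by simp [hs])
      rw [Bool.eq_iff_iff]
      simp only [Option.map_some, beq_iff_eq, Option.some.injEq]
      exact ofNat_inj hx hb
  | eqBuf =>
    simp only [testFun, Test.holds, State.bufs]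
    cases hs : s.buf with
    | none => cases hs' : s.buf2 <;> rfl
    | some x =>
      have hx := h.buf x (by simp [hs])
      cases hs' : s.buf2 with
      | none => rfl
      | some y =>
        have hy := h.buf2 y (by simp [hs'])
        rw [Bool.eq_iff_iff]
        simp only [Option.map_some, beq_iff_eq, Option.some.injEq]
        exact ofNat_inj hx hy

/-- `M` goes from one configuration to another in exactly `t` steps. -/
def Reach {Λ : Type} (M : Λ → TM2.Stmt (Alph N L) Λ (Bufs N)) (t : ℕ)
    (c c' : TM2.Cfg (Alph N L) Λ (Bufs N)) : Prop :=
  (flip bind (TM2.step M))^[t] (some c) = some c'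

theorem Reach.trans {Λ : Type} {M : Λ → TM2.Stmt (Alph N L) Λ (Bufs N)} {t₁ t₂ : ℕ}
    {c₁ c₂ c₃ : TM2.Cfg (Alph N L) Λ (Bufs N)} (h₁ : Reach M t₁ c₁ c₂) (h₂ : Reach M t₂ c₂ c₃) :
    Reach M (t₁ + t₂) c₁ c₃ := by
  unfold Reach at *
  rw [Nat.add_comm, Function.iterate_add_apply, h₁, h₂]

theorem Reach.single {Λ : Type} {M : Λ → TM2.Stmt (Alph N L) Λ (Bufs N)}
    {l : Λ} {v : Bufs N} {S : ∀ k, List (Alph N L k)} {c : TM2.Cfg (Alph N L) Λ (Bufs N)}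
    (h : TM2.stepAux (M l) v S = c) : Reach M 1 ⟨some l, v, S⟩ c := by
  subst h; rfl

/-- Induction on the run: each elementary operation, branch or loop test is exactly one machine
step, so the step count is preserved and not merely bounded. The machine `M` need only contain the
code of `p` under `emb`, which is what lets the induction pass to subprograms. -/
theorem Run.reach {p : Prog} {s s' : State} {t : ℕ} (hr : Run p s t s') (hp : p.Bounded N)
    (h : s.Good N code dec) {Λ : Type} (M : Λ → TM2.Stmt (Alph N L) Λ (Bufs N))
    (emb : p.Label → Λ) (ex : Λ) (hM : ∀ l, M (emb l) = p.compile code dec emb ex l) :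
    Reach M t ⟨some (emb p.entry), s.bufs, s.stacks dec⟩ ⟨some ex, s'.bufs, s'.stacks dec⟩ := by
  induction hr generalizing ex with
  | op o s =>
    apply Reach.single
    rw [hM, Prog.compile, stepAux_opStmt h]
    rfl
  | @seq p q s₁ s₂ s₃ t₁ t₂ r₁ r₂ ih₁ ih₂ =>
    refine Reach.trans (c₂ := ⟨some (emb (.inr q.entry)), s₂.bufs, s₂.stacks dec⟩) ?_ ?_
    · exact ih₁ hp.1 h (fun x => emb (.inl x)) _ (fun l => hM (.inl l))
    · exact ih₂ hp.2 (r₁.good hp.1 h) (fun x => emb (.inr x)) _ (fun l => hM (.inr l))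
  | @ite_true b p q s s' t hb r ih =>
    refine Reach.trans (c₂ := ⟨some (emb (some (.inl p.entry))), s.bufs, s.stacks dec⟩) ?_
      (ih hp.2.1 h (fun x => emb (some (.inl x))) _ (fun l => hM (some (.inl l))))
    apply Reach.single
    rw [hM]
    simp only [Prog.entry, Prog.compile, TM2.stepAux, testFun_bufs h hp.1, hb, cond_true]
  | @ite_false b p q s s' t hb r ih =>
    refine Reach.trans (c₂ := ⟨some (emb (some (.inr q.entry))), s.bufs, s.stacks dec⟩) ?_
      (ih hp.2.2 h (fun x => emb (some (.inr x))) _ (fun l => hM (some (.inr l))))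
    apply Reach.single
    rw [hM]
    simp only [Prog.entry, Prog.compile, TM2.stepAux, testFun_bufs h hp.1, hb, cond_false]
  | @loop_exit k b p s hb =>
    apply Reach.single
    rw [hM]
    simp only [Prog.entry, Prog.compile, stepAux_popStmt h, TM2.stepAux,
      testFun_bufs (h.pop k) hp.1, hb, cond_false]
  | @loop_step k b p s s₁ s₂ t₁ t₂ hb r₁ r₂ ih₁ ih₂ =>
    refine Reach.trans (c₂ := ⟨some (emb (some p.entry)), (s.pop k).bufs, (s.pop k).stacks dec⟩) ?_
      (Reach.trans (c₂ := ⟨some (emb none), s₁.bufs, s₁.stacks dec⟩) ?_ ?_)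
    · apply Reach.single
      rw [hM]
      simp only [Prog.entry, Prog.compile, stepAux_popStmt h, TM2.stepAux,
        testFun_bufs (h.pop k) hp.1, hb, cond_true]
    · exact ih₁ hp.2 (h.pop k) (fun x => emb (some x)) _ (fun l => hM (some l))
    · exact ih₂ hp (r₁.good hp.2 (h.pop k)) emb ex hM

variable (N code dec) in
/-- The Turing machine of a program. -/
noncomputable def Prog.machine (p : Prog) [Fintype L] : FinTM2 :=
  letI := p.fintypeLabel
  { K := Stack
    k₀ := .inr false
    k₁ := .inr true
    Γ := Alph N L
    Λ := Option p.Label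
    main := some p.entry
    σ := Bufs N
    initialState := (none, none)
    Γk₀Fin := inferInstanceAs (Fintype L)
    m := fun l => match l with
      | none => .load (fun _ => (none, none)) .halt
      | some l => p.compile code dec some none l }

/-- The state of a program before its start on the input `w`. -/
def State.start (w : List ℕ) : State := ⟨w, [], fun _ => [], none, none⟩

/-- A program that turns the codes of the word of `a` into the codes of the word of `f a` within
polynomial time yields a Turing machine that does so. -/
theorem exists_polyTime [Fintype L] {α β : Type} (ea : α → List L) (eb : β → List L)
    (f : α → β) (p : Prog) (time : Polynomial ℕ) (hdec : ∀ a, dec (code a) = a)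
    (hrun : ∀ a, ∃ t < time.eval (ea a).length, ∃ s' : State,
      Run p (State.start ((ea a).map code)) t s' ∧ s'.inp = [] ∧ s'.stk = (fun _ => []) ∧
        s'.out = (eb (f a)).map code) :
    ∃ M : TM2ComputableInPolyTime ea eb f, M.time = time := by
  obtain ⟨N₀, hN₀⟩ := p.exists_bounded
  obtain ⟨N₁, hN₁⟩ : ∃ N₁, ∀ a : L, code a ≤ N₁ :=
    ⟨∑ a, code a, fun a => Finset.single_le_sum (f := code) (fun _ _ => Nat.zero_le _)
      (Finset.mem_univ a)⟩
  have hp : p.Bounded (N₀ + N₁) := hN₀.mono (by omega)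
  choose t ht s' hr hinp hstk hout using hrun
  -- The additional step is the one at the label `none`, which resets the buffers to their initial
  -- values, as `haltList` demands, and halts. It is paid for by the strict inequality in `hrun`.
  refine ⟨⟨⟨p.machine (N₀ + N₁) code dec, Equiv.refl L, Equiv.refl L⟩, time, fun a =>
    ⟨⟨t a + 1, ?_⟩, ht a⟩⟩, rfl⟩
  have hgood : (State.start ((ea a).map code)).Good (N₀ + N₁) code dec := by
    refine ⟨fun x hx => ?_, by simp [State.start], by simp [State.start], by simp [State.start]⟩
    simp only [State.start, List.mem_map] at hx
    obtain ⟨y, _, rfl⟩ := hx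
    exact ⟨(hN₁ y).trans (by omega), by rw [hdec]⟩
  have h1 := (hr a).reach hp hgood (p.machine (N₀ + N₁) code dec).m some none (fun l => rfl)
  have h2 : Reach (p.machine (N₀ + N₁) code dec).m 1
      ⟨some none, (s' a).bufs, (s' a).stacks dec⟩ ⟨none, (none, none), (s' a).stacks dec⟩ := rfl
  have hi : initList (p.machine (N₀ + N₁) code dec) (List.map id (ea a)) =
      ⟨some (some p.entry), (State.start ((ea a).map code)).bufs,
        (State.start ((ea a).map code)).stacks dec⟩ := by
    unfold initList
    congr 1
    funext k
    rcases k with r | b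
    · rfl
    · cases b
      · change List.map id (ea a) = _
        simp [Function.comp_def, hdec, State.stacks, State.start]
      · rfl
  have ho : haltList (p.machine (N₀ + N₁) code dec) (List.map id (eb (f a))) =
      ⟨none, (none, none), (s' a).stacks dec⟩ := by
    unfold haltList
    congr 1
    funext k
    rcases k with r | b
    · simp only [State.stacks, hstk]; rfl
    · cases b
      · simp only [State.stacks, hinp]; rfl
      · simp only [State.stacks, hout]
        change List.map id (eb (f a)) = _
        simp [Function.comp_def, hdec]
  refine Eq.trans (congrArg (fun c => (flip bind (TM2.step (p.machine (N₀ + N₁) code dec).m))^[t a + 1]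
    (some c)) hi) (Eq.trans ?_ (congrArg some ho.symm))
  exact h1.trans h2

end Compile

end StackProg

/-! ### Trees on stacks -/

namespace StackProg

/-- `RunLe p s T s'`: started in `s`, the program `p` ends in `s'` after at most `T` steps. -/
def RunLe (p : Prog) (s : State) (T : ℕ) (s' : State) : Prop := ∃ t ≤ T, Run p s t s'

theorem RunLe.mono {p : Prog} {s s' : State} {T T' : ℕ} (h : RunLe p s T s') (hT : T ≤ T') :
    RunLe p s T' s' := by
  obtain ⟨t, ht, hr⟩ := h
  exact ⟨t, ht.trans hT, hr⟩

theorem RunLe.op {o : Op} {s s' : State} (h : o.apply s = s') : RunLe (.op o) s 1 s' := by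
  subst h; exact ⟨1, le_rfl, .op o s⟩

theorem RunLe.seq {p q : Prog} {s₁ s₂ s₃ : State} {t₁ t₂ : ℕ} (h₁ : RunLe p s₁ t₁ s₂)
    (h₂ : RunLe q s₂ t₂ s₃) : RunLe (.seq p q) s₁ (t₁ + t₂) s₃ := by
  obtain ⟨u₁, hu₁, r₁⟩ := h₁
  obtain ⟨u₂, hu₂, r₂⟩ := h₂
  exact ⟨u₁ + u₂, by omega, r₁.seq r₂⟩

theorem RunLe.ite_true {b : Test} {p q : Prog} {s s' : State} {t : ℕ} (hb : b.holds s = true)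
    (h : RunLe p s t s') : RunLe (.ite b p q) s (1 + t) s' := by
  obtain ⟨u, hu, r⟩ := h
  exact ⟨1 + u, by omega, .ite_true hb r⟩

theorem RunLe.ite_false {b : Test} {p q : Prog} {s s' : State} {t : ℕ} (hb : b.holds s = false)
    (h : RunLe q s t s') : RunLe (.ite b p q) s (1 + t) s' := by
  obtain ⟨u, hu, r⟩ := h
  exact ⟨1 + u, by omega, .ite_false hb r⟩

theorem RunLe.loop_exit {k : Option Reg} {b : Test} {p : Prog} {s s' : State}
    (hs : s.pop k = s') (hb : b.holds s' = false) : RunLe (.loop k b p) s 1 s' := by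
  subst hs; exact ⟨1, le_rfl, .loop_exit hb⟩

theorem RunLe.loop_step {k : Option Reg} {b : Test} {p : Prog} {s s₀ s₁ s₂ : State} {t₁ t₂ : ℕ}
    (hs : s.pop k = s₀) (hb : b.holds s₀ = true) (h₁ : RunLe p s₀ t₁ s₁)
    (h₂ : RunLe (.loop k b p) s₁ t₂ s₂) : RunLe (.loop k b p) s (1 + (t₁ + t₂)) s₂ := by
  subst hs
  obtain ⟨u₁, hu₁, r₁⟩ := h₁
  obtain ⟨u₂, hu₂, r₂⟩ := h₂
  exact ⟨1 + (u₁ + u₂), by omega, .loop_step hb r₁ r₂⟩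

/-- Binary trees with numbers at the leaves, the data that programs work on. -/
inductive Tree
  | atom (n : ℕ)
  | node (l r : Tree)
deriving DecidableEq

/-- A tree in prefix notation; `0` stands for an inner node. -/
def Tree.flat : Tree → List ℕ
  | .atom n => [n + 1]
  | .node l r => 0 :: (l.flat ++ r.flat)

def Tree.size (d : Tree) : ℕ := d.flat.length

theorem Tree.size_pos (d : Tree) : 0 < d.size := by
  cases d <;> simp [Tree.size, Tree.flat]

@[simp] theorem Tree.size_atom (n : ℕ) : (Tree.atom n).size = 1 := rfl

@[simp] theorem Tree.size_node (l r : Tree) : (Tree.node l r).size = 1 + l.size + r.size := by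
  simp [Tree.size, Tree.flat]; omega

theorem Tree.length_reverse_flat (d : Tree) : d.flat.reverse.length = d.size := by
  simp [Tree.size]

/-- Prefix notation is self-delimiting. Thus equality of trees can be decided by comparing the
symbols on two stacks. -/
theorem Tree.flat_append_inj : ∀ (d e : Tree) (u v : List ℕ),
    d.flat ++ u = e.flat ++ v → d = e ∧ u = v
  | .atom m, .atom n, u, v, h => by simpa [Tree.flat] using h
  | .atom m, .node l r, u, v, h => by simp [Tree.flat] at h
  | .node l r, .atom n, u, v, h => by simp [Tree.flat] at h
  | .node l r, .node l' r', u, v, h => by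
    simp only [Tree.flat, List.cons_append, List.append_assoc, List.cons.injEq, true_and] at h
    obtain ⟨h₁, h₂⟩ := Tree.flat_append_inj l l' _ _ h
    obtain ⟨h₃, h₄⟩ := Tree.flat_append_inj r r' _ _ h₂
    exact ⟨by rw [h₁, h₃], h₄⟩

theorem Tree.flat_injective : Function.Injective Tree.flat := fun d e h =>
  (Tree.flat_append_inj d e [] [] (by rw [h])).1

/-- The stack that holds a list of trees. -/
def forest (vs : List Tree) : List ℕ := vs.flatMap Tree.flat

@[simp] theorem forest_nil : forest [] = [] := rfl

@[simp] theorem forest_cons (v : Tree) (vs : List Tree) : forest (v :: vs) = v.flat ++ forest vs :=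
  rfl

/-- The internal stacks: the main one, a counter, and three auxiliary ones. -/
def regs (m c x y z : List ℕ) : Reg → List ℕ := ![m, c, x, y, z]

section Regs
variable (m c x y z w : List ℕ)
@[simp] theorem regs_zero : regs m c x y z 0 = m := rfl
@[simp] theorem regs_one : regs m c x y z 1 = c := rfl
@[simp] theorem regs_two : regs m c x y z 2 = x := rfl
@[simp] theorem regs_three : regs m c x y z 3 = y := rfl
@[simp] theorem regs_four : regs m c x y z 4 = z := rfl
@[simp] theorem update_regs_zero : Function.update (regs m c x y z) 0 w = regs w c x y z := by
  funext r; fin_cases r <;> rfl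
@[simp] theorem update_regs_one : Function.update (regs m c x y z) 1 w = regs m w x y z := by
  funext r; fin_cases r <;> rfl
@[simp] theorem update_regs_two : Function.update (regs m c x y z) 2 w = regs m c w y z := by
  funext r; fin_cases r <;> rfl
@[simp] theorem update_regs_three : Function.update (regs m c x y z) 3 w = regs m c x w z := by
  funext r; fin_cases r <;> rfl
@[simp] theorem update_regs_four : Function.update (regs m c x y z) 4 w = regs m c x y w := by
  funext r; fin_cases r <;> rfl
end Regs

/-- A state with empty input and output. -/
def st (m c x y z : List ℕ) (u v : Option ℕ) : State := ⟨[], [], regs m c x y z, u, v⟩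

/-- The state that holds the trees `vs` on the main stack. -/
def cfg (vs : List Tree) : State := st (forest vs) [] [] [] [] none none

/-- Moves all of the stack `i` to the stack `j`, in reverse order. -/
def moveAll (i j : Reg) : Prog := .loop (some i) .isSome (.op (.push j))

theorem moveAll_run {i j : Reg} (hij : i ≠ j) (l : List ℕ) (s : State) (hl : s.stk i = l) :
    RunLe (moveAll i j) s (2 * l.length + 1)
      { s with
        stk := Function.update (Function.update s.stk i []) j (l.reverse ++ s.stk j)
        buf := none } := by
  induction l generalizing s with
  | nil =>
    refine RunLe.loop_exit ?_ rfl
    simp only [State.pop, hl, List.tail_nil, List.head?_nil, List.reverse_nil, List.nil_append]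
    congr 1
    rw [eq_comm, Function.update_eq_self_iff, Function.update_of_ne hij.symm]
  | cons a l ih =>
    have h := ih { s with
        stk := Function.update (Function.update s.stk i l) j (a :: s.stk j)
        buf := some a } (by simp [Function.update_of_ne hij])
    refine RunLe.mono (T := 1 + (1 + (2 * l.length + 1))) (RunLe.loop_step (s := s) rfl
      (by simp [State.pop, hl, Test.holds]) (RunLe.op rfl) (?_ : RunLe (moveAll i j) _ _ _)) (by simp; omega)
    convert h using 1
    · simp [State.pop, Op.apply, hl, Function.update_of_ne hij.symm]
    · congr 1
      simp only [Function.update_self, List.reverse_cons, List.append_assoc, List.cons_append,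
        List.nil_append]
      rw [Function.update_comm hij.symm]
      simp

/-- Empties the stack `i`. -/
def clearAll (i : Reg) : Prog := .loop (some i) .isSome (.op .clear)

theorem clearAll_run {i : Reg} (l : List ℕ) (s : State) (hl : s.stk i = l) (hb : s.buf2 = none) :
    RunLe (clearAll i) s (2 * l.length + 1)
      { s with stk := Function.update s.stk i [], buf := none } := by
  induction l generalizing s with
  | nil =>
    refine RunLe.loop_exit ?_ rfl
    simp only [State.pop, hl, List.tail_nil, List.head?_nil]
  | cons a l ih =>
    have h := ih { s with stk := Function.update s.stk i l, buf := none } (by simp) hb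
    refine RunLe.mono (T := 1 + (1 + (2 * l.length + 1))) (RunLe.loop_step (s := s) rfl
      (by simp [State.pop, hl, Test.holds]) (RunLe.op rfl) (?_ : RunLe (clearAll i) _ _ _)) (by simp; omega)
    convert h using 1
    · simp [State.pop, Op.apply, hl, hb]
    · simp

/-- Stacks given by their values at `0`, `1`, `i` and a function. -/
def frame (i : Reg) (f : Reg → List ℕ) (m c x : List ℕ) : Reg → List ℕ := fun r =>
  if r = 0 then m else if r = 1 then c else if r = i then x else f r

theorem update_frame_zero (i : Reg) (f : Reg → List ℕ) (m c x w : List ℕ) :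
    Function.update (frame i f m c x) 0 w = frame i f w c x := by
  funext r
  by_cases h : r = 0
  · subst h; simp [frame]
  · simp [frame, h]

theorem update_frame_one (i : Reg) (f : Reg → List ℕ) (m c x w : List ℕ) :
    Function.update (frame i f m c x) 1 w = frame i f m w x := by
  funext r
  by_cases h : r = 1
  · subst h; simp [frame]
  · simp [frame, h]

theorem update_frame {i : Reg} (h₀ : i ≠ 0) (h₁ : i ≠ 1) (f : Reg → List ℕ) (m c x w : List ℕ) :
    Function.update (frame i f m c x) i w = frame i f m c w := by
  funext r
  by_cases h : r = i
  · subst h; simp [frame, h₀, h₁]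
  · simp [frame, h]

/-- Moves the top tree of the main stack to the stack `i`, in reverse order. -/
def moveTreeLoop (i : Reg) : Prog :=
  .loop (some 1) .isSome (.seq (.op (.pop (some 0))) (.seq (.op (.push i))
    (.ite (.isConst 0) (.seq (.op (.pushc 1 0)) (.op (.pushc 1 0))) (.op .clear))))

/-- The counter holds one mark for each tree that is still to be moved. A leaf uses up its mark; an
inner node trades its mark for two, one for each subtree. Each symbol costs at most 6 steps, whence
the induction on the number of symbols. -/
theorem moveTreeLoop_run {i : Reg} (h₀ : i ≠ 0) (h₁ : i ≠ 1) (f : Reg → List ℕ) (rest : List ℕ)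
    (inp out : List ℕ) :
    ∀ (n : ℕ) (vs : List Tree) (x : List ℕ) (u : Option ℕ), (forest vs).length = n →
      RunLe (moveTreeLoop i)
        ⟨inp, out, frame i f (forest vs ++ rest) (List.replicate vs.length 0) x, u, none⟩
        (6 * n + 1) ⟨inp, out, frame i f rest [] ((forest vs).reverse ++ x), none, none⟩ := by
  intro n
  induction n using Nat.strong_induction_on with
  | _ n ih =>
  intro vs x u hn
  rcases vs with - | ⟨a | ⟨l, r⟩, vs⟩
  · refine (RunLe.loop_exit ?_ rfl).mono (by omega)
    simp only [State.pop, forest_nil, List.nil_append, List.length_nil, List.replicate_zero]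
    rw [update_frame_one]
    rfl
  · have hlen : (forest vs).length + 1 = n := by
      rw [← hn]; simp [Tree.flat]
    have h := ih (forest vs).length (by omega) vs ((a + 1) :: x) none rfl
    refine RunLe.mono (T := 1 + (4 + (6 * (forest vs).length + 1))) (RunLe.loop_step
      (s₀ := ⟨inp, out, frame i f (forest (Tree.atom a :: vs) ++ rest)
        (List.replicate vs.length 0) x, some 0, none⟩)
      ?_ rfl (RunLe.mono (RunLe.seq (RunLe.op rfl)
        (RunLe.seq (RunLe.op rfl) (RunLe.ite_false ?_ (RunLe.op rfl)))) (by omega)) (?_ : RunLe (moveTreeLoop i) _ _ _))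
          (by omega)
    · simp only [State.pop, update_frame_one]; rfl
    · simp [Op.apply, State.pop, frame, Test.holds, Tree.flat]
    · convert h using 1
      · simp only [Op.apply, State.pop]
        rw [update_frame_zero, update_frame h₀ h₁]
        simp [frame, Tree.flat, h₀, h₁]
      · simp [Tree.flat]
  · have hlen : (forest (l :: r :: vs)).length + 1 = n := by
      rw [← hn]; simp [Tree.flat, Nat.add_assoc]
    have h := ih (forest (l :: r :: vs)).length (by omega) (l :: r :: vs) (0 :: x) (some 0) rfl
    refine RunLe.mono (T := 1 + (5 + (6 * (forest (l :: r :: vs)).length + 1))) (RunLe.loop_step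
      (s₀ := ⟨inp, out, frame i f (forest (Tree.node l r :: vs) ++ rest)
        (List.replicate vs.length 0) x, some 0, none⟩)
      ?_ rfl (RunLe.mono (RunLe.seq (RunLe.op rfl) (RunLe.seq (RunLe.op rfl)
        (RunLe.ite_true ?_ (RunLe.seq (RunLe.op rfl) (RunLe.op rfl))))) (by omega))
          (?_ : RunLe (moveTreeLoop i) _ _ _)) (by omega)
    · simp only [State.pop, update_frame_one]; rfl
    · simp [Op.apply, State.pop, frame, Test.holds, Tree.flat]
    · convert h using 1
      · simp only [Op.apply, State.pop]
        rw [update_frame_zero, update_frame h₀ h₁, update_frame_one, update_frame_one]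
        simp [frame, Tree.flat, h₀, h₁, List.replicate_succ]
      · simp [Tree.flat]

def moveTree (i : Reg) : Prog := .seq (.op (.pushc 1 0)) (moveTreeLoop i)

theorem moveTree_run {i : Reg} (h₀ : i ≠ 0) (h₁ : i ≠ 1) (d : Tree) (rest x y z : List ℕ) :
    RunLe (moveTree i) (st (d.flat ++ rest) [] x y z none none) (6 * d.size + 2)
      { st rest [] x y z none none with
        stk := Function.update (regs rest [] x y z) i (d.flat.reverse ++ regs rest [] x y z i) } := by
  have hf : ∀ m c, regs m c x y z = frame i (regs m c x y z) m c (regs m c x y z i) := by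
    intro m c
    funext r
    simp only [frame]
    split_ifs with a b c
    · rw [a]; rfl
    · rw [b]; rfl
    · rw [c]
    · rfl
  have h := moveTreeLoop_run h₀ h₁ (regs rest [] x y z) rest [] [] _ [d] (regs rest [] x y z i)
    none rfl
  refine RunLe.mono (T := 1 + (6 * d.size + 1)) (RunLe.seq (RunLe.op (s' := ⟨[], [],
    frame i (regs rest [] x y z) (forest [d] ++ rest) (List.replicate 1 0)
      (regs rest [] x y z i), none, none⟩) ?_) ?_) (by omega)
  · simp only [Op.apply, st]
    congr 1
    funext r
    fin_cases r <;> simp [frame]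
    all_goals intro h; subst h; rfl
  · convert h using 1
    · rfl
    · simp [Tree.size]
    simp only [st]
    congr 1
    conv_lhs => rw [hf rest []]
    rw [update_frame h₀ h₁]
    simp [frame, h₀, h₁]

/-! ### Elementary programs on the trees of the main stack -/

def dropProg : Prog := .seq (moveTree 2) (clearAll 2)

theorem dropProg_run (v : Tree) (vs : List Tree) :
    RunLe dropProg (cfg (v :: vs)) (8 * v.size + 3) (cfg vs) := by
  have h₁ := moveTree_run (i := 2) (by decide) (by decide) v (forest vs) [] [] []
  refine (h₁.seq (t₂ := 2 * v.size + 1) ?_).mono (by omega)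
  have h₂ := clearAll_run (i := 2) v.flat.reverse
    (st (forest vs) [] v.flat.reverse [] [] none none) rfl rfl
  simpa [st, cfg, Tree.size] using h₂

def swapProg : Prog :=
  .seq (moveTree 2) (.seq (moveTree 3) (.seq (moveAll 2 0) (moveAll 3 0)))

theorem swapProg_run (v w : Tree) (vs : List Tree) :
    RunLe swapProg (cfg (v :: w :: vs)) (8 * (v.size + w.size) + 6) (cfg (w :: v :: vs)) := by
  have h₁ := moveTree_run (i := 2) (by decide) (by decide) v (w.flat ++ forest vs) [] [] []
  have h₂ := moveTree_run (i := 3) (by decide) (by decide) w (forest vs) v.flat.reverse [] []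
  have h₃ := moveAll_run (i := 2) (j := 0) (by decide) v.flat.reverse
    (st (forest vs) [] v.flat.reverse w.flat.reverse [] none none) rfl
  have h₄ := moveAll_run (i := 3) (j := 0) (by decide) w.flat.reverse
    (st (v.flat ++ forest vs) [] [] w.flat.reverse [] none none) rfl
  simp only [Tree.length_reverse_flat] at h₃ h₄
  simp only [st, update_regs_two, update_regs_three, update_regs_zero, regs_two, regs_three,
    regs_zero, List.append_nil, List.reverse_reverse] at h₁ h₂ h₃ h₄
  exact (h₁.seq (h₂.seq (h₃.seq h₄))).mono (by omega)

/-- Brings the third tree to the top. -/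
def rotProg : Prog :=
  .seq (moveTree 2) (.seq (moveTree 3) (.seq (moveTree 4)
    (.seq (moveAll 3 0) (.seq (moveAll 2 0) (moveAll 4 0)))))

theorem rotProg_run (u v w : Tree) (vs : List Tree) :
    RunLe rotProg (cfg (u :: v :: w :: vs)) (8 * (u.size + v.size + w.size) + 9)
      (cfg (w :: u :: v :: vs)) := by
  have h₁ := moveTree_run (i := 2) (by decide) (by decide) u (v.flat ++ (w.flat ++ forest vs))
    [] [] []
  have h₂ := moveTree_run (i := 3) (by decide) (by decide) v (w.flat ++ forest vs)
    u.flat.reverse [] []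
  have h₃ := moveTree_run (i := 4) (by decide) (by decide) w (forest vs) u.flat.reverse
    v.flat.reverse []
  have h₄ := moveAll_run (i := 3) (j := 0) (by decide) v.flat.reverse
    (st (forest vs) [] u.flat.reverse v.flat.reverse w.flat.reverse none none) rfl
  have h₅ := moveAll_run (i := 2) (j := 0) (by decide) u.flat.reverse
    (st (v.flat ++ forest vs) [] u.flat.reverse [] w.flat.reverse none none) rfl
  have h₆ := moveAll_run (i := 4) (j := 0) (by decide) w.flat.reverse
    (st (u.flat ++ (v.flat ++ forest vs)) [] [] [] w.flat.reverse none none) rfl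
  simp only [Tree.length_reverse_flat] at h₄ h₅ h₆
  simp only [st, update_regs_two, update_regs_three, update_regs_four, update_regs_zero, regs_two,
    regs_three, regs_four, regs_zero, List.append_nil, List.reverse_reverse] at h₁ h₂ h₃ h₄ h₅ h₆
  exact (h₁.seq (h₂.seq (h₃.seq (h₄.seq (h₅.seq h₆))))).mono (by omega)

/-- Pours the stack `2` onto the stacks `0` and `3`. -/
def pourProg : Prog := .loop (some 2) .isSome (.seq (.op (.push 0)) (.op (.push 3)))

theorem pourProg_run (l m y : List ℕ) (u : Option ℕ) :
    RunLe pourProg (st m [] l y [] u none) (3 * l.length + 1)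
      (st (l.reverse ++ m) [] [] (l.reverse ++ y) [] none none) := by
  induction l generalizing m y u with
  | nil =>
    refine (RunLe.loop_exit ?_ rfl).mono (by omega)
    simp [State.pop, st]
  | cons a l ih =>
    have h := ih (a :: m) (a :: y) (some a)
    refine RunLe.mono (T := 1 + (1 + 1 + (3 * l.length + 1))) (RunLe.loop_step
      (s₁ := st (a :: m) [] l (a :: y) [] (some a) none) rfl
      (by simp [Test.holds, State.pop, st]) (RunLe.seq (RunLe.op rfl) (RunLe.op ?_))
        (?_ : RunLe pourProg _ _ _))
        (by simp; omega)
    · simp [st, Op.apply, State.pop]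
    · simpa using h

def dupProg : Prog :=
  .seq (moveTree 2) (.seq pourProg (.seq (moveAll 3 2) (moveAll 2 0)))

theorem dupProg_run (v : Tree) (vs : List Tree) :
    RunLe dupProg (cfg (v :: vs)) (13 * v.size + 5) (cfg (v :: v :: vs)) := by
  have h₁ := moveTree_run (i := 2) (by decide) (by decide) v (forest vs) [] [] []
  have h₂ := pourProg_run v.flat.reverse (forest vs) [] none
  have h₃ := moveAll_run (i := 3) (j := 2) (by decide) v.flat
    (st (v.flat ++ forest vs) [] [] v.flat [] none none) rfl
  have h₄ := moveAll_run (i := 2) (j := 0) (by decide) v.flat.reverse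
    (st (v.flat ++ forest vs) [] v.flat.reverse [] [] none none) rfl
  simp only [Tree.length_reverse_flat] at h₂ h₄
  simp only [st, update_regs_two, update_regs_three, update_regs_zero, regs_two,
    regs_zero, List.append_nil, List.reverse_reverse] at h₁ h₂ h₃ h₄
  refine (h₁.seq (h₂.seq (h₃.seq h₄))).mono ?_
  simp only [Tree.size]
  omega

def nodeProg : Prog := .op (.pushc 0 0)

theorem nodeProg_run (v w : Tree) (vs : List Tree) :
    RunLe nodeProg (cfg (v :: w :: vs)) 1 (cfg (.node v w :: vs)) := by
  refine RunLe.op ?_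
  simp [Op.apply, cfg, st, Tree.flat]

def unnodeProg : Prog := .seq (.op (.pop (some 0))) (.op .clear)

theorem unnodeProg_run (v w : Tree) (vs : List Tree) :
    RunLe unnodeProg (cfg (.node v w :: vs)) 2 (cfg (v :: w :: vs)) := by
  refine RunLe.seq (RunLe.op rfl) (RunLe.op ?_)
  simp [Op.apply, State.pop, cfg, st, Tree.flat]

/-- Pushes a fixed tree. -/
def pushProg : Tree → Prog
  | .atom n => .op (.pushc 0 (n + 1))
  | .node l r => .seq (pushProg r) (.seq (pushProg l) nodeProg)

theorem pushProg_run (v : Tree) (vs : List Tree) :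
    RunLe (pushProg v) (cfg vs) v.size (cfg (v :: vs)) := by
  induction v generalizing vs with
  | atom n =>
    refine RunLe.op ?_
    simp [Op.apply, cfg, st, Tree.flat]
  | node l r ihl ihr =>
    exact ((ihr vs).seq ((ihl _).seq (nodeProg_run l r vs))).mono (by simp; omega)

/-- Runs `p` or `q`, as the top tree is `atom 1` or another atom. -/
def condProg (p q : Prog) : Prog :=
  -- A leaf `n` is stored as `n + 1`, so that `atom 1` appears as the symbol 2.
  .seq (.op (.pop (some 0))) (.ite (.isConst 2) (.seq (.op .clear) p) (.seq (.op .clear) q))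

theorem condProg_true {p : Prog} (q : Prog) {vs ws : List Tree} {t : ℕ}
    (h : RunLe p (cfg vs) t (cfg ws)) :
    RunLe (condProg p q) (cfg (.atom 1 :: vs)) (t + 3) (cfg ws) := by
  refine (RunLe.seq (RunLe.op rfl) (RunLe.ite_true (t := 1 + t) ?_
    (RunLe.seq (RunLe.op ?_) h))).mono (by omega)
  · simp [Test.holds, Op.apply, State.pop, cfg, st, Tree.flat]
  · simp [Op.apply, State.pop, cfg, st, Tree.flat]

theorem condProg_false (p : Prog) {q : Prog} {vs ws : List Tree} {t : ℕ}
    (h : RunLe q (cfg vs) t (cfg ws)) :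
    RunLe (condProg p q) (cfg (.atom 0 :: vs)) (t + 3) (cfg ws) := by
  refine (RunLe.seq (RunLe.op rfl) (RunLe.ite_false (t := 1 + t) ?_
    (RunLe.seq (RunLe.op ?_) h))).mono (by omega)
  · simp [Test.holds, Op.apply, State.pop, cfg, st, Tree.flat]
  · simp [Op.apply, State.pop, cfg, st, Tree.flat]

/-- Runs `p` on the two parts if the top tree is a node, and drops it and runs `q` otherwise. -/
def caseProg (p q : Prog) : Prog :=
  .seq (.op (.pop (some 0))) (.ite (.isConst 0) (.seq (.op .clear) p) (.seq (.op .clear) q))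

theorem caseProg_node {p : Prog} (q : Prog) {v w : Tree} {vs ws : List Tree} {t : ℕ}
    (h : RunLe p (cfg (v :: w :: vs)) t (cfg ws)) :
    RunLe (caseProg p q) (cfg (.node v w :: vs)) (t + 3) (cfg ws) := by
  refine (RunLe.seq (RunLe.op rfl) (RunLe.ite_true (t := 1 + t) ?_
    (RunLe.seq (RunLe.op ?_) h))).mono (by omega)
  · simp [Test.holds, Op.apply, State.pop, cfg, st, Tree.flat]
  · simp [Op.apply, State.pop, cfg, st, Tree.flat]

theorem caseProg_atom (p : Prog) {q : Prog} {n : ℕ} {vs ws : List Tree} {t : ℕ}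
    (h : RunLe q (cfg vs) t (cfg ws)) :
    RunLe (caseProg p q) (cfg (.atom n :: vs)) (t + 3) (cfg ws) := by
  refine (RunLe.seq (RunLe.op rfl) (RunLe.ite_false (t := 1 + t) ?_
    (RunLe.seq (RunLe.op ?_) h))).mono (by omega)
  · simp [Test.holds, Op.apply, State.pop, cfg, st, Tree.flat]
  · simp [Op.apply, State.pop, cfg, st, Tree.flat]

/-- Repeats `p` on the two parts of the top tree as long as that is a node, and drops it then. -/
def whileProg (p : Prog) : Prog :=
  .seq (.loop (some 0) (.isConst 0) (.seq (.op .clear) p)) (.op .clear)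

/-- Unrolls one iteration. The given run of the whole program is split into its loop and the final
clearing, and the iteration is put in front of the loop. -/
theorem whileProg_node {p : Prog} {v w : Tree} {vs us ws : List Tree} {t₁ t₂ : ℕ}
    (h₁ : RunLe p (cfg (v :: w :: vs)) t₁ (cfg us))
    (h₂ : RunLe (whileProg p) (cfg us) t₂ (cfg ws)) :
    RunLe (whileProg p) (cfg (.node v w :: vs)) (t₁ + t₂ + 2) (cfg ws) := by
  obtain ⟨t, ht, hr⟩ := h₂
  cases hr with
  | @seq _ _ _ s₂ _ u₁ u₂ r₁ r₂ =>
    refine (RunLe.seq (RunLe.loop_step rfl ?_ (RunLe.seq (RunLe.op ?_) h₁)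
      ⟨_, le_rfl, r₁⟩) ⟨_, le_rfl, r₂⟩).mono (by omega)
    · simp [Test.holds, State.pop, cfg, st, Tree.flat]
    · simp [Op.apply, State.pop, cfg, st, Tree.flat]

theorem whileProg_atom (p : Prog) (n : ℕ) (vs : List Tree) :
    RunLe (whileProg p) (cfg (.atom n :: vs)) 2 (cfg vs) := by
  refine RunLe.seq (RunLe.loop_exit rfl ?_) (RunLe.op ?_)
  · simp [Test.holds, State.pop, cfg, st, Tree.flat]
  · simp [Op.apply, State.pop, cfg, st, Tree.flat]

/-- Compares the stacks `2` and `3` and marks each difference on the counter. -/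
def compareProg : Prog :=
  .seq (.loop (some 2) .isSome (.seq (.op .save) (.seq (.op (.pop (some 3)))
    (.ite .eqBuf (.op .clear) (.seq (.op (.pushc 1 0)) (.op .clear))))))
    (.loop (some 3) .isSome (.op (.pushc 1 0)))

theorem compareProg_run₂ (m l c : List ℕ) (u : Option ℕ) :
    ∃ c', RunLe (.loop (some 3) .isSome (.op (.pushc 1 0))) (st m c [] l [] u none)
      (2 * l.length + 1) (st m c' [] [] [] none none) ∧ c'.length = c.length + l.length := by
  induction l generalizing c u with
  | nil =>
    refine ⟨c, (RunLe.loop_exit ?_ rfl).mono (by omega), rfl⟩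
    simp [State.pop, st]
  | cons a l ih =>
    obtain ⟨c', h, hc⟩ := ih (0 :: c) (some a)
    refine ⟨c', (RunLe.loop_step (t₁ := 1) (t₂ := 2 * l.length + 1) (s₁ := st m (0 :: c) [] l []
      (some a) none) rfl rfl (RunLe.op ?_) h).mono (by simp; omega), by simp at hc ⊢; omega⟩
    simp [State.pop, Op.apply, st]

/-- Each position where the stacks differ, and each symbol of the second stack left over, puts a
mark on the counter, so an empty counter certifies equality. The mark is independent of the rest,
which makes a plain induction on the first stack possible. -/
theorem compareProg_run (m l l' : List ℕ) (c : List ℕ) (u : Option ℕ) :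
    ∃ c', RunLe compareProg (st m c l l' [] u none)
      (7 * (l.length + l'.length) + 2) (st m c' [] [] [] none none) ∧
      (c' = [] ↔ c = [] ∧ l = l') ∧ c'.length ≤ c.length + l.length + l'.length := by
  suffices H : ∃ c₁ l₁, RunLe (.loop (some 2) .isSome (.seq (.op .save) (.seq (.op (.pop (some 3)))
      (.ite .eqBuf (.op .clear) (.seq (.op (.pushc 1 0)) (.op .clear))))))
      (st m c l l' [] u none) (7 * l.length + 1) (st m c₁ [] l₁ [] none none) ∧
      (c₁ = [] ∧ l₁ = [] ↔ c = [] ∧ l = l') ∧ c₁.length ≤ c.length + l.length ∧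
      l₁.length ≤ l'.length by
    obtain ⟨c₁, l₁, h₁, h₂, h₃, h₄⟩ := H
    obtain ⟨c', h₅, h₆⟩ := compareProg_run₂ m l₁ c₁ none
    refine ⟨c', (h₁.seq h₅).mono (by omega), ?_, by omega⟩
    rw [← h₂, ← List.length_eq_zero_iff, h₆, ← List.length_eq_zero_iff, ← List.length_eq_zero_iff]
    omega
  induction l generalizing l' c u with
  | nil =>
    refine ⟨c, l', (RunLe.loop_exit ?_ rfl).mono (by omega), ?_, by simp, le_rfl⟩
    · simp [State.pop, st]
    · rw [eq_comm (a := l')]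
  | cons a l ih =>
    by_cases hl : l'.head? = some a
    · obtain ⟨l'', rfl⟩ : ∃ l'', l' = a :: l'' := by
        cases l' with
        | nil => simp at hl
        | cons b l'' => exact ⟨l'', by simpa using hl⟩
      obtain ⟨c₁, l₁, h₁, h₂, h₃, h₄⟩ := ih l'' c none
      refine ⟨c₁, l₁, (RunLe.loop_step (t₁ := 6) (t₂ := 7 * l.length + 1) rfl rfl
        ((RunLe.seq (RunLe.op rfl) (RunLe.seq (RunLe.op rfl) (RunLe.ite_true ?_
          (RunLe.op ?_)))).mono ?_) h₁).mono ?_, ?_, ?_, ?_⟩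
      · simp [State.pop, st, Op.apply, Test.holds]
      · simp [State.pop, st, Op.apply]
      · omega
      · simp; omega
      · simp [h₂]
      · simp; omega
      · simp; omega
    · obtain ⟨c₁, l₁, h₁, h₂, h₃, h₄⟩ := ih l'.tail (0 :: c) none
      refine ⟨c₁, l₁, (RunLe.loop_step (t₁ := 6) (t₂ := 7 * l.length + 1) rfl rfl
        ((RunLe.seq (RunLe.op rfl) (RunLe.seq (RunLe.op rfl) (RunLe.ite_false ?_
          (RunLe.seq (RunLe.op rfl) (RunLe.op ?_))))).mono ?_) h₁).mono ?_, ?_, ?_, ?_⟩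
      · simpa [State.pop, st, Op.apply, Test.holds] using hl
      · simp [State.pop, st, Op.apply]
      · omega
      · simp; omega
      · rw [h₂]
        simp only [reduceCtorEq, false_and, false_iff, not_and]
        rintro - rfl
        simp at hl
      · simp at h₃ ⊢; omega
      · simp at h₄; omega

/-- Replaces the top two trees by `atom 1` if they are equal and by `atom 0` otherwise. -/
def eqProg : Prog :=
  .seq (moveTree 2) (.seq (moveTree 3) (.seq compareProg (.seq (.op (.pop (some 1)))
    (.ite .isSome (.seq (clearAll 1) (.op (.pushc 0 1))) (.op (.pushc 0 2))))))

theorem eqProg_run (v w : Tree) (vs : List Tree) :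
    RunLe eqProg (cfg (v :: w :: vs)) (15 * (v.size + w.size) + 10)
      (cfg (.atom (if v = w then 1 else 0) :: vs)) := by
  have h₁ := moveTree_run (i := 2) (by decide) (by decide) v (w.flat ++ forest vs) [] [] []
  have h₂ := moveTree_run (i := 3) (by decide) (by decide) w (forest vs) v.flat.reverse [] []
  obtain ⟨c, h₃, h₄, h₅⟩ := compareProg_run (forest vs) v.flat.reverse w.flat.reverse [] none
  simp only [Tree.length_reverse_flat, List.length_nil] at h₃ h₅
  simp only [st, update_regs_two, update_regs_three, regs_two, regs_three,
    List.append_nil] at h₁ h₂ h₃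
  refine ((h₁.seq (h₂.seq (h₃.seq (RunLe.seq (RunLe.op rfl)
    (?_ : RunLe _ _ (2 * (v.size + w.size) + 3) _)))))).mono (by omega)
  by_cases h : v = w
  · rw [if_pos h]
    obtain rfl : c = [] := h₄.2 ⟨rfl, by rw [h]⟩
    refine (RunLe.ite_false rfl (RunLe.op ?_)).mono (by omega)
    simp [Op.apply, State.pop, cfg, st, Tree.flat]
  · rw [if_neg h]
    have hc : c ≠ [] := fun hc => h (Tree.flat_injective (List.reverse_injective (h₄.1 hc).2))
    obtain ⟨a, c', rfl⟩ := List.exists_cons_of_ne_nil hc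
    have h₆ := clearAll_run (i := 1) c' (st (forest vs) c' [] [] [] (some a) none) rfl rfl
    refine (RunLe.ite_true ?_ (RunLe.seq (t₁ := 2 * c'.length + 1)
      (s₂ := st (forest vs) [] [] [] [] none none) ?_ (RunLe.op ?_))).mono ?_
    · simp [Op.apply, State.pop, Test.holds]
    · simpa [Op.apply, State.pop, st] using h₆
    · simp [Op.apply, cfg, st, Tree.flat]
    · simp at h₅; omega

end StackProg

/-! ### Functions computable in polynomial time -/

namespace StackProg

/-- Types whose elements are represented by trees. -/
class Enc (α : Type) where
  enc : α → Tree
  enc_injective : Function.Injective enc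

open Enc (enc)

/-- The size of the representation of an object. -/
def size {α : Type} [Enc α] (a : α) : ℕ := (enc a).size

/-- Symbols, represented by leaves. -/
@[ext] structure Atom where
  id : ℕ
deriving DecidableEq

instance : Enc Atom := ⟨fun a => .atom a.id, fun _ _ h => Atom.ext (Tree.atom.inj h)⟩

instance : Enc Bool := ⟨fun b => .atom b.toNat, fun a b h => by
  cases a <;> cases b <;> simp_all⟩

instance {α β : Type} [Enc α] [Enc β] : Enc (α × β) :=
  ⟨fun p => .node (enc p.1) (enc p.2), fun p q h => by
    injection h with h₁ h₂
    exact Prod.ext (Enc.enc_injective h₁) (Enc.enc_injective h₂)⟩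

def encList {α : Type} [Enc α] : List α → Tree
  | [] => .atom 0
  | a :: l => .node (enc a) (encList l)

theorem encList_injective {α : Type} [Enc α] :
    ∀ l m : List α, encList l = encList m → l = m
  | [], [], _ => rfl
  | [], _ :: _, h => by simp [encList] at h
  | _ :: _, [], h => by simp [encList] at h
  | a :: l, b :: m, h => by
    injection h with h₁ h₂
    rw [Enc.enc_injective h₁, encList_injective l m h₂]

instance {α : Type} [Enc α] : Enc (List α) := ⟨encList, fun l m => encList_injective l m⟩

def encNat : ℕ → Tree
  | 0 => .atom 0
  | n + 1 => .node (.atom 0) (encNat n)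

theorem encNat_injective : ∀ m n : ℕ, encNat m = encNat n → m = n
  | 0, 0, _ => rfl
  | 0, _ + 1, h => by simp [encNat] at h
  | _ + 1, 0, h => by simp [encNat] at h
  | m + 1, n + 1, h => by
    injection h with h₁ h₂
    rw [encNat_injective m n h₂]

/-- Natural numbers are represented in unary. -/
instance : Enc ℕ := ⟨encNat, fun m n => encNat_injective m n⟩

section Size
variable {α β : Type} [Enc α] [Enc β]

theorem size_pos (a : α) : 0 < size a := Tree.size_pos _

@[simp] theorem size_atom (a : Atom) : size a = 1 := rfl
@[simp] theorem size_bool (b : Bool) : size b = 1 := rfl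
@[simp] theorem size_pair (p : α × β) : size p = 1 + size p.1 + size p.2 := Tree.size_node _ _
@[simp] theorem size_nil : size ([] : List α) = 1 := rfl
@[simp] theorem size_cons (a : α) (l : List α) : size (a :: l) = 1 + size a + size l :=
  Tree.size_node _ _
@[simp] theorem size_nat (n : ℕ) : size n = 2 * n + 1 := by
  induction n with
  | zero => rfl
  | succ n ih =>
    have : size (n + 1) = 1 + 1 + size n := Tree.size_node _ _
    omega

theorem length_le_size (l : List α) : l.length ≤ size l := by
  induction l with
  | nil => simp
  | cons a l ih => simp; omega

theorem size_append (l m : List α) : size (l ++ m) + 1 = size l + size m := by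
  induction l with
  | nil => simp; omega
  | cons a l ih => simp; omega

theorem size_prefix {l m : List α} (h : l <+: m) : size l ≤ size m := by
  obtain ⟨t, rfl⟩ := h
  have := size_append l t
  have := size_pos t
  omega

theorem size_sublist {l m : List α} (h : l.Sublist m) : size l ≤ size m := by
  induction h with
  | slnil => exact le_rfl
  | cons a _ ih => simp; omega
  | cons_cons a _ ih => simp; omega

end Size

theorem eval_mono (p : Polynomial ℕ) {m n : ℕ} (h : m ≤ n) : p.eval m ≤ p.eval n := by
  induction p using Polynomial.induction_on' with
  | add p q hp hq => simpa using Nat.add_le_add hp hq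
  | monomial k a =>
    simp only [Polynomial.eval_monomial]
    exact Nat.mul_le_mul_left _ (Nat.pow_le_pow_left h k)

/-- `f` is computed by a program in polynomial time, as a function of the top of the stack. -/
def PolyTime {α β : Type} [Enc α] [Enc β] (f : α → β) : Prop :=
  ∃ (c : Prog) (p : Polynomial ℕ), ∀ a, size (f a) ≤ p.eval (size a) ∧
    ∀ vs, RunLe c (cfg (enc a :: vs)) (p.eval (size a)) (cfg (enc (f a) :: vs))

/-- The size of `f a` is bounded by a polynomial in the size of `a`. -/
def PolySize {α β : Type} [Enc α] [Enc β] (f : α → β) : Prop :=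
  ∃ p : Polynomial ℕ, ∀ a, size (f a) ≤ p.eval (size a)

namespace PolyTime

variable {α β γ δ : Type} [Enc α] [Enc β] [Enc γ] [Enc δ]

theorem polySize {f : α → β} (h : PolyTime f) : PolySize f := by
  obtain ⟨_, p, hp⟩ := h
  exact ⟨p, fun a => (hp a).1⟩

theorem of_eq {f g : α → β} (hf : PolyTime f) (h : ∀ a, f a = g a) : PolyTime g :=
  (funext h : f = g) ▸ hf

/-- Functions with the same values up to representation. -/
theorem of_enc {f : α → β} {g : α → γ} (hf : PolyTime f) (h : ∀ a, enc (f a) = enc (g a)) :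
    PolyTime g := by
  obtain ⟨c, p, hp⟩ := hf
  refine ⟨c, p, fun a => ?_⟩
  simp only [size, ← h]
  exact hp a

protected theorem id : PolyTime (fun a : α => a) :=
  -- There is no empty program; clearing buffers that are already empty changes nothing.
  ⟨.op .clear, .X + 1, fun a => ⟨by simp, fun vs => (RunLe.op rfl).mono (by simp)⟩⟩

theorem comp {g : β → γ} {f : α → β} (hg : PolyTime g) (hf : PolyTime f) :
    PolyTime (fun a => g (f a)) := by
  obtain ⟨cf, pf, hf⟩ := hf
  obtain ⟨cg, pg, hg⟩ := hg
  refine ⟨.seq cf cg, pf + pg.comp pf, fun a => ?_⟩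
  have h₁ := eval_mono pg (hf a).1
  have h₂ := (hg (f a)).1
  simp only [Polynomial.eval_add, Polynomial.eval_comp]
  exact ⟨by omega, fun vs => (((hf a).2 vs).seq ((hg _).2 vs)).mono (by omega)⟩

protected theorem const (b : β) : PolyTime (fun _ : α => b) := by
  refine ⟨.seq dropProg (pushProg (enc b)), 8 * .X + 3 + .C (size b), fun a => ?_⟩
  simp only [Polynomial.eval_add, Polynomial.eval_mul, Polynomial.eval_X, Polynomial.eval_ofNat,
    Polynomial.eval_C]
  exact ⟨by omega, fun vs => ((dropProg_run _ _).seq (pushProg_run _ _)).mono le_rfl⟩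

theorem pair {f : α → β} {g : α → γ} (hf : PolyTime f) (hg : PolyTime g) :
    PolyTime (fun a => (f a, g a)) := by
  obtain ⟨cf, pf, hf⟩ := hf
  obtain ⟨cg, pg, hg⟩ := hg
  refine ⟨.seq dupProg (.seq cf (.seq swapProg (.seq cg (.seq swapProg nodeProg)))),
    21 * .X + 18 + 17 * pf + 9 * pg, fun a => ?_⟩
  have hfa := (hf a).1
  have hga := (hg a).1
  simp only [Polynomial.eval_add, Polynomial.eval_mul, Polynomial.eval_X, Polynomial.eval_ofNat]
  refine ⟨by simp; omega, fun vs => ?_⟩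
  refine ((dupProg_run _ _).seq (((hf a).2 _).seq ((swapProg_run _ _ _).seq
    (((hg a).2 _).seq ((swapProg_run _ _ _).seq (nodeProg_run _ _ _)))))).mono ?_
  simp only [size] at hfa hga ⊢
  omega

theorem fst : PolyTime (fun p : α × β => p.1) := by
  refine ⟨.seq unnodeProg (.seq swapProg dropProg), 16 * .X + 11, fun p => ?_⟩
  simp only [Polynomial.eval_add, Polynomial.eval_mul, Polynomial.eval_X, Polynomial.eval_ofNat]
  refine ⟨by simp; omega, fun vs => ?_⟩
  refine ((unnodeProg_run _ _ _).seq ((swapProg_run _ _ _).seq (dropProg_run _ _))).mono ?_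
  simp only [size_pair]
  simp only [size]
  omega

theorem snd : PolyTime (fun p : α × β => p.2) := by
  refine ⟨.seq unnodeProg dropProg, 16 * .X + 11, fun p => ?_⟩
  simp only [Polynomial.eval_add, Polynomial.eval_mul, Polynomial.eval_X, Polynomial.eval_ofNat]
  refine ⟨by simp; omega, fun vs => ?_⟩
  refine ((unnodeProg_run _ _ _).seq (dropProg_run _ _)).mono ?_
  simp only [size_pair]
  simp only [size]
  omega

theorem fst' {f : α → β × γ} (hf : PolyTime f) : PolyTime (fun a => (f a).1) := fst.comp hf

theorem snd' {f : α → β × γ} (hf : PolyTime f) : PolyTime (fun a => (f a).2) := snd.comp hf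

protected theorem cons {f : α → β} {l : α → List β} (hf : PolyTime f) (hl : PolyTime l) :
    PolyTime (fun a => f a :: l a) := (hf.pair hl).of_enc fun _ => rfl

protected theorem succ {f : α → ℕ} (hf : PolyTime f) : PolyTime (fun a => f a + 1) :=
  ((PolyTime.const false).pair hf).of_enc fun _ => rfl

protected theorem ite {p : α → Prop} [DecidablePred p] {f g : α → β}
    (hp : PolyTime fun a => decide (p a)) (hf : PolyTime f) (hg : PolyTime g) :
    PolyTime (fun a => if p a then f a else g a) := by
  obtain ⟨cp, pp, hp⟩ := hp
  obtain ⟨cf, pf, hf⟩ := hf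
  obtain ⟨cg, pg, hg⟩ := hg
  refine ⟨.seq dupProg (.seq cp (condProg cf cg)), 13 * .X + 8 + pp + pf + pg, fun a => ?_⟩
  have hfa := (hf a).1
  have hga := (hg a).1
  simp only [Polynomial.eval_add, Polynomial.eval_mul, Polynomial.eval_X, Polynomial.eval_ofNat]
  refine ⟨by split_ifs <;> omega, fun vs => ?_⟩
  refine ((dupProg_run _ _).seq (((hp a).2 _).seq
    (t₂ := pf.eval (size a) + pg.eval (size a) + 3) ?_)).mono ?_
  · by_cases h : p a
    · have e : enc (decide (p a)) = .atom 1 := by simp [h, Enc.enc]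
      rw [e, if_pos h]
      exact (condProg_true cg ((hf a).2 vs)).mono (by omega)
    · have e : enc (decide (p a)) = .atom 0 := by simp [h, Enc.enc]
      rw [e, if_neg h]
      exact (condProg_false cf ((hg a).2 vs)).mono (by omega)
  · simp only [size]
    omega

protected theorem eq [DecidableEq β] {f g : α → β} (hf : PolyTime f) (hg : PolyTime g) :
    PolyTime (fun a => decide (f a = g a)) := by
  suffices h : PolyTime (fun p : β × β => decide (p.1 = p.2)) from h.comp (hf.pair hg)
  refine ⟨.seq unnodeProg eqProg, 15 * .X + 12, fun p => ?_⟩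
  simp only [Polynomial.eval_add, Polynomial.eval_mul, Polynomial.eval_X, Polynomial.eval_ofNat]
  refine ⟨by simp, fun vs => ?_⟩
  have e : enc (decide (p.1 = p.2)) = .atom (decide (p.1 = p.2)).toNat := rfl
  have h := eqProg_run (enc p.1) (enc p.2) vs
  rw [e]
  refine ((unnodeProg_run _ _ _).seq (t₂ := 15 * (size p.1 + size p.2) + 10) ?_).mono ?_
  · have e' : (decide (p.1 = p.2)).toNat = if enc p.1 = enc p.2 then 1 else 0 := by
      by_cases hp : p.1 = p.2
      · simp [hp]
      · simp [hp, Enc.enc_injective.ne hp]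
    rw [e']
    exact h
  · simp
    omega

end PolyTime

/-- Case distinction on a list. -/
def listCase {β γ : Type} (l : List β) (x : γ) (g : β → List β → γ) : γ :=
  match l with
  | [] => x
  | b :: t => g b t

namespace PolyTime

variable {α β γ δ : Type} [Enc α] [Enc β] [Enc γ] [Enc δ]

protected theorem listCase {l : α → List β} {f : α → γ} {g : α → β → List β → γ}
    (hl : PolyTime l) (hf : PolyTime f)
    (hg : PolyTime fun q : α × β × List β => g q.1 q.2.1 q.2.2) :
    PolyTime (fun a => listCase (l a) (f a) (g a)) := by
  obtain ⟨cl, pl, hl⟩ := hl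
  obtain ⟨cf, pf, hf⟩ := hf
  obtain ⟨cg, pg, hg⟩ := hg
  refine ⟨.seq dupProg (.seq cl (caseProg (.seq nodeProg (.seq swapProg (.seq nodeProg cg))) cf)),
    21 * .X + 16 + 9 * pl + pf + pg.comp (1 + .X + pl), fun a => ?_⟩
  have hfa := (hf a).1
  have hla := (hl a).1
  simp only [Polynomial.eval_add, Polynomial.eval_mul, Polynomial.eval_X, Polynomial.eval_ofNat,
    Polynomial.eval_comp, Polynomial.eval_one]
  have hsz : ∀ b t, l a = b :: t →
      size (a, b, t) ≤ 1 + size a + pl.eval (size a) := by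
    intro b t h
    rw [h, size_cons] at hla
    simp; omega
  refine ⟨?_, fun vs => ?_⟩
  · cases h : l a with
    | nil => simp only [listCase]; omega
    | cons b t =>
      have h₁ := (hg (a, b, t)).1
      have h₂ := eval_mono pg (hsz b t h)
      simp only [listCase] at h₁ ⊢
      omega
  · refine ((dupProg_run _ _).seq (((hl a).2 _).seq (t₂ := 8 * size a + 8 * pl.eval (size a) +
      11 + pf.eval (size a) + pg.eval (1 + size a + pl.eval (size a))) ?_)).mono ?_
    · cases h : l a with
      | nil => exact (caseProg_atom _ ((hf a).2 vs)).mono (by omega)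
      | cons b t =>
        have h₂ := eval_mono pg (hsz b t h)
        have h₃ := hsz b t h
        refine (caseProg_node _ ((nodeProg_run _ _ _).seq ((swapProg_run _ _ _).seq
          ((nodeProg_run _ _ _).seq ((hg (a, b, t)).2 vs))))).mono ?_
        simp only [size_pair] at h₃
        simp only [size, Tree.size_node] at h₂ h₃ ⊢
        omega
    · simp only [size]
      omega

/-- The bound on all intermediate states is indispensable: a step that doubles its state runs in
polynomial time, but its iteration does not. With it, every iteration costs at most a fixed
polynomial in the size of `a`, and the number of iterations is at most the size of the list. The
argument `a` is carried along with the state because each step may use it. -/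
theorem foldl {l : α → List β} {g : α → γ} {h : α → γ → β → γ} (hl : PolyTime l)
    (hg : PolyTime g) (hh : PolyTime fun q : α × γ × β => h q.1 q.2.1 q.2.2)
    (hsize : ∃ q : Polynomial ℕ, ∀ a m, m <+: l a → size (m.foldl (h a) (g a)) ≤ q.eval (size a)) :
    PolyTime (fun a => (l a).foldl (h a) (g a)) := by
  obtain ⟨q, hq⟩ := hsize
  have hstep : PolyTime fun x : (α × γ) × β => (x.1.1, h x.1.1 x.1.2 x.2) :=
    (fst.comp fst).pair (hh.comp ((fst.comp fst).pair ((snd.comp fst).pair snd)))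
  obtain ⟨c₁, p₁, h₁⟩ := hl.pair (PolyTime.id.pair hg)
  obtain ⟨c₂, p₂, h₂⟩ := hstep
  obtain ⟨c₃, p₃, h₃⟩ := snd (α := α) (β := γ)
  let K : Polynomial ℕ := 16 * (p₁ + (1 + .X + q)) + 20 + p₂.comp (1 + (1 + .X + q) + p₁)
  refine ⟨.seq c₁ (.seq unnodeProg (.seq (whileProg (.seq rotProg (.seq nodeProg
    (.seq c₂ swapProg)))) c₃)), q + p₁ + 4 + p₁ * K + p₃.comp (1 + .X + q), fun a => ?_⟩
  have hs : ∀ m, m <+: l a → size (a, m.foldl (h a) (g a)) ≤ 1 + size a + q.eval (size a) := by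
    intro m hm
    have := hq a m hm
    simp only [size_pair]
    omega
  have hla : size (l a) ≤ p₁.eval (size a) := by
    have := (h₁ a).1
    simp only [size_pair] at this
    omega
  -- Loop invariant: the top of the stack is the unread part `m`, and below it lies `a` together
  -- with the fold over the part `pre` already read.
  have key : ∀ vs (m pre : List β), pre ++ m = l a →
      RunLe (whileProg (.seq rotProg (.seq nodeProg (.seq c₂ swapProg))))
        (cfg (enc m :: enc (a, pre.foldl (h a) (g a)) :: vs))
        (m.length * K.eval (size a) + 2) (cfg (enc (a, (l a).foldl (h a) (g a)) :: vs)) := by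
    intro vs m
    induction m with
    | nil =>
      intro pre hpre
      rw [List.append_nil] at hpre
      subst hpre
      exact (whileProg_atom _ _ _).mono (by simp)
    | cons b m ih =>
      intro pre hpre
      have h₄ := ih (pre ++ [b]) (by simpa using hpre)
      have hs₁ := hs pre ⟨_, hpre⟩
      have hs₂ := hs (pre ++ [b]) ⟨m, by simpa using hpre⟩
      have hbm : size (b :: m) ≤ size (l a) := by
        rw [← hpre]
        have := size_append pre (b :: m)
        have := size_pos pre
        omega
      have h₅ := (h₂ ((a, pre.foldl (h a) (g a)), b)).2 (enc m :: vs)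
      have h₆ : p₂.eval (size ((a, pre.foldl (h a) (g a)), b)) ≤
          p₂.eval (1 + (1 + size a + q.eval (size a)) + p₁.eval (size a)) := by
        apply eval_mono
        rw [size_pair]
        rw [size_cons] at hbm
        change 1 + size (a, pre.foldl (h a) (g a)) + size b ≤ _
        omega
      have h₇ : (pre ++ [b]).foldl (h a) (g a) = h a (pre.foldl (h a) (g a)) b := by simp
      rw [h₇] at h₄ hs₂
      refine (whileProg_node ((rotProg_run _ _ _ _).seq ((nodeProg_run _ _ _).seq
        (h₅.seq (swapProg_run _ _ _)))) h₄).mono ?_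
      have hK : K.eval (size a) = 16 * (p₁.eval (size a) + (1 + size a + q.eval (size a))) + 20 +
          p₂.eval (1 + (1 + size a + q.eval (size a)) + p₁.eval (size a)) := by
        simp [K]
      rw [List.length_cons, Nat.add_mul, one_mul]
      rw [size_cons] at hbm
      simp only [size] at hs₁ hs₂ hbm h₆ hla hK ⊢
      omega
  simp only [Polynomial.eval_add, Polynomial.eval_mul, Polynomial.eval_X, Polynomial.eval_ofNat,
    Polynomial.eval_comp, Polynomial.eval_one]
  refine ⟨?_, fun vs => ?_⟩
  · have := hq a (l a) List.prefix_rfl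
    omega
  · have h₈ := key vs (l a) [] rfl
    have h₉ := (h₃ (a, (l a).foldl (h a) (g a))).2 vs
    have h₁₀ := eval_mono p₃ (hs (l a) List.prefix_rfl)
    refine (((h₁ a).2 vs).seq ((unnodeProg_run _ _ _).seq (h₈.seq h₉))).mono ?_
    have h₁₁ := Nat.mul_le_mul_right (K.eval (size a)) ((length_le_size (l a)).trans hla)
    omega

end PolyTime

/-! ### Programs with input and output -/

/-- Reads the input and pushes it as a list of symbols. -/
def readProg : Prog :=
  .seq (.loop none .isSome (.op (.push 2)))
    (.seq (.op (.pushc 0 1)) (.loop (some 2) .isSome (.seq (.op (.push 0)) (.op (.pushc 0 0)))))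

theorem readProg_run₁ (l x : List ℕ) (u : Option ℕ) :
    RunLe (.loop none .isSome (.op (.push 2))) ⟨l, [], regs [] [] x [] [], u, none⟩
      (2 * l.length + 1) (st [] [] (l.reverse ++ x) [] [] none none) := by
  induction l generalizing x u with
  | nil => exact (RunLe.loop_exit rfl rfl).mono (by omega)
  | cons a l ih =>
    refine RunLe.mono (T := 1 + (1 + (2 * l.length + 1))) (RunLe.loop_step rfl rfl (RunLe.op rfl)
      (?_ : RunLe (.loop none .isSome (.op (.push 2))) _ _ _)) (by simp; omega)
    simpa [Op.apply, State.pop] using ih (a :: x) (some a)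

theorem readProg_run₂ (l : List Atom) (t : List Atom) (u : Option ℕ) :
    RunLe (.loop (some 2) .isSome (.seq (.op (.push 0)) (.op (.pushc 0 0))))
      (st (enc t).flat [] (l.map fun a => a.id + 1) [] [] u none) (3 * l.length + 1)
      (cfg [enc (l.reverse ++ t)]) := by
  induction l generalizing t u with
  | nil =>
    refine (RunLe.loop_exit ?_ rfl).mono (by omega)
    simp [State.pop, st, cfg]
  | cons a l ih =>
    refine RunLe.mono (T := 1 + (1 + 1 + (3 * l.length + 1)))
      (RunLe.loop_step rfl ?_ (RunLe.seq (RunLe.op rfl) (RunLe.op rfl))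
      (?_ : RunLe (.loop (some 2) .isSome (.seq (.op (.push 0)) (.op (.pushc 0 0)))) _ _ _))
      (by simp; omega)
    · simp [Test.holds, State.pop, st]
    · have := ih (a :: t) (some (a.id + 1))
      have e : (enc (a :: t)).flat = 0 :: (a.id + 1) :: (enc t).flat := rfl
      simpa [Op.apply, State.pop, e, st] using this

theorem readProg_run (w : List Atom) :
    RunLe readProg (State.start (w.map fun a => a.id + 1)) (5 * w.length + 3) (cfg [enc w]) := by
  have h₁ := readProg_run₁ (w.map fun a => a.id + 1) [] none
  have h₂ := readProg_run₂ w.reverse [] none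
  have h₃ : regs [] [] [] [] [] = fun _ => [] := by funext r; fin_cases r <;> rfl
  rw [h₃] at h₁
  refine (h₁.seq (RunLe.seq (t₂ := 3 * w.length + 1) (RunLe.op
    (s' := st [1] [] (w.map fun a => a.id + 1).reverse [] [] none none) ?_) ?_)).mono ?_
  · simp [Op.apply, st]
  · simpa [Enc.enc, encList, Tree.flat] using h₂
  · simp; omega

/-- Pops a list of symbols and writes it to the output. -/
def writeProg : Prog :=
  .seq (.loop (some 0) (.isConst 0) (.seq (.op (.pop (some 0))) (.op (.push 2))))
    (.loop (some 2) .isSome (.op .write))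

theorem writeProg_run₁ (l : List Atom) (x : List ℕ) (u : Option ℕ) :
    RunLe (.loop (some 0) (.isConst 0) (.seq (.op (.pop (some 0))) (.op (.push 2))))
      (st (enc l).flat [] x [] [] u none) (3 * l.length + 1)
      (st [] [] ((l.map fun a => a.id + 1).reverse ++ x) [] [] (some 1) none) := by
  induction l generalizing x u with
  | nil =>
    refine (RunLe.loop_exit ?_ rfl).mono (by omega)
    simp [State.pop, st, Enc.enc, encList, Tree.flat]
  | cons a l ih =>
    have e : (enc (a :: l)).flat = 0 :: (a.id + 1) :: (enc l).flat := rfl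
    rw [e]
    refine RunLe.mono (T := 1 + (1 + 1 + (3 * l.length + 1)))
      (RunLe.loop_step rfl ?_ (RunLe.seq (RunLe.op rfl) (RunLe.op rfl))
      (?_ : RunLe (.loop (some 0) (.isConst 0) (.seq (.op (.pop (some 0))) (.op (.push 2)))) _ _ _))
      (by simp; omega)
    · simp [Test.holds, State.pop, st]
    · simpa [Op.apply, State.pop, st] using ih ((a.id + 1) :: x) (some (a.id + 1))

theorem writeProg_run₂ (l out : List ℕ) (u : Option ℕ) :
    RunLe (.loop (some 2) .isSome (.op .write)) ⟨[], out, regs [] [] l [] [], u, none⟩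
      (2 * l.length + 1) ⟨[], l.reverse ++ out, regs [] [] [] [] [], none, none⟩ := by
  induction l generalizing out u with
  | nil =>
    refine (RunLe.loop_exit ?_ rfl).mono (by omega)
    simp [State.pop]
  | cons a l ih =>
    refine RunLe.mono (T := 1 + (1 + (2 * l.length + 1))) (RunLe.loop_step rfl rfl (RunLe.op rfl)
      (?_ : RunLe (.loop (some 2) .isSome (.op .write)) _ _ _)) (by simp; omega)
    simpa [Op.apply, State.pop] using ih (a :: out) (some a)

theorem writeProg_run (w : List Atom) :
    RunLe writeProg (cfg [enc w]) (5 * w.length + 2)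
      ⟨[], w.map fun a => a.id + 1, fun _ => [], none, none⟩ := by
  have h₁ := writeProg_run₁ w [] none
  have h₂ := writeProg_run₂ (w.map fun a => a.id + 1).reverse [] (some 1)
  have h₃ : regs [] [] [] [] [] = fun _ => [] := by funext r; fin_cases r <;> rfl
  rw [h₃] at h₂
  simp only [List.append_nil, List.reverse_reverse, List.length_reverse, List.length_map]
    at h₁ h₂
  have e : cfg [enc w] = st (enc w).flat [] [] [] [] none none := by simp [cfg]
  rw [e]
  exact (h₁.seq h₂).mono (by omega)

theorem size_atoms (w : List Atom) : size w = 2 * w.length + 1 := by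
  induction w with
  | nil => rfl
  | cons a w ih => simp [ih]; omega

/-- A polynomial-time function on words over an infinite alphabet yields Turing machines for all
functions that agree with it up to the choice of the letters, with the same time bound. -/
theorem PolyTime.exists_machine {f : List Atom → List Atom} (hf : PolyTime f) :
    ∃ time : Polynomial ℕ, ∀ (L : Type) [Finite L] (α β : Type) (ea : α → List L)
      (eb : β → List L) (F : α → β) (code : L → Atom) (dec : Atom → L),
      (∀ a, dec (code a) = a) → (∀ a, (eb (F a)).map code = f ((ea a).map code)) →
      ∃ M : Turing.TM2ComputableInPolyTime ea eb F, M.time = time := by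
  obtain ⟨c, p, hp⟩ := hf
  refine ⟨10 * .X + 10 + 6 * p.comp (2 * .X + 1), fun L _ α β ea eb F code dec hdec hF => ?_⟩
  have := Fintype.ofFinite L
  refine exists_polyTime (code := fun a => (code a).id + 1) (dec := fun n => dec ⟨n - 1⟩) ea eb F
    (.seq readProg (.seq c writeProg)) _ (fun a => by simpa using hdec a) fun a => ?_
  have h₁ := readProg_run ((ea a).map code)
  have h₂ := (hp ((ea a).map code)).2 []
  have h₃ := writeProg_run ((eb (F a)).map code)
  have h₄ := (hp ((ea a).map code)).1
  rw [← hF] at h₂ h₄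
  obtain ⟨t, ht, hr⟩ := h₁.seq (h₂.seq h₃)
  refine ⟨t, ?_, _, by simpa [Function.comp_def] using hr, rfl, rfl, by simp⟩
  rw [size_atoms, size_atoms] at h₄
  rw [size_atoms] at ht
  simp only [List.length_map] at ht h₄
  simp
  omega

end StackProg

namespace StackProg

open Enc (enc)

/-! ### Closure of polynomial time under list operations and arithmetic. -/

namespace PolyTime

variable {α β γ δ : Type} [Enc α] [Enc β] [Enc γ] [Enc δ]

/-- A fold whose state grows by a bounded amount in each step. -/
theorem foldl_add {l : α → List β} {g : α → γ} {h : α → γ → β → γ} (hl : PolyTime l)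
    (hg : PolyTime g) (hh : PolyTime fun q : α × γ × β => h q.1 q.2.1 q.2.2)
    (hadd : ∃ q : Polynomial ℕ, ∀ a s b, size (h a s b) ≤ size s + q.eval (size (a, b))) :
    PolyTime (fun a => (l a).foldl (h a) (g a)) := by
  obtain ⟨q, hq⟩ := hadd
  obtain ⟨pl, hpl⟩ := hl.polySize
  obtain ⟨pg, hpg⟩ := hg.polySize
  refine foldl hl hg hh ⟨pg + pl * q.comp (1 + .X + pl), fun a m hm => ?_⟩
  have key : ∀ (m : List β) (s : γ), size m ≤ pl.eval (size a) →
      size (m.foldl (h a) s) ≤ size s + m.length * q.eval (1 + size a + pl.eval (size a)) := by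
    intro m
    induction m with
    | nil => intro s _; simp
    | cons b m ih =>
      intro s hs
      rw [size_cons] at hs
      have h₁ := ih (h a s b) (by omega)
      have h₂ := hq a s b
      have h₃ : q.eval (size (a, b)) ≤ q.eval (1 + size a + pl.eval (size a)) :=
        eval_mono q (by rw [size_pair]; change 1 + size a + size b ≤ _; omega)
      rw [List.foldl_cons, List.length_cons, Nat.add_mul, one_mul]
      omega
  have h₁ := (size_prefix hm).trans (hpl a)
  have h₂ := key m (g a) h₁
  have h₃ := hpg a
  have h₄ := Nat.mul_le_mul_right (q.eval (1 + size a + pl.eval (size a)))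
    ((length_le_size m).trans h₁)
  simp only [Polynomial.eval_add, Polynomial.eval_mul, Polynomial.eval_comp, Polynomial.eval_X,
    Polynomial.eval_one]
  omega

theorem reverse {l : α → List β} (hl : PolyTime l) : PolyTime (fun a => (l a).reverse) := by
  have h : PolyTime (fun a => (l a).foldl (fun s b => b :: s) []) := by
    refine foldl_add (h := fun _ s b => b :: s) hl (PolyTime.const [])
      (PolyTime.cons (snd.comp snd) (fst.comp snd)) ⟨.X, fun a s b => ?_⟩
    simp; omega
  refine h.of_eq fun a => ?_
  suffices H : ∀ m s : List β, m.foldl (fun s b => b :: s) s = m.reverse ++ s by simp [H]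
  intro m
  induction m with
  | nil => simp
  | cons b m ih => intro s; simp [ih]

theorem foldr {l : α → List β} {g : α → γ} {h : α → β → γ → γ} (hl : PolyTime l)
    (hg : PolyTime g) (hh : PolyTime fun q : α × β × γ => h q.1 q.2.1 q.2.2)
    (hsize : ∃ q : Polynomial ℕ, ∀ a (m : List β), m <:+ l a →
      size (m.foldr (h a) (g a)) ≤ q.eval (size a)) :
    PolyTime (fun a => (l a).foldr (h a) (g a)) := by
  obtain ⟨q, hq⟩ := hsize
  have : PolyTime (fun a => (l a).reverse.foldl (fun s b => h a b s) (g a)) := by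
    refine foldl (h := fun a s b => h a b s) hl.reverse hg
      (hh.comp (fst.pair ((snd.comp snd).pair (fst.comp snd)))) ⟨q, fun a m hm => ?_⟩
    rw [← List.foldr_reverse]
    exact hq a _ (by simpa using List.reverse_suffix.2 hm)
  exact this.of_eq fun a => by rw [List.foldl_reverse]

theorem foldr_add {l : α → List β} {g : α → γ} {h : α → β → γ → γ} (hl : PolyTime l)
    (hg : PolyTime g) (hh : PolyTime fun q : α × β × γ => h q.1 q.2.1 q.2.2)
    (hadd : ∃ q : Polynomial ℕ, ∀ a b s, size (h a b s) ≤ size s + q.eval (size (a, b))) :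
    PolyTime (fun a => (l a).foldr (h a) (g a)) := by
  obtain ⟨q, hq⟩ := hadd
  have : PolyTime (fun a => (l a).reverse.foldl (fun s b => h a b s) (g a)) :=
    foldl_add (h := fun a s b => h a b s) hl.reverse hg
      (hh.comp (fst.pair ((snd.comp snd).pair (fst.comp snd)))) ⟨q, fun a s b => hq a b s⟩
  exact this.of_eq fun a => by rw [List.foldl_reverse]

/-! Lists -/

theorem map {l : α → List β} {f : α → β → γ} (hl : PolyTime l)
    (hf : PolyTime fun q : α × β => f q.1 q.2) : PolyTime (fun a => (l a).map (f a)) := by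
  have h : PolyTime (fun a => (l a).foldr (fun b s => f a b :: s) []) := by
    obtain ⟨p, hp⟩ := hf.polySize
    refine foldr_add (h := fun a b s => f a b :: s) hl (PolyTime.const [])
      (PolyTime.cons (hf.comp (fst.pair (fst.comp snd))) (snd.comp snd)) ⟨1 + p, fun a b s => ?_⟩
    have : size (f a b) ≤ _ := hp (a, b)
    simp only [size_cons, Polynomial.eval_add, Polynomial.eval_one]
    omega
  refine h.of_eq fun a => ?_
  induction l a with
  | nil => rfl
  | cons b m ih => simp [ih]

theorem filter {l : α → List β} {p : α → β → Bool} (hl : PolyTime l)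
    (hp : PolyTime fun q : α × β => p q.1 q.2) : PolyTime (fun a => (l a).filter (p a)) := by
  have h : PolyTime (fun a => (l a).foldr (fun b s => if p a b = true then b :: s else s) []) := by
    refine foldr_add (h := fun a b s => if p a b = true then b :: s else s) hl (PolyTime.const [])
      (PolyTime.ite ?_ (PolyTime.cons (fst.comp snd) (snd.comp snd)) (snd.comp snd))
      ⟨.X, fun a b s => ?_⟩
    · exact (hp.comp (fst.pair (fst.comp snd))).of_eq fun a => by simp
    · split_ifs
      · simp; omega
      · simp
  refine h.of_eq fun a => ?_
  induction l a with
  | nil => rfl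
  | cons b m ih => simp [ih, List.filter_cons]

protected theorem append {l m : α → List β} (hl : PolyTime l) (hm : PolyTime m) :
    PolyTime (fun a => l a ++ m a) := by
  have h : PolyTime (fun a => (l a).foldr (fun b s => b :: s) (m a)) := by
    refine foldr_add (h := fun _ b s => b :: s) hl hm
      (PolyTime.cons (fst.comp snd) (snd.comp snd)) ⟨.X, fun a b s => ?_⟩
    simp; omega
  refine h.of_eq fun a => ?_
  induction l a with
  | nil => rfl
  | cons b m ih => simp [ih]

theorem flatMap {l : α → List β} {f : α → β → List γ} (hl : PolyTime l)
    (hf : PolyTime fun q : α × β => f q.1 q.2) : PolyTime (fun a => (l a).flatMap (f a)) := by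
  have h : PolyTime (fun a => (l a).foldr (fun b s => f a b ++ s) []) := by
    obtain ⟨p, hp⟩ := hf.polySize
    refine foldr_add (h := fun a b s => f a b ++ s) hl (PolyTime.const [])
      (PolyTime.append (hf.comp (fst.pair (fst.comp snd))) (snd.comp snd)) ⟨p, fun a b s => ?_⟩
    have : size (f a b) ≤ _ := hp (a, b)
    have := size_append (f a b) s
    omega
  refine h.of_eq fun a => ?_
  induction l a with
  | nil => rfl
  | cons b m ih => simp [ih]

theorem or {p q : α → Bool} (hp : PolyTime p) (hq : PolyTime q) :
    PolyTime (fun a => p a || q a) := by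
  have h : PolyTime (fun a => if p a = true then true else q a) :=
    PolyTime.ite (hp.of_eq fun a => by simp) (PolyTime.const true) hq
  exact h.of_eq fun a => by cases p a <;> rfl

theorem and {p q : α → Bool} (hp : PolyTime p) (hq : PolyTime q) :
    PolyTime (fun a => p a && q a) := by
  have h : PolyTime (fun a => if p a = true then q a else false) :=
    PolyTime.ite (hp.of_eq fun a => by simp) hq (PolyTime.const false)
  exact h.of_eq fun a => by cases p a <;> rfl

theorem not {p : α → Bool} (hp : PolyTime p) : PolyTime (fun a => !p a) := by
  have h : PolyTime (fun a => if p a = true then false else true) :=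
    PolyTime.ite (hp.of_eq fun a => by simp) (PolyTime.const false) (PolyTime.const true)
  exact h.of_eq fun a => by cases p a <;> rfl

theorem any {l : α → List β} {p : α → β → Bool} (hl : PolyTime l)
    (hp : PolyTime fun q : α × β => p q.1 q.2) : PolyTime (fun a => (l a).any (p a)) := by
  have h : PolyTime (fun a => (l a).foldr (fun b s => p a b || s) false) := by
    refine foldr_add (h := fun a b s => p a b || s) hl (PolyTime.const false)
      (or (hp.comp (fst.pair (fst.comp snd))) (snd.comp snd)) ⟨1, fun a b s => ?_⟩
    simp
  refine h.of_eq fun a => ?_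
  induction l a with
  | nil => rfl
  | cons b m ih => simp [ih]

theorem tail {l : α → List β} (hl : PolyTime l) : PolyTime (fun a => (l a).tail) := by
  have h : PolyTime (fun a => listCase (l a) [] (fun _ t => t)) :=
    PolyTime.listCase (g := fun _ _ t => t) hl (PolyTime.const []) (snd.comp snd)
  exact h.of_eq fun a => by cases l a <;> rfl

/-! Natural numbers -/

/-- Unary numbers and lists of `false` are the same trees, so arithmetic on numbers reduces to list
operations: addition to appending, truncated subtraction to dropping. -/
theorem enc_replicate (n : ℕ) : enc (List.replicate n false) = enc n := by
  induction n with
  | zero => rfl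
  | succ n ih =>
    change Tree.node _ (enc (List.replicate n false)) = Tree.node _ (enc n)
    rw [ih]
    rfl

theorem length {l : α → List β} (hl : PolyTime l) : PolyTime (fun a => (l a).length) := by
  refine (map (f := fun _ _ => false) hl (PolyTime.const false)).of_enc fun a => ?_
  rw [List.map_const', enc_replicate]

theorem replicate {n : α → ℕ} (hn : PolyTime n) :
    PolyTime (fun a => List.replicate (n a) false) :=
  hn.of_enc fun _ => (enc_replicate _).symm

theorem add {m n : α → ℕ} (hm : PolyTime m) (hn : PolyTime n) : PolyTime (fun a => m a + n a) :=
  (length ((replicate hm).append (replicate hn))).of_eq fun a => by simp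

theorem drop {n : α → ℕ} {l : α → List β} (hn : PolyTime n) (hl : PolyTime l) :
    PolyTime (fun a => (l a).drop (n a)) := by
  have h : PolyTime (fun a => (List.replicate (n a) false).foldl (fun s _ => s.tail) (l a)) := by
    refine foldl_add (h := fun _ s _ => s.tail) (replicate hn) hl (tail (fst.comp snd))
      ⟨0, fun a s b => ?_⟩
    exact (size_sublist (List.tail_sublist s)).trans (by simp)
  refine h.of_eq fun a => ?_
  generalize l a = m
  induction n a generalizing m with
  | zero => rfl
  | succ k ih => simp [List.replicate_succ, ih]

theorem sub {m n : α → ℕ} (hm : PolyTime m) (hn : PolyTime n) : PolyTime (fun a => m a - n a) :=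
  (length (drop hn (replicate hm))).of_eq fun a => by simp

theorem le {m n : α → ℕ} (hm : PolyTime m) (hn : PolyTime n) :
    PolyTime (fun a => decide (m a ≤ n a)) :=
  (PolyTime.eq (sub hm hn) (PolyTime.const 0)).of_eq fun a => by
    simp [Nat.sub_eq_zero_iff_le]

theorem lt {m n : α → ℕ} (hm : PolyTime m) (hn : PolyTime n) :
    PolyTime (fun a => decide (m a < n a)) :=
  (le hm.succ hn).of_eq fun a => by simp

protected theorem min {m n : α → ℕ} (hm : PolyTime m) (hn : PolyTime n) :
    PolyTime (fun a => Min.min (m a) (n a)) :=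
  (sub hm (sub hm hn)).of_eq fun a => by omega

theorem const_mul (k : ℕ) {n : α → ℕ} (hn : PolyTime n) : PolyTime (fun a => k * n a) := by
  induction k with
  | zero => exact (PolyTime.const 0).of_eq fun a => by simp
  | succ k ih => exact (add ih hn).of_eq fun a => by rw [Nat.add_mul, one_mul]

theorem take {n : α → ℕ} {l : α → List β} (hn : PolyTime n) (hl : PolyTime l) :
    PolyTime (fun a => (l a).take (n a)) := by
  refine (reverse (drop (sub (length hl) hn) (reverse hl))).of_eq fun a => ?_
  rw [List.drop_reverse, List.reverse_reverse]
  rcases le_total (n a) (l a).length with h | h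
  · rw [Nat.sub_sub_self h]
  · rw [Nat.sub_eq_zero_of_le h, Nat.sub_zero, List.take_of_length_le le_rfl,
      List.take_of_length_le h]

theorem sum_map {l : α → List β} {f : α → β → ℕ} (hl : PolyTime l)
    (hf : PolyTime fun q : α × β => f q.1 q.2) : PolyTime (fun a => ((l a).map (f a)).sum) := by
  refine (length (flatMap (f := fun a b => List.replicate (f a b) false) hl (replicate hf))).of_eq
    fun a => ?_
  simp [List.length_flatMap]

theorem isPrefix [DecidableEq β] {l m : α → List β} (hl : PolyTime l) (hm : PolyTime m) :
    PolyTime (fun a => decide (l a <+: m a)) :=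
  (PolyTime.eq hl (take (length hl) hm)).of_eq fun a => by simp [List.prefix_iff_eq_take]

/-- The fold from the right carries the suffix read so far along with the answer, so that every
suffix can be tested for having the first list as a prefix. The same device serves the functions
below that recurse on the tail but also look at it. -/
theorem isInfix [DecidableEq β] {l m : α → List β} (hl : PolyTime l) (hm : PolyTime m) :
    PolyTime (fun a => decide (l a <:+: m a)) := by
  have h : PolyTime (fun a => ((m a).foldr (fun b s => (b :: s.1, s.2 || decide (l a <+: b :: s.1)))
      (([] : List β), decide (l a = []))).2) := by
    refine snd.comp (foldr_add (h := fun a b s => (b :: s.1, s.2 || decide (l a <+: b :: s.1))) hm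
      ((PolyTime.const []).pair (PolyTime.eq hl (PolyTime.const []))) ?_ ⟨.X, fun a b s => ?_⟩)
    · have h₁ : PolyTime fun q : α × β × (List β × Bool) => q.2.1 :: q.2.2.1 :=
        PolyTime.cons (fst.comp snd) (fst.comp (snd.comp snd))
      exact h₁.pair (or (snd.comp (snd.comp snd)) (isPrefix (hl.comp fst) h₁))
    · simp; omega
  refine h.of_eq fun a => ?_
  suffices H : ∀ n : List β, n.foldr (fun b s => (b :: s.1, s.2 || decide (l a <+: b :: s.1)))
      (([] : List β), decide (l a = [])) = (n, decide (l a <:+: n)) by rw [H]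
  intro n
  induction n with
  | nil => simp
  | cons b n ih =>
    rw [List.foldr_cons, ih]
    simp only [List.infix_cons_iff, Prod.mk.injEq, true_and]
    rw [Bool.eq_iff_iff]
    simp [or_comm]

theorem mem [DecidableEq β] {x : α → β} {l : α → List β} (hx : PolyTime x) (hl : PolyTime l) :
    PolyTime (fun a => decide (x a ∈ l a)) :=
  (any (p := fun a b => decide (x a = b)) hl (PolyTime.eq (hx.comp fst) snd)).of_eq fun a => by
    rw [Bool.eq_iff_iff]; simp

theorem idxOf [DecidableEq β] [BEq β] [LawfulBEq β] {x : α → β} {l : α → List β} (hx : PolyTime x) (hl : PolyTime l) :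
    PolyTime (fun a => (l a).idxOf (x a)) := by
  have h : PolyTime (fun a => (l a).foldr (fun b s => if b = x a then 0 else s + 1) 0) := by
    refine foldr_add (h := fun a b s => if b = x a then 0 else s + 1) hl (PolyTime.const 0)
      (PolyTime.ite (PolyTime.eq (fst.comp snd) (hx.comp fst)) (PolyTime.const 0)
        (PolyTime.succ (snd.comp snd))) ⟨2, fun a b s => ?_⟩
    split_ifs
    · simp
    · simp; omega
  refine h.of_eq fun a => ?_
  induction l a with
  | nil => simp
  | cons b m ih => by_cases hb : b = x a <;> simp [ih, hb]

end PolyTime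

/-! ### Binary numerals -/

/-- The successor of a binary numeral, with the least significant digit first. -/
def incBits : List Bool → List Bool
  | [] => [true]
  | false :: t => true :: t
  | true :: t => false :: incBits t

theorem length_incBits (l : List Bool) : (incBits l).length ≤ l.length + 1 := by
  induction l with
  | nil => simp [incBits]
  | cons b t ih => cases b <;> simp [incBits]; omega

theorem incBits_bits (n : ℕ) : incBits n.bits = (n + 1).bits := by
  induction n using Nat.binaryRec' with
  | zero => simp [incBits]
  | bit b n h ih =>
    rw [Nat.bits_append_bit n b h]
    cases b with
    | false =>
      have : Nat.bit false n + 1 = Nat.bit true n := by simp [Nat.bit_val]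
      rw [this, Nat.bits_append_bit n true (by simp)]
      rfl
    | true =>
      have : Nat.bit true n + 1 = Nat.bit false (n + 1) := by simp [Nat.bit_val]; ring
      rw [this, Nat.bits_append_bit (n + 1) false (by simp)]
      simp [incBits, ih]

theorem size_bits (l : List Bool) : size l = 2 * l.length + 1 := by
  induction l with
  | nil => rfl
  | cons b l ih => simp [ih]; omega

namespace PolyTime

variable {α : Type} [Enc α]

/-- Below a digit `false` the successor leaves the tail untouched, so the fold carries both the tail
and its successor. -/
protected theorem incBits {l : α → List Bool} (hl : PolyTime l) :
    PolyTime (fun a => incBits (l a)) := by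
  have H : ∀ n : List Bool, n.foldr (fun b s =>
      (b :: s.1, if b = true then false :: s.2 else true :: s.1)) (([] : List Bool), [true]) =
      (n, incBits n) := by
    intro n
    induction n with
    | nil => rfl
    | cons b n ih => rw [List.foldr_cons, ih]; cases b <;> rfl
  have h : PolyTime (fun a => ((l a).foldr (fun b s =>
      (b :: s.1, if b = true then false :: s.2 else true :: s.1))
      (([] : List Bool), [true])).2) := by
    obtain ⟨p, hp⟩ := hl.polySize
    refine snd.comp (foldr (h := fun _ b s =>
      (b :: s.1, if b = true then false :: s.2 else true :: s.1)) hl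
      (PolyTime.const _) ?_ ⟨2 * p + 3, fun a m hm => ?_⟩)
    · exact (PolyTime.cons (fst.comp snd) (fst.comp (snd.comp snd))).pair
        (PolyTime.ite (((fst.comp snd)).of_eq fun a => by simp)
          (PolyTime.cons (PolyTime.const false) (snd.comp (snd.comp snd)))
          (PolyTime.cons (PolyTime.const true) (fst.comp (snd.comp snd))))
    · have h₁ := hp a
      have h₂ := hm.length_le
      have h₃ := length_incBits m
      rw [H]
      simp only [size_bits] at h₁
      simp only [size_pair, size_bits, Polynomial.eval_add, Polynomial.eval_mul,
        Polynomial.eval_ofNat]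
      omega
  exact h.of_eq fun a => by rw [H]

/-- The number is given in unary, so it is affordable to count up to it in binary; each increment
adds at most one digit. -/
theorem bits {n : α → ℕ} (hn : PolyTime n) : PolyTime (fun a => (n a).bits) := by
  have h : PolyTime (fun a => (List.replicate (n a) false).foldl (fun s _ => incBits s) []) := by
    refine foldl_add (h := fun _ s _ => incBits s) (replicate hn) (PolyTime.const [])
      (PolyTime.incBits (fst.comp snd)) ⟨2, fun a s b => ?_⟩
    have := length_incBits s
    simp only [size_bits, Polynomial.eval_ofNat]
    omega
  refine h.of_eq fun a => ?_
  induction n a with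
  | zero => simp
  | succ k ih => rw [List.replicate_succ', List.foldl_append, ih, ← incBits_bits]; rfl

end PolyTime

/-- The number with the given binary digits, cut off at `t`. -/
def cutOfBits (t : ℕ) (l : List Bool) : ℕ := l.foldr (fun b s => min t (s + s + b.toNat)) 0

/-- Capping after every doubling gives the same result as capping once at the end. The unary value
of `ℓ` could be exponential in its number of digits, whereas the capped value stays below the total
length, and beyond that `ℓ` has no influence on the parameter. -/
theorem cutOfBits_bits (t n : ℕ) : cutOfBits t n.bits = min t n := by
  induction n using Nat.binaryRec' with
  | zero => simp [cutOfBits]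
  | bit b n h ih =>
    rw [Nat.bits_append_bit n b h, cutOfBits, List.foldr_cons]
    change min t (cutOfBits t n.bits + cutOfBits t n.bits + b.toNat) = _
    rw [ih, Nat.bit_val]
    cases b <;> simp <;> omega

theorem PolyTime.cutOfBits {α : Type} [Enc α] {t : α → ℕ} {l : α → List Bool} (ht : PolyTime t)
    (hl : PolyTime l) : PolyTime (fun a => cutOfBits (t a) (l a)) := by
  obtain ⟨p, hp⟩ := ht.polySize
  refine PolyTime.foldr (h := fun a b s => min (t a) (s + s + b.toNat)) hl (PolyTime.const 0)
    (PolyTime.min (ht.comp PolyTime.fst) (PolyTime.add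
      (PolyTime.add (snd.comp snd) (snd.comp snd)) ?_)) ⟨p, fun a m _ => ?_⟩
  · have : PolyTime fun q : α × Bool × ℕ => if q.2.1 = true then 1 else 0 :=
      PolyTime.ite ((fst.comp snd).of_eq fun a => by simp) (PolyTime.const 1) (PolyTime.const 0)
    exact this.of_eq fun a => by cases a.2.1 <;> rfl
  · refine le_trans ?_ (hp a)
    cases m with
    | nil => simp
    | cons b m => simp

end StackProg

/-! ### Overlaps and superstrings -/

namespace ShortestSuperstring

/-! ### Weights of paths. -/

section Path
variable {β : Type}

/-- The sum of the weights of consecutive pairs. -/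
def pathWeight (w : β → β → ℕ) : List β → ℕ
  | [] => 0
  | [_] => 0
  | a :: b :: l => w a b + pathWeight w (b :: l)

theorem pathWeight_cons (w : β → β → ℕ) (a : β) (l : List β) :
    pathWeight w (a :: l) = l.head?.elim 0 (w a) + pathWeight w l := by
  cases l <;> simp [pathWeight]

/-- Isolates the contribution of one vertex in terms of its two neighbours, either of which may be
missing. Changing that vertex alters only the two `elim` terms. -/
theorem pathWeight_append_cons (w : β → β → ℕ) (l : List β) (a : β) (m : List β) :
    pathWeight w (l ++ a :: m) = pathWeight w l + l.getLast?.elim 0 (fun b => w b a) +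
      (m.head?.elim 0 (w a) + pathWeight w m) := by
  induction l with
  | nil => simp [pathWeight_cons, pathWeight]
  | cons b l ih =>
    rw [List.cons_append, pathWeight_cons, ih, pathWeight_cons]
    cases l with
    | nil => simp [pathWeight]
    | cons c l =>
      simp only [List.cons_append, List.head?_cons, Option.elim_some, List.getLast?_cons_cons]
      omega

theorem pathWeight_le_append (w : β → β → ℕ) (l m : List β) :
    pathWeight w l ≤ pathWeight w (l ++ m) := by
  cases m with
  | nil => simp
  | cons a m => rw [pathWeight_append_cons]; omega

theorem pathWeight_map {γ : Type} (w : β → β → ℕ) (f : γ → β) (l : List γ) :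
    pathWeight w (l.map f) = pathWeight (fun a b => w (f a) (f b)) l := by
  induction l with
  | nil => rfl
  | cons a l ih =>
    rw [List.map_cons, pathWeight_cons, pathWeight_cons, ih]
    cases l <;> rfl

theorem pathWeight_const_mul {v w : β → β → ℕ} {k : ℕ} {l : List β} (hl : l.Nodup)
    (h : ∀ a ∈ l, ∀ b ∈ l, a ≠ b → v a b = k * w a b) : pathWeight v l = k * pathWeight w l := by
  induction l with
  | nil => rfl
  | cons a l ih =>
    rw [List.nodup_cons] at hl
    rw [pathWeight_cons, pathWeight_cons,
      ih hl.2 fun b hb c hc => h b (by simp [hb]) c (by simp [hc]), Nat.mul_add]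
    congr 1
    cases l with
    | nil => simp
    | cons b l =>
      exact h a (by simp) b (by simp) fun hab => hl.1 (by simp [hab])

/-- A path of weight at least `r` has a subpath of weight at least `r` with at most `2 * r`
vertices. -/
theorem exists_short_sublist (w : β → β → ℕ) (l : List β) (r : ℕ) (h : r ≤ pathWeight w l) :
    ∃ m, m.Sublist l ∧ r ≤ pathWeight w m ∧ m.length ≤ 2 * r := by
  induction l generalizing r with
  | nil => exact ⟨[], .refl _, h, by simp⟩
  | cons a l ih =>
    rcases l with - | ⟨b, l⟩
    · simp only [pathWeight, Nat.le_zero] at h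
      exact ⟨[], by simp, by simp [h], by simp⟩
    · simp only [pathWeight] at h
      rcases Nat.eq_zero_or_pos r with rfl | hr
      · exact ⟨[], by simp, by simp, by simp⟩
      rcases Nat.eq_zero_or_pos (w a b) with hw | hw
      -- An arc of weight 0 contributes nothing, so its first vertex is dropped.
      · obtain ⟨m, h₁, h₂, h₃⟩ := ih r (by omega)
        exact ⟨m, h₁.cons a, h₂, h₃⟩
      · obtain ⟨m, h₁, h₂, h₃⟩ := ih (r - w a b) (by omega)
        by_cases hb : m.head? = some b
        · obtain ⟨m', rfl⟩ : ∃ m', m = b :: m' := by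
            cases m with
            | nil => simp at hb
            | cons c m' => exact ⟨m', by simpa using hb⟩
          refine ⟨a :: b :: m', h₁.cons_cons a, ?_, ?_⟩
          · simp only [pathWeight]; omega
          · simp only [List.length_cons] at h₃ ⊢; omega
        -- The two new vertices are paid for by the arc between them, which lowers the required
        -- weight by at least 1.
        · refine ⟨a :: b :: m, List.Sublist.cons_cons a (List.Sublist.cons_cons b ?_), ?_, ?_⟩
          · rcases h₁ with - | h₁ | h₁
            · assumption
            · simp at hb
          · rw [pathWeight_cons, pathWeight_cons, List.head?_cons, Option.elim_some]
            omega
          · simp only [List.length_cons]; omega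

end Path

/-! ### Superstrings as paths in the overlap digraph. -/

section Overlap
variable {α : Type}

theorem totalLength_perm {S T : List (List α)} (h : S.Perm T) : totalLength S = totalLength T :=
  (h.map _).sum_eq

theorem totalLength_cons (x : List α) (S : List (List α)) :
    totalLength (x :: S) = x.length + totalLength S := by simp [totalLength]

variable [DecidableEq α]

/-- The length of the longest suffix of the first string that is a prefix of the second. -/
def ov : List α → List α → ℕ
  | [], _ => 0
  | a :: x, y => if (a :: x) <+: y then x.length + 1 else ov x y

theorem exists_ov (x y : List α) : ∃ z, z <:+ x ∧ z <+: y ∧ z.length = ov x y := by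
  induction x with
  | nil => exact ⟨[], by simp, by simp, rfl⟩
  | cons a x ih =>
    by_cases h : (a :: x) <+: y
    · exact ⟨a :: x, List.suffix_rfl, h, by simp [ov, h]⟩
    · obtain ⟨z, h₁, h₂, h₃⟩ := ih
      exact ⟨z, h₁.trans (List.suffix_cons a x), h₂, by simp [ov, h, h₃]⟩

theorem le_ov {x y z : List α} (h₁ : z <:+ x) (h₂ : z <+: y) : z.length ≤ ov x y := by
  induction x with
  | nil => simp [List.suffix_nil.1 h₁]
  | cons a x ih =>
    rcases List.suffix_cons_iff.1 h₁ with rfl | h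
    · simp [ov, h₂]
    · have := ih h
      have h₃ := h.length_le
      unfold ov
      split_ifs
      · omega
      · exact this

theorem ov_eq_iff {x y : List α} {n : ℕ} : ov x y = n ↔
    (∃ z, z <:+ x ∧ z <+: y ∧ z.length = n) ∧ ∀ z, z <:+ x → z <+: y → z.length ≤ n := by
  constructor
  · rintro rfl
    exact ⟨exists_ov x y, fun z => le_ov⟩
  · rintro ⟨⟨z, h₁, h₂, rfl⟩, h⟩
    obtain ⟨z', h₃, h₄, h₅⟩ := exists_ov x y
    have := h z' h₃ h₄
    have := le_ov h₁ h₂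
    omega

@[simp] theorem ov_nil_left (y : List α) : ov [] y = 0 := rfl

@[simp] theorem ov_nil_right (x : List α) : ov x [] = 0 := by
  obtain ⟨z, _, h, hz⟩ := exists_ov x []
  rw [← hz, List.prefix_nil.1 h]; rfl

/-- No two members are equal, and none is a substring of another one. -/
structure FactorFree (S : List (List α)) : Prop where
  nodup : S.Nodup
  eq_of_infix : ∀ x ∈ S, ∀ y ∈ S, x <:+: y → x = y

/-- Merging consecutive strings along their overlaps. -/
theorem exists_superstring (x : List α) (P : List (List α)) :
    ∃ s, IsSuperstring s (x :: P) ∧ x <+: s ∧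
      s.length + pathWeight ov (x :: P) = totalLength (x :: P) := by
  induction P generalizing x with
  | nil => exact ⟨x, by simp [IsSuperstring], List.prefix_rfl, by simp [pathWeight, totalLength]⟩
  | cons y P ih =>
    obtain ⟨s, h₁, h₂, h₃⟩ := ih y
    -- Write `x = u ++ z` with the longest overlap `z`. The superstring `s` of the rest starts with
    -- `y`, hence with `z`, and only `u` has to be put in front of it.
    obtain ⟨z, ⟨u, hu⟩, hzy, hz⟩ := exists_ov x y
    have hx : x <+: u ++ s := by
      rw [← hu]
      exact List.prefix_append_right_inj u |>.2 (hzy.trans h₂)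
    refine ⟨u ++ s, ?_, hx, ?_⟩
    · intro w hw
      rcases List.mem_cons.1 hw with rfl | hw
      · exact hx.isInfix
      · exact (h₁ w hw).trans (List.suffix_append u s).isInfix
    · rw [totalLength_cons, ← h₃, pathWeight, ← hz, ← hu]
      simp only [List.length_append]
      omega

/-- Deletes letters from the front of `s`. Whenever a member stops being a substring, it was a
prefix of the current string and becomes the next vertex; no other member is lost in the same step.
The suffix `t` that starts with the first vertex is part of the claim because the overlap with the
preceding vertex is read off from the place where `t` begins. -/
theorem exists_path {s : List α} {S : List (List α)} (hS : FactorFree S) (hne : S ≠ [])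
    (hs : IsSuperstring s S) : ∃ x P t, (x :: P).Perm S ∧ x <+: t ∧ t <:+ s ∧
      totalLength (x :: P) ≤ t.length + pathWeight ov (x :: P) := by
  induction s generalizing S with
  | nil =>
    obtain ⟨x, S, rfl⟩ := List.exists_cons_of_ne_nil hne
    have hall : ∀ y ∈ x :: S, y = [] := fun y hy => List.infix_nil.1 (hs y hy)
    obtain rfl : S = [] := by
      refine List.eq_nil_iff_forall_not_mem.2 fun y hy => ?_
      have hn := List.nodup_cons.1 hS.nodup
      rw [hall x (by simp), ← hall y (by simp [hy])] at hn
      exact hn.1 hy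
    exact ⟨x, [], [], .refl _, by simp [hall x], by simp, by simp [totalLength, hall x]⟩
  | cons a s ih =>
    by_cases h : IsSuperstring s S
    · obtain ⟨x, P, t, h₁, h₂, h₃, h₄⟩ := ih hS hne h
      exact ⟨x, P, t, h₁, h₂, h₃.trans (List.suffix_cons a s), h₄⟩
    · simp only [IsSuperstring, not_forall] at h
      obtain ⟨x, hxS, hx⟩ := h
      have hxs : x <+: a :: s := by
        rcases List.infix_cons_iff.1 (hs x hxS) with h | h
        · exact h
        · exact absurd h hx
      have hperm : (x :: S.erase x).Perm S := (List.perm_cons_erase hxS).symm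
      have hS' : FactorFree (S.erase x) := ⟨hS.nodup.erase x, fun y hy z hz =>
        hS.eq_of_infix y (List.mem_of_mem_erase hy) z (List.mem_of_mem_erase hz)⟩
      rcases eq_or_ne (S.erase x) [] with hnil | hnil
      · refine ⟨x, [], a :: s, hnil ▸ hperm, hxs, List.suffix_rfl, ?_⟩
        have := hxs.length_le
        simp [totalLength, pathWeight] at this ⊢
        omega
      -- If another member were a prefix of `a :: s` as well, one of the two would be a prefix of
      -- the other, against factor-freeness.
      have hsup : IsSuperstring s (S.erase x) := by
        intro y hy
        rcases List.infix_cons_iff.1 (hs y (List.mem_of_mem_erase hy)) with h | h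
        · exfalso
          have hyx : y ≠ x := ((hS.nodup.mem_erase_iff).1 hy).1
          have hyS := List.mem_of_mem_erase hy
          rcases le_total x.length y.length with hl | hl
          · exact hyx (hS.eq_of_infix x hxS y hyS
              (List.prefix_of_prefix_length_le hxs h hl).isInfix).symm
          · exact hyx (hS.eq_of_infix y hyS x hxS
              (List.prefix_of_prefix_length_le h hxs hl).isInfix)
        · exact h
      obtain ⟨y, P, t, h₁, h₂, h₃, h₄⟩ := ih hS' hnil hsup
      refine ⟨x, y :: P, a :: s, (h₁.cons x).trans hperm, hxs, List.suffix_rfl, ?_⟩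
      have hy : y ∈ S.erase x := h₁.subset (by simp)
      obtain ⟨u, hu⟩ := h₃.trans (List.suffix_cons a s)
      -- Let `u` be what precedes `t`. If `x` reaches beyond `u`, the excess `x₂` is a suffix of `x`
      -- and a prefix of `t`. It cannot be longer than `y`, for then `y` would be a substring of
      -- `x`; so it is a prefix of `y` and its length bounds `ov x y` from below.
      have key : x.length + t.length ≤ (a :: s).length + ov x y := by
        rw [← hu] at hxs ⊢
        rw [List.length_append]
        rcases le_total x.length u.length with h | h
        · omega
        · obtain ⟨x₂, rfl⟩ := List.prefix_of_prefix_length_le (List.prefix_append u t) hxs h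
          replace h := (List.prefix_append_right_inj u).1 hxs
          have hle : x₂.length ≤ y.length := by
            by_contra hlt
            have h₅ := List.prefix_of_prefix_length_le h₂ h (by omega)
            have h₆ := hS.eq_of_infix y (List.mem_of_mem_erase hy) _ hxS
              (h₅.isInfix.trans (List.suffix_append u x₂).isInfix)
            exact ((hS.nodup.mem_erase_iff).1 hy).1 h₆
          have := le_ov (List.suffix_append u x₂) (List.prefix_of_prefix_length_le h h₂ hle)
          rw [List.length_append]
          omega
      rw [totalLength_cons, pathWeight]
      omega

/-- The path formulation of Shortest Superstring for factor-free collections. -/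
theorem exists_superstring_iff {S : List (List α)} (hS : FactorFree S) (L : ℕ) :
    (∃ s : List α, s.length ≤ L ∧ IsSuperstring s S) ↔
      ∃ P, P.Perm S ∧ totalLength S ≤ L + pathWeight ov P := by
  constructor
  · rintro ⟨s, hs, h⟩
    rcases eq_or_ne S [] with rfl | hne
    · exact ⟨[], .refl _, by simp [totalLength]⟩
    · obtain ⟨x, P, t, h₁, h₂, h₃, h₄⟩ := exists_path hS hne h
      have := h₃.length_le
      exact ⟨x :: P, h₁, by rw [← totalLength_perm h₁]; omega⟩
  · rintro ⟨P, hP, h⟩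
    rcases P with - | ⟨x, P⟩
    · rw [List.nil_perm.1 hP]
      exact ⟨[], by simp, by simp [IsSuperstring]⟩
    · obtain ⟨s, h₁, -, h₂⟩ := exists_superstring x P
      rw [totalLength_perm hP] at h₂
      exact ⟨s, by omega, fun y hy => h₁ y (hP.mem_iff.2 hy)⟩

/-- A path need not visit all members: the missing ones can be appended in any order, and this never
lowers the weight. -/
theorem exists_superstring_iff_path {S : List (List α)} (hS : FactorFree S) {L r : ℕ}
    (hr : totalLength S = L + r) :
    (∃ s : List α, s.length ≤ L ∧ IsSuperstring s S) ↔
      ∃ P : List (List α), P.Nodup ∧ P ⊆ S ∧ r ≤ pathWeight ov P := by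
  rw [exists_superstring_iff hS]
  constructor
  · rintro ⟨P, hP, h⟩
    exact ⟨P, hP.nodup_iff.2 hS.nodup, hP.subset, by omega⟩
  · rintro ⟨P, hP, hPS, h⟩
    refine ⟨P ++ S.filter (· ∉ P), ?_, ?_⟩
    · rw [List.perm_ext_iff_of_nodup _ hS.nodup]
      · intro x
        by_cases hx : x ∈ P
        · simp [hx, hPS hx]
        · simp [hx]
      · refine hP.append (hS.nodup.filter _) fun x hx hx' => ?_
        simp [hx] at hx'
    · have := pathWeight_le_append ov P (S.filter (· ∉ P))
      omega

/-! ### Removing substrings -/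

/-- Removes the members that are substrings of others. -/
def reduce (S : List (List α)) : List (List α) :=
  S.foldr (fun x T => if T.any (fun y => decide (x <:+: y)) = true then T else
    x :: T.filter (fun y => !decide (y <:+: x))) []

theorem reduce_cons (x : List α) (S : List (List α)) : reduce (x :: S) =
    if (reduce S).any (fun y => decide (x <:+: y)) = true then reduce S else
    x :: (reduce S).filter (fun y => !decide (y <:+: x)) := rfl

theorem reduce_sublist (S : List (List α)) : (reduce S).Sublist S := by
  induction S with
  | nil => exact .refl _
  | cons x S ih =>
    rw [reduce_cons]
    split_ifs
    · exact ih.cons x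
    · exact (List.filter_sublist.trans ih).cons_cons x

theorem factorFree_reduce (S : List (List α)) : FactorFree (reduce S) := by
  induction S with
  | nil => exact ⟨List.nodup_nil, by simp [reduce]⟩
  | cons x S ih =>
    rw [reduce_cons]
    split_ifs with h
    · exact ih
    · simp only [List.any_eq_true, decide_eq_true_eq, not_exists, not_and] at h
      refine ⟨List.nodup_cons.2 ⟨fun hx => ?_, ih.nodup.filter _⟩, fun y hy z hz hyz => ?_⟩
      · simp at hx
      · simp only [List.mem_cons, List.mem_filter, Bool.not_eq_true', decide_eq_false_iff_not]
          at hy hz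
        rcases hy with rfl | hy
        · rcases hz with rfl | hz
          · rfl
          · exact absurd hyz (h z hz.1)
        · rcases hz with rfl | hz
          · exact absurd hyz hy.2
          · exact ih.eq_of_infix y hy.1 z hz.1 hyz

/-- Each removed string is a substring of one that survives, by transitivity, even if the string
that first caused the removal is removed later. -/
theorem isSuperstring_reduce (s : List α) (S : List (List α)) :
    IsSuperstring s (reduce S) ↔ IsSuperstring s S := by
  refine ⟨fun h => ?_, fun h x hx => h x ((reduce_sublist S).subset hx)⟩
  suffices H : ∀ x ∈ S, ∃ y ∈ reduce S, x <:+: y by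
    intro x hx
    obtain ⟨y, hy, hxy⟩ := H x hx
    exact hxy.trans (h y hy)
  clear h
  induction S with
  | nil => simp
  | cons x S ih =>
    rw [reduce_cons]
    split_ifs with h
    · simp only [List.any_eq_true, decide_eq_true_eq] at h
      intro y hy
      rcases List.mem_cons.1 hy with rfl | hy
      · exact h
      · exact ih y hy
    · intro y hy
      rcases List.mem_cons.1 hy with rfl | hy
      · exact ⟨y, by simp, List.infix_rfl⟩
      · obtain ⟨z, hz, hyz⟩ := ih y hy
        by_cases hzx : z <:+: x
        · exact ⟨x, by simp, hyz.trans hzx⟩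
        · exact ⟨z, by simp [hz, hzx], hyz⟩

theorem totalLength_reduce_le (S : List (List α)) : totalLength (reduce S) ≤ totalLength S :=
  ((reduce_sublist S).map List.length).sum_le_sum (by simp)

end Overlap

end ShortestSuperstring

namespace ShortestSuperstring

/-! ### Selecting the members with the largest keys. -/

section Sorting
variable {β : Type}

/-- The members of a list, in the order of decreasing keys. -/
def sortBy (k : β → ℕ) (l : List β) : List β :=
  l.foldr (fun v m => m.filter (fun u => decide (k v ≤ k u)) ++
    v :: m.filter (fun u => !decide (k v ≤ k u))) []

theorem sortBy_cons (k : β → ℕ) (v : β) (l : List β) : sortBy k (v :: l) =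
    (sortBy k l).filter (fun u => decide (k v ≤ k u)) ++
      v :: (sortBy k l).filter (fun u => !decide (k v ≤ k u)) := rfl

theorem sortBy_perm (k : β → ℕ) (l : List β) : (sortBy k l).Perm l := by
  induction l with
  | nil => exact .refl _
  | cons v l ih =>
    rw [sortBy_cons]
    refine List.perm_middle.trans (List.Perm.cons v ?_)
    exact (List.filter_append_perm _ _).trans ih

theorem sortBy_pairwise (k : β → ℕ) (l : List β) :
    (sortBy k l).Pairwise (fun u v => k v ≤ k u) := by
  induction l with
  | nil => exact List.Pairwise.nil
  | cons v l ih =>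
    rw [sortBy_cons, List.pairwise_append, List.pairwise_cons]
    refine ⟨ih.filter _, ⟨?_, ih.filter _⟩, ?_⟩
    · intro u hu
      simp at hu
      omega
    · intro u hu x hx
      simp only [List.mem_filter, decide_eq_true_eq] at hu
      rcases List.mem_cons.1 hx with rfl | hx
      · exact hu.2
      · simp at hx
        omega

/-- A member that is not among the first `M` is beaten by all of those. -/
theorem take_sortBy {k : β → ℕ} {l : List β} {M : ℕ} {v : β} (hv : v ∈ l)
    (hv' : v ∉ (sortBy k l).take M) :
    ((sortBy k l).take M).length = M ∧ ∀ u ∈ (sortBy k l).take M, k v ≤ k u := by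
  have h₁ : v ∈ (sortBy k l).take M ++ (sortBy k l).drop M := by
    rw [List.take_append_drop]
    exact (sortBy_perm k l).mem_iff.2 hv
  have h₂ : v ∈ (sortBy k l).drop M := by
    rcases List.mem_append.1 h₁ with h | h
    · exact absurd h hv'
    · exact h
  refine ⟨?_, fun u hu => ?_⟩
  · have := List.length_pos_of_mem h₂
    rw [List.length_drop] at this
    rw [List.length_take]
    omega
  · have := sortBy_pairwise k l
    rw [← List.take_append_drop M (sortBy k l), List.pairwise_append] at this
    exact this.2.2 u hu v h₂

end Sorting

/-! ### The exchange argument and the greedy matching. -/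

section Exchange
variable {β : Type}

/-- The members of `I` that are among the best `M` between two members of `X`; `e` stands for a
missing neighbour. -/
def best (w : β → β → ℕ) (e : β) (M : ℕ) (X I : List β) : List β :=
  (e :: X).flatMap fun a => (e :: X).flatMap fun b =>
    (sortBy (fun v => w a v + w v b) I).take M

theorem length_best_le (w : β → β → ℕ) (e : β) (M : ℕ) (X I : List β) :
    (best w e M X I).length ≤ (X.length + 1) * ((X.length + 1) * M) := by
  unfold best
  rw [List.length_flatMap]
  refine (List.sum_le_card_nsmul _ ((X.length + 1) * M) ?_).trans (by simp)
  intro n hn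
  obtain ⟨a, -, rfl⟩ := List.mem_map.1 hn
  rw [List.length_flatMap]
  refine (List.sum_le_card_nsmul _ M ?_).trans (by simp)
  intro n hn
  obtain ⟨b, -, rfl⟩ := List.mem_map.1 hn
  simp

variable [DecidableEq β]

/-- The vertices that are kept. -/
def kept (w : β → β → ℕ) (e : β) (M : ℕ) (X I : List β) : List β :=
  X ++ I.filter fun v => decide (v ∈ best w e M X I)

theorem length_kept_le {w : β → β → ℕ} {e : β} {M : ℕ} {X I : List β} (hI : I.Nodup) :
    (kept w e M X I).length ≤ X.length + (X.length + 1) * ((X.length + 1) * M) := by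
  have h : (I.filter fun v => decide (v ∈ best w e M X I)).length ≤ (best w e M X I).length := by
    refine ((hI.filter _).subperm fun v hv => ?_).length_le
    simpa using (List.mem_filter.1 hv).2
  have := length_best_le w e M X I
  rw [kept, List.length_append]
  omega

/-- Induction on the number of vertices of the path that are not kept: one such vertex `v` is
exchanged for a kept one without loss of weight. The bound `2 * r` on the length of the path is what
guarantees a free candidate. The dummy `e`, of weight 0 to everything, replaces a missing neighbour
and also a neighbour in `I`, whose arcs to and from `v` have weight 0. -/
theorem exists_path_kept_aux {w : β → β → ℕ} {e : β} {r : ℕ} {X I : List β}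
    (hI : I.Nodup) (hw : ∀ u ∈ I, ∀ v ∈ I, u ≠ v → w u v = 0)
    (he : ∀ v, w e v = 0 ∧ w v e = 0) (n : ℕ) :
    ∀ P : List β, P.Nodup → P ⊆ X ++ I → r ≤ pathWeight w P → P.length ≤ 2 * r →
      P.countP (fun v => decide (v ∉ kept w e (2 * r) X I)) = n →
      ∃ Q : List β, Q.Nodup ∧ Q ⊆ kept w e (2 * r) X I ∧ r ≤ pathWeight w Q := by
  induction n with
  | zero =>
    intro P hP hsub hr hlen hn
    refine ⟨P, hP, fun v hv => ?_, hr⟩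
    have := List.countP_eq_zero.1 hn v hv
    simpa using this
  | succ n ih =>
    intro P hP hsub hr hlen hn
    obtain ⟨v, hvP, hvk⟩ := List.countP_pos_iff.1 (by rw [hn]; omega : 0 < P.countP _)
    have hvk : v ∉ kept w e (2 * r) X I := by simpa using hvk
    obtain ⟨P₁, P₂, rfl⟩ := List.append_of_mem hvP
    have hvX : v ∉ X := fun h => hvk (List.mem_append_left _ h)
    have hvI : v ∈ I := (List.mem_append.1 (hsub hvP)).resolve_left hvX
    have hvb : v ∉ best w e (2 * r) X I := fun h =>
      hvk (List.mem_append_right _ (List.mem_filter.2 ⟨hvI, by simpa using h⟩))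
    -- the neighbours of `v`, as far as they are in `X`
    have hnb : ∀ o : Option β, (∀ x ∈ o, x ∈ X ++ I ∧ x ≠ v) → ∃ a ∈ e :: X,
        (o.elim 0 (fun x => w x v) = w a v ∧ o.elim 0 (w v) = w v a) ∧
        ∀ u, w a u ≤ o.elim 0 (fun x => w x u) ∧ w u a ≤ o.elim 0 (w u) := by
      intro o ho
      rcases o with - | x
      · exact ⟨e, by simp, by simp [he], fun u => by simp [he]⟩
      · obtain ⟨hx, hxv⟩ := ho x rfl
        rcases List.mem_append.1 hx with h | h
        · exact ⟨x, by simp [h], by simp, fun u => by simp⟩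
        · exact ⟨e, by simp, by simp [he, hw x h v hvI hxv, hw v hvI x h (Ne.symm hxv)],
            fun u => by simp [he]⟩
    have hnd := List.nodup_middle.1 hP
    rw [List.nodup_cons, List.mem_append, not_or] at hnd
    obtain ⟨a, ha, ⟨ha₁, -⟩, ha₂⟩ := hnb P₁.getLast? fun x hx => by
      have := List.mem_of_getLast? hx
      exact ⟨hsub (by simp [this]), fun h => hnd.1.1 (h ▸ this)⟩
    obtain ⟨b, hb, ⟨-, hb₁⟩, hb₂⟩ := hnb P₂.head? fun x hx => by
      have := List.mem_of_mem_head? hx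
      exact ⟨hsub (by simp [this]), fun h => hnd.1.2 (h ▸ this)⟩
    have hT : ∀ u ∈ (sortBy (fun v => w a v + w v b) I).take (2 * r),
        u ∈ best w e (2 * r) X I := fun u hu =>
      List.mem_flatMap.2 ⟨a, ha, List.mem_flatMap.2 ⟨b, hb, hu⟩⟩
    obtain ⟨hlenT, hkey⟩ := take_sortBy (k := fun v => w a v + w v b) hvI (fun h => hvb (hT v h))
    -- Pigeonhole: there are exactly `2 * r` candidates, all different from `v`, while the path
    -- without `v` has at most `2 * r - 1` vertices.
    obtain ⟨u, huT, huP⟩ : ∃ u ∈ (sortBy (fun v => w a v + w v b) I).take (2 * r),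
        u ∉ P₁ ++ v :: P₂ := by
      by_contra! hcon
      have hsubT : (sortBy (fun v => w a v + w v b) I).take (2 * r) ⊆ P₁ ++ P₂ := by
        intro u hu
        have h₁ := hcon u hu
        have h₂ : u ≠ v := fun h => hvb (h ▸ hT u hu)
        simpa [h₂] using h₁
      have hndT : ((sortBy (fun v => w a v + w v b) I).take (2 * r)).Nodup :=
        ((sortBy_perm _ _).nodup_iff.2 hI).sublist (List.take_sublist _ _)
      have := (hndT.subperm hsubT).length_le
      simp only [List.length_append, List.length_cons] at this hlen
      omega
    have huI : u ∈ I := (sortBy_perm _ _).subset (List.mem_of_mem_take huT)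
    have huk : u ∈ kept w e (2 * r) X I :=
      List.mem_append_right _ (List.mem_filter.2 ⟨huI, by simpa using hT u huT⟩)
    refine ih (P₁ ++ u :: P₂) ?_ ?_ ?_ ?_ ?_
    · refine List.nodup_middle.2 (List.nodup_cons.2 ⟨fun h => huP ?_, hnd.2⟩)
      rcases List.mem_append.1 h with h | h <;> simp [h]
    · intro x hx
      rcases List.mem_append.1 hx with hx | hx
      · exact hsub (by simp [hx])
      · rcases List.mem_cons.1 hx with rfl | hx
        · exact List.mem_append_right _ huI
        · exact hsub (by simp [hx])
    -- For `v` the weights to the true neighbours equal those to `a` and `b`; for `u` they are at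
    -- least as large. Since `u` is ranked no lower than `v` between `a` and `b`, the weight does
    -- not drop.
    · refine hr.trans ?_
      rw [pathWeight_append_cons, pathWeight_append_cons, ha₁, hb₁]
      have h₁ := hkey u huT
      have h₂ := (ha₂ u).1
      have h₃ := (hb₂ u).2
      omega
    · simpa using hlen
    · simp only [List.countP_append, List.countP_cons, hvk, huk] at hn ⊢
      simp at hn ⊢
      omega

/-- Paths of weight `r` exist among the kept vertices if they exist at all. -/
theorem exists_path_kept_iff {w : β → β → ℕ} {e : β} {r : ℕ} {X I S : List β}
    (hS : S.Nodup) (hperm : (X ++ I).Perm S) (hw : ∀ u ∈ I, ∀ v ∈ I, u ≠ v → w u v = 0)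
    (he : ∀ v, w e v = 0 ∧ w v e = 0) :
    (∃ P : List β, P.Nodup ∧ P ⊆ S ∧ r ≤ pathWeight w P) ↔
      ∃ P : List β, P.Nodup ∧ P ⊆ kept w e (2 * r) X I ∧ r ≤ pathWeight w P := by
  have hI : I.Nodup := (hperm.nodup_iff.2 hS).of_append_right
  constructor
  · rintro ⟨P, hP, hPS, hr⟩
    obtain ⟨Q, hQ, hQr, hQl⟩ := exists_short_sublist w P r hr
    exact exists_path_kept_aux hI hw he _ Q (hP.sublist hQ)
      (fun x hx => hperm.symm.subset (hPS (hQ.subset hx))) hQr hQl rfl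
  · rintro ⟨P, hP, hPS, hr⟩
    refine ⟨P, hP, fun x hx => hperm.subset ?_, hr⟩
    rcases List.mem_append.1 (hPS hx) with h | h
    · exact List.mem_append_left _ h
    · exact List.mem_append_right _ (List.mem_filter.1 h).1

/-- A maximal set of disjoint arcs, found greedily: the first list consists of the vertices without
an arc, the second one of pairs of consecutive vertices that are joined by arcs. -/
def cover (w : β → β → ℕ) (S : List β) : List β × List β :=
  S.foldr (fun x T => StackProg.listCase
    (T.1.filter fun y => decide (0 < w x y) || decide (0 < w y x)) (x :: T.1, T.2)
    fun y _ => (T.1.filter fun z => !decide (z = y),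
      if 0 < w x y then x :: y :: T.2 else y :: x :: T.2)) ([], [])

theorem cover_cons (w : β → β → ℕ) (x : β) (S : List β) : cover w (x :: S) =
    StackProg.listCase ((cover w S).1.filter fun y => decide (0 < w x y) || decide (0 < w y x))
      (x :: (cover w S).1, (cover w S).2)
      fun y _ => ((cover w S).1.filter fun z => !decide (z = y),
        if 0 < w x y then x :: y :: (cover w S).2 else y :: x :: (cover w S).2) := rfl

/-- The greedy matching is maximal, so no two unmatched vertices are joined by an arc. Each matched
pair is listed in the direction of an arc of positive weight, so the listing itself is a path with
at least one unit of weight for every two vertices. -/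
theorem cover_spec (w : β → β → ℕ) {S : List β} (hS : S.Nodup) :
    ((cover w S).2 ++ (cover w S).1).Perm S ∧
    (∀ u ∈ (cover w S).1, ∀ v ∈ (cover w S).1, u ≠ v → w u v = 0) ∧
    (cover w S).2.length ≤ 2 * pathWeight w (cover w S).2 := by
  induction S with
  | nil => simp [cover]
  | cons x S ih =>
    obtain ⟨h₁, h₂, h₃⟩ := ih (List.nodup_cons.1 hS).2
    rw [cover_cons]
    have hI := (h₁.nodup_iff.2 (List.nodup_cons.1 hS).2).of_append_right
    revert h₁ h₂ h₃ hI
    generalize (cover w S).1 = I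
    generalize (cover w S).2 = X
    intro h₁ h₂ h₃ hI
    rcases hf : I.filter fun y => decide (0 < w x y) || decide (0 < w y x) with - | ⟨y, t⟩
    · have hf' : ∀ y ∈ I, w x y = 0 ∧ w y x = 0 := by
        intro y hy
        have := List.filter_eq_nil_iff.1 hf y hy
        simpa using this
      simp only [StackProg.listCase]
      refine ⟨List.perm_middle.trans (h₁.cons x), fun u hu v hv huv => ?_, h₃⟩
      rcases List.mem_cons.1 hu with hu' | hu'
      · rcases List.mem_cons.1 hv with hv' | hv'
        · exact absurd (hu'.trans hv'.symm) huv
        · exact hu' ▸ (hf' v hv').1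
      · rcases List.mem_cons.1 hv with hv' | hv'
        · exact hv' ▸ (hf' u hu').2
        · exact h₂ u hu' v hv' huv
    · have hy : y ∈ I.filter fun y => decide (0 < w x y) || decide (0 < w y x) := by simp [hf]
      rw [List.mem_filter] at hy
      simp only [Bool.or_eq_true, decide_eq_true_eq] at hy
      have hy₂ : (y :: I.filter fun z => !decide (z = y)).Perm I := by
        have e : (I.filter fun z => !decide (z = y)) = I.erase y := by
          rw [hI.erase_eq_filter]
          rfl
        rw [e]
        exact (List.perm_cons_erase hy.1).symm
      simp only [StackProg.listCase]
      refine ⟨?_, fun u hu v hv huv => h₂ u (List.mem_filter.1 hu).1 v (List.mem_filter.1 hv).1 huv,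
        ?_⟩
      · have h₄ : (x :: y :: X ++ I.filter fun z => !decide (z = y)).Perm (x :: S) := by
          refine List.Perm.cons x (List.Perm.trans ?_ h₁)
          exact List.perm_middle.symm.trans (hy₂.append_left X)
        split_ifs
        · exact h₄
        · exact (List.Perm.swap x y _).trans h₄
      · split_ifs with h
        · rw [pathWeight_cons, pathWeight_cons]
          simp
          omega
        · have := hy.2.resolve_left h
          rw [pathWeight_cons, pathWeight_cons]
          simp
          omega

end Exchange

end ShortestSuperstring

/-! ### Strings with two extra letters and their block code -/

namespace ShortestSuperstring

section Gadget
variable {α : Type}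

/-- The string `p # i $ q`, where the two extra letters are `inr false` and `inr true`. -/
def gadget (p i q : List α) : List (α ⊕ Bool) :=
  p.map .inl ++ .inr false :: (i.map .inl ++ .inr true :: q.map .inl)

/-- Each marker occurs only once in a gadget, so the part between the two markers can be read off
from any factorization. -/
theorem gadget_eq {i p' i' q' : List α} {c d : List (α ⊕ Bool)}
    (h : gadget p' i' q' = c ++ .inr false :: (i.map .inl ++ .inr true :: d)) : i = i' := by
  have h₁ := (List.append_cons_inj_of_notMem (by simp) (by simp)).1 h
  have h₂ := (List.append_cons_inj_of_notMem (by simp) (by simp)).1 h₁.2.2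
  exact (List.map_injective_iff.2 Sum.inl_injective h₂.1).symm

theorem gadget_infix {p i q p' i' q' : List α} (h : gadget p i q <:+: gadget p' i' q') :
    i = i' := by
  obtain ⟨c, d, h⟩ := h
  refine gadget_eq (c := c ++ p.map .inl) (d := q.map .inl ++ d) (h.symm.trans ?_)
  simp [gadget]

theorem prefix_of_notMem {β : Type} {z l m : List β} {a : β} (h : z <+: l ++ a :: m)
    (ha : a ∉ z) : z <+: l := by
  rcases le_total z.length l.length with hl | hl
  · exact List.prefix_of_prefix_length_le h (List.prefix_append _ _) hl
  · obtain ⟨t, rfl⟩ := List.prefix_of_prefix_length_le (List.prefix_append _ _) h hl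
    rw [List.prefix_append_right_inj] at h
    cases t with
    | nil => simp
    | cons b t =>
      obtain ⟨rfl, -⟩ := List.cons_prefix_cons.1 h
      simp at ha

theorem suffix_of_notMem {β : Type} {z l m : List β} {a : β} (h : z <:+ l ++ a :: m)
    (ha : a ∉ z) : z <:+ m := by
  rw [← List.reverse_prefix] at h ⊢
  refine prefix_of_notMem (a := a) (m := l.reverse) ?_ (by simpa using ha)
  simpa using h

variable [DecidableEq α]

theorem ov_map {β : Type} [DecidableEq β] {f : α → β} (hf : Function.Injective f)
    (x y : List α) : ov (x.map f) (y.map f) = ov x y := by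
  induction x with
  | nil => rfl
  | cons a x ih =>
    have h : (a :: x).map f <+: y.map f ↔ (a :: x) <+: y :=
      List.prefix_map_iff_of_injective hf
    rw [List.map_cons] at h ⊢
    simp only [ov, h, List.length_map, ih]

/-- An overlap that contained the first marker would contain everything after it in the left gadget,
in particular the whole label and the second marker; as a prefix of the right gadget it would then
force the labels to agree. So an overlap contains neither marker and lies within the outer parts. -/
theorem ov_gadget {p i q p' i' q' : List α} (hi : i ≠ i') :
    ov (gadget p i q) (gadget p' i' q') = ov q p' := by
  rw [← ov_map (β := α ⊕ Bool) Sum.inl_injective, ov_eq_iff]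
  constructor
  · obtain ⟨z, h₁, h₂, h₃⟩ := exists_ov (q.map (Sum.inl : α → α ⊕ Bool)) (p'.map Sum.inl)
    refine ⟨z, h₁.trans ?_, h₂.trans (List.prefix_append _ _), h₃⟩
    refine List.suffix_append_of_suffix ((?_ : _ <:+ _).trans (List.suffix_cons _ _))
    exact List.suffix_append_of_suffix (List.suffix_cons _ _)
  · intro z hz₁ hz₂
    have h₁ : .inr false ∉ z := by
      intro hz
      obtain ⟨c, d, rfl⟩ := List.append_of_mem hz
      obtain ⟨u, hu⟩ := hz₁
      obtain ⟨v, hv⟩ := hz₂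
      rw [← List.append_assoc] at hu
      have h := (List.append_cons_inj_of_notMem (by simp) (by simp)).1 hu.symm
      refine hi (gadget_eq (p' := p') (q' := q') (c := c) (d := q.map .inl ++ v) ?_)
      rw [← hv, ← h.2.2]
      simp
    have h₂ := prefix_of_notMem hz₂ h₁
    have h₃ : .inr true ∉ z := fun h => by
      have := h₂.subset h
      simp at this
    have hz₁' : z <:+ (p.map .inl ++ .inr false :: i.map .inl) ++ .inr true :: q.map .inl := by
      simpa [gadget] using hz₁
    exact le_ov (suffix_of_notMem hz₁' h₃) h₂

end Gadget

/-! ### A block code over two letters that preserves overlaps. -/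

section Code
variable {α : Type} (c₀ c₁ : α)

/-- The code of a letter. The pattern `c₀ c₀` occurs at the start of code words only. -/
def block : α ⊕ Bool → List α
  | .inl a => [c₀, c₀, c₁, c₁, c₁, a, c₁]
  | .inr b => [c₀, c₀, c₁, c₀, c₁, if b = true then c₁ else c₀, c₁]

def code (l : List (α ⊕ Bool)) : List α := l.flatMap (block c₀ c₁)

theorem code_nil : code c₀ c₁ [] = [] := rfl

theorem code_cons (b : α ⊕ Bool) (l : List (α ⊕ Bool)) :
    code c₀ c₁ (b :: l) = block c₀ c₁ b ++ code c₀ c₁ l := rfl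

theorem code_append (l m : List (α ⊕ Bool)) :
    code c₀ c₁ (l ++ m) = code c₀ c₁ l ++ code c₀ c₁ m := List.flatMap_append

theorem length_code (l : List (α ⊕ Bool)) : (code c₀ c₁ l).length = 7 * l.length := by
  induction l with
  | nil => rfl
  | cons b l ih =>
    rw [code_cons, List.length_append, ih, List.length_cons]
    cases b <;> simp [block] <;> omega

variable {c₀ c₁}

/-- All blocks have length 7, the fourth letter separates letters from markers, and the sixth
carries the content. -/
theorem code_prefix (hc : c₀ ≠ c₁) {u v : List (α ⊕ Bool)}
    (h : code c₀ c₁ u <+: code c₀ c₁ v) : u <+: v := by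
  induction u generalizing v with
  | nil => simp
  | cons a u ih =>
    cases v with
    | nil => cases a <;> simp [code_cons, code_nil, block] at h
    | cons b v =>
      rw [code_cons, code_cons] at h
      have hc' := hc.symm
      rw [List.cons_prefix_cons]
      rcases a with a | a <;> rcases b with b | b
      · simp [block, List.cons_prefix_cons] at h
        exact ⟨by rw [h.1], ih h.2⟩
      · simp [block, List.cons_prefix_cons, hc'] at h
      · simp [block, List.cons_prefix_cons, hc] at h
      · cases a <;> cases b <;> simp [block, List.cons_prefix_cons, hc, hc'] at h ⊢ <;> exact ih h

theorem prefix_code {u v : List (α ⊕ Bool)} (h : u <+: v) : code c₀ c₁ u <+: code c₀ c₁ v := by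
  obtain ⟨t, rfl⟩ := h
  rw [code_append]
  exact List.prefix_append _ _

theorem suffix_code {u v : List (α ⊕ Bool)} (h : u <:+ v) : code c₀ c₁ u <:+ code c₀ c₁ v := by
  obtain ⟨t, rfl⟩ := h
  rw [code_append]
  exact List.suffix_append _ _

/-- Suffixes of coded strings that start like a coded string are coded strings. -/
theorem exists_eq_code (hc : c₀ ≠ c₁) {z : List α} {v : List (α ⊕ Bool)}
    (h : z <:+ code c₀ c₁ v) (hz : z ≠ []) (hz' : z.take 2 <+: [c₀, c₀]) :
    ∃ v', v' <:+ v ∧ z = code c₀ c₁ v' := by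
  induction v with
  | nil => exact absurd (List.suffix_nil.1 h) hz
  | cons b v ih =>
    by_cases hv : z <:+ code c₀ c₁ v
    · obtain ⟨v', h₁, h₂⟩ := ih hv
      exact ⟨v', h₁.trans (List.suffix_cons _ _), h₂⟩
    · refine ⟨b :: v, List.suffix_rfl, ?_⟩
      rw [code_cons] at h ⊢
      have hc' := hc.symm
      rcases b with a | b
      · simp only [block, List.cons_append, List.nil_append, List.suffix_cons_iff, hv, or_false]
          at h ⊢
        rcases h with rfl | rfl | rfl | rfl | rfl | rfl | rfl
        · rfl
        all_goals simp [List.cons_prefix_cons, hc'] at hz'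
      · simp only [block, List.cons_append, List.nil_append, List.suffix_cons_iff, hv, or_false]
          at h ⊢
        rcases h with rfl | rfl | rfl | rfl | rfl | rfl | rfl
        · rfl
        all_goals simp [List.cons_prefix_cons, hc'] at hz'

theorem take_two_code {u : List (α ⊕ Bool)} (hu : u ≠ []) :
    (code c₀ c₁ u).take 2 = [c₀, c₀] := by
  obtain ⟨b, u, rfl⟩ := List.exists_cons_of_ne_nil hu
  cases b <;> simp [code_cons, block]

theorem code_infix (hc : c₀ ≠ c₁) {u v : List (α ⊕ Bool)} (hu : u ≠ [])
    (h : code c₀ c₁ u <:+: code c₀ c₁ v) : u <:+: v := by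
  obtain ⟨s, t, h⟩ := h
  rw [List.append_assoc] at h
  have h₁ : code c₀ c₁ u ++ t <:+ code c₀ c₁ v := ⟨s, h⟩
  have h₂ : 2 ≤ (code c₀ c₁ u).length := by
    rw [length_code]
    have := List.length_pos_of_ne_nil hu
    omega
  have h₃ : (code c₀ c₁ u ++ t).take 2 = [c₀, c₀] := by
    rw [List.take_append_of_le_length h₂, take_two_code hu]
  obtain ⟨v', h₄, h₅⟩ := exists_eq_code hc h₁ (fun h => by simp [h] at h₃) (by simp [h₃])
  exact (code_prefix hc ⟨t, h₅⟩).isInfix.trans h₄.isInfix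

/-- A nonempty overlap starts like the right-hand code, hence with the synchronizing pattern; being
a suffix of the left-hand code, it must then begin at a block boundary. So it is itself a coded
string, and decoding it gives an overlap of `u` and `v`. -/
theorem ov_code [DecidableEq α] (hc : c₀ ≠ c₁) (u v : List (α ⊕ Bool)) :
    ov (code c₀ c₁ u) (code c₀ c₁ v) = 7 * ov u v := by
  rw [ov_eq_iff]
  constructor
  · obtain ⟨z, h₁, h₂, h₃⟩ := exists_ov u v
    exact ⟨code c₀ c₁ z, suffix_code h₁, prefix_code h₂, by rw [length_code, h₃]⟩
  · intro z h₁ h₂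
    rcases eq_or_ne z [] with rfl | hz
    · simp
    have hv : v ≠ [] := by
      rintro rfl
      exact hz (List.prefix_nil.1 h₂)
    have h₃ : z.take 2 <+: [c₀, c₀] := by
      rw [← take_two_code (c₁ := c₁) hv]
      exact h₂.take 2
    obtain ⟨u', h₄, rfl⟩ := exists_eq_code hc h₁ hz h₃
    rw [length_code]
    exact Nat.mul_le_mul_left _ (le_ov h₄ (code_prefix hc h₂))

theorem mem_of_mem_code {a : α} {l : List (α ⊕ Bool)} (h : a ∈ code c₀ c₁ l) :
    a = c₀ ∨ a = c₁ ∨ .inl a ∈ l := by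
  obtain ⟨b, hb, ha⟩ := List.mem_flatMap.1 h
  rcases b with x | b
  · simp [block] at ha
    have : a = c₀ ∨ a = c₁ ∨ a = x := by tauto
    rcases this with rfl | rfl | rfl <;> simp [hb]
  · cases b
    all_goals simp [block] at ha; tauto

end Code

/-! ### Replacing long strings by short ones with proportional overlaps. -/

section Shrink
variable {α : Type} [DecidableEq α] (c₀ c₁ : α)

/-- A string over `c₀` and `c₁` that identifies a member of `Q`. -/
def label (Q : List (List α)) (x : List α) : List α :=
  (Q.idxOf x).bits.map fun b => if b = true then c₁ else c₀

/-- The string `x` with all but its first and last `r` letters replaced by its label, and coded. -/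
def shrinkString (r : ℕ) (Q : List (List α)) (x : List α) : List α :=
  code c₀ c₁ (gadget (x.take r) (label c₀ c₁ Q x) (x.drop (x.length - r)))

variable {c₀ c₁}

theorem label_inj (hc : c₀ ≠ c₁) {Q : List (List α)} {x y : List α} (hx : x ∈ Q)
    (h : label c₀ c₁ Q x = label c₀ c₁ Q y) : x = y := by
  have h₁ := List.map_injective_iff.2 (fun b b' hb => by
    cases b <;> cases b' <;> simp [hc, hc.symm] at hb ⊢) h
  exact (List.idxOf_inj hx).1 (bits_injective h₁)

/-- An overlap of length at most `r` sees only the last `r` letters of `x` and the first `r` letters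
of `y`. The strings may be shorter than `r`, and the two ends of one string may intersect; neither
does any harm. -/
theorem ov_drop_take {x y : List α} {r : ℕ} (h : ov x y ≤ r) :
    ov (x.drop (x.length - r)) (y.take r) = ov x y := by
  rw [ov_eq_iff]
  constructor
  · obtain ⟨z, h₁, h₂, h₃⟩ := exists_ov x y
    refine ⟨z, ?_, ?_, h₃⟩
    · refine List.suffix_of_suffix_length_le h₁ (List.drop_suffix _ _) ?_
      have := h₁.length_le
      rw [List.length_drop]
      omega
    · refine List.prefix_of_prefix_length_le h₂ (List.take_prefix _ _) ?_
      have := h₂.length_le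
      rw [List.length_take]
      omega
  · exact fun z h₁ h₂ => le_ov (h₁.trans (List.drop_suffix _ _)) (h₂.trans (List.take_prefix _ _))

theorem ov_shrinkString (hc : c₀ ≠ c₁) {r : ℕ} {Q : List (List α)} {x y : List α} (hx : x ∈ Q)
    (hxy : x ≠ y) (h : ov x y ≤ r) :
    ov (shrinkString c₀ c₁ r Q x) (shrinkString c₀ c₁ r Q y) = 7 * ov x y := by
  rw [shrinkString, shrinkString, ov_code hc, ov_gadget (fun h => hxy (label_inj hc hx h)),
    ov_drop_take h]

theorem shrinkString_infix (hc : c₀ ≠ c₁) {r : ℕ} {Q : List (List α)} {x y : List α} (hx : x ∈ Q)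
    (h : shrinkString c₀ c₁ r Q x <:+: shrinkString c₀ c₁ r Q y) : x = y :=
  label_inj hc hx (gadget_infix (code_infix hc (by simp [gadget]) h))

theorem factorFree_map_shrinkString (hc : c₀ ≠ c₁) (r : ℕ) {Q : List (List α)} (hQ : Q.Nodup) :
    FactorFree (Q.map (shrinkString c₀ c₁ r Q)) := by
  refine ⟨hQ.map_on fun x hx y _ h => shrinkString_infix hc hx (by rw [h]), ?_⟩
  intro x' hx' y' hy' h
  obtain ⟨x, hx, rfl⟩ := List.mem_map.1 hx'
  obtain ⟨y, hy, rfl⟩ := List.mem_map.1 hy'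
  rw [shrinkString_infix hc hx h]

theorem pathWeight_map_shrinkString (hc : c₀ ≠ c₁) {r : ℕ} {Q P : List (List α)}
    (hr : ∀ x ∈ Q, ∀ y ∈ Q, x ≠ y → ov x y ≤ r) (hP : P.Nodup) (hPQ : P ⊆ Q) :
    pathWeight ov (P.map (shrinkString c₀ c₁ r Q)) = 7 * pathWeight ov P := by
  rw [pathWeight_map]
  exact pathWeight_const_mul hP fun x hx y hy hxy =>
    ov_shrinkString hc (hPQ hx) hxy (hr x (hPQ hx) y (hPQ hy) hxy)

/-- Distinct labels make `shrinkString` injective on `Q`, so paths correspond to each other, with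
weights multiplied by 7. -/
theorem exists_path_map_shrinkString (hc : c₀ ≠ c₁) {r k : ℕ} {Q : List (List α)}
    (hr : ∀ x ∈ Q, ∀ y ∈ Q, x ≠ y → ov x y ≤ r) :
    (∃ P : List (List α), P.Nodup ∧ P ⊆ Q.map (shrinkString c₀ c₁ r Q) ∧
      7 * k ≤ pathWeight ov P) ↔
    ∃ P : List (List α), P.Nodup ∧ P ⊆ Q ∧ k ≤ pathWeight ov P := by
  constructor
  · rintro ⟨P, hP, hPQ, h⟩
    obtain ⟨P', hP', rfl⟩ : ∃ P', P' ⊆ Q ∧ P = P'.map (shrinkString c₀ c₁ r Q) := by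
      clear h hP
      induction P with
      | nil => exact ⟨[], by simp, rfl⟩
      | cons x P ih =>
        obtain ⟨P', h₁, h₂⟩ := ih fun y hy => hPQ (by simp [hy])
        obtain ⟨y, hy, hyx⟩ := List.mem_map.1 (hPQ List.mem_cons_self)
        exact ⟨y :: P', List.cons_subset.2 ⟨hy, h₁⟩, by rw [List.map_cons, hyx, h₂]⟩
    have hnd : P'.Nodup := hP.of_map _
    rw [pathWeight_map_shrinkString hc hr hnd hP'] at h
    exact ⟨P', hnd, hP', by omega⟩
  · rintro ⟨P, hP, hPQ, h⟩
    refine ⟨P.map (shrinkString c₀ c₁ r Q), ?_, List.map_subset _ hPQ, ?_⟩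
    · exact hP.map_on fun x hx y _ h => shrinkString_infix hc (hPQ hx) (by rw [h])
    · rw [pathWeight_map_shrinkString hc hr hP hPQ]
      omega

theorem length_shrinkString_le (r : ℕ) (Q : List (List α)) (x : List α) :
    (shrinkString c₀ c₁ r Q x).length ≤ 7 * (2 * r + 2 + (Q.idxOf x).bits.length) := by
  rw [shrinkString, length_code]
  refine Nat.mul_le_mul_left _ ?_
  simp only [gadget, label, List.length_append, List.length_map, List.length_cons,
    List.length_take, List.length_drop]
  omega

end Shrink

end ShortestSuperstring

/-! ### The kernelization -/

namespace ShortestSuperstring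

section Kernel
variable {α : Type} [DecidableEq α] (c₀ c₁ : α)

/-- The strings of `T` that matter for paths of weight `r`. -/
def keptStrings (r : ℕ) (T : List (List α)) : List (List α) :=
  kept ov [] (2 * r) (cover ov T).2 (cover ov T).1

/-- The strings that matter, in short form. -/
def shrunkStrings (r : ℕ) (T : List (List α)) : List (List α) :=
  (keptStrings r T).map (shrinkString c₀ c₁ r (keptStrings r T))

/-- The kernel of an instance with the factor-free collection `T` and the parameter `r`. -/
def kernelOfFactorFree (r : ℕ) (T : List (List α)) : List (List α) × ℕ :=
  if r = 0 then ([], 0)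
  else if (T.any fun x => T.any fun y => !decide (x = y) && decide (r ≤ ov x y)) = true then ([], 0)
  else if 2 * r ≤ (cover ov T).2.length then ([], 0)
  -- A path of positive weight needs two vertices. The test also ensures that `c₁` is used only when
  -- there are two incomparable strings, which requires two different letters.
  else if T.length ≤ 1 then ([[c₀]], 0)
  -- The weight of a path never exceeds the total length, so this is a no-instance. Beyond this test
  -- the subtraction of `7 * r` is not truncated.
  else if totalLength (shrunkStrings c₀ c₁ r T) < 7 * r then ([[c₀]], 0)
  else (shrunkStrings c₀ c₁ r T, totalLength (shrunkStrings c₀ c₁ r T) - 7 * r)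

/-- The kernel of an instance. -/
def kernel (I : List (List α) × ℕ) : List (List α) × ℕ :=
  kernelOfFactorFree c₀ c₁ (totalLength (reduce I.1) - I.2) (reduce I.1)

variable {c₀ c₁}

theorem kernelOfFactorFree_cases (r : ℕ) (T : List (List α)) :
    (kernelOfFactorFree c₀ c₁ r T = ([], 0) ∧
      (r = 0 ∨ (∃ x ∈ T, ∃ y ∈ T, x ≠ y ∧ r ≤ ov x y) ∨ 2 * r ≤ (cover ov T).2.length)) ∨
    (kernelOfFactorFree c₀ c₁ r T = ([[c₀]], 0) ∧ 0 < r ∧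
      (T.length ≤ 1 ∨ ((∀ x ∈ T, ∀ y ∈ T, x ≠ y → ov x y < r) ∧
        totalLength (shrunkStrings c₀ c₁ r T) < 7 * r))) ∨
    (kernelOfFactorFree c₀ c₁ r T =
        (shrunkStrings c₀ c₁ r T, totalLength (shrunkStrings c₀ c₁ r T) - 7 * r) ∧
      0 < r ∧ (∀ x ∈ T, ∀ y ∈ T, x ≠ y → ov x y < r) ∧ (cover ov T).2.length < 2 * r ∧
      1 < T.length ∧ 7 * r ≤ totalLength (shrunkStrings c₀ c₁ r T)) := by
  unfold kernelOfFactorFree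
  split_ifs with h₁ h₂ h₃ h₄ h₅
  · simp [h₁]
  · refine .inl ⟨rfl, .inr (.inl ?_)⟩
    simpa using h₂
  · exact .inl ⟨rfl, .inr (.inr h₃)⟩
  · exact .inr (.inl ⟨rfl, Nat.pos_of_ne_zero h₁, .inl h₄⟩)
  · refine .inr (.inl ⟨rfl, Nat.pos_of_ne_zero h₁, .inr ⟨?_, h₅⟩⟩)
    simpa using h₂
  · refine .inr (.inr ⟨rfl, Nat.pos_of_ne_zero h₁, ?_, by omega, by omega, by omega⟩)
    simpa using h₂

theorem keptStrings_subset {r : ℕ} {T : List (List α)} (hT : T.Nodup) : keptStrings r T ⊆ T := by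
  have h := (cover_spec ov hT).1
  intro x hx
  refine h.subset ?_
  rcases List.mem_append.1 hx with h | h
  · exact List.mem_append_left _ h
  · exact List.mem_append_right _ (List.mem_filter.1 h).1

theorem nodup_keptStrings {r : ℕ} {T : List (List α)} (hT : T.Nodup) :
    (keptStrings r T).Nodup := by
  have h := (cover_spec ov hT).1.nodup_iff.2 hT
  exact h.sublist (List.Sublist.append_left List.filter_sublist _)

/-- The weight is the number of letters saved by merging along the path, and one cannot save more
letters than there are. -/
theorem pathWeight_le_totalLength {P U : List (List α)} (hP : P.Nodup) (hPU : P ⊆ U) :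
    pathWeight ov P ≤ totalLength U := by
  obtain ⟨P', h₁, h₂⟩ := hP.subperm hPU
  have h₃ : totalLength P' ≤ totalLength U := (h₂.map List.length).sum_le_sum (by simp)
  rw [totalLength_perm h₁] at h₃
  refine le_trans ?_ h₃
  cases P with
  | nil => simp [pathWeight]
  | cons x P =>
    obtain ⟨s, -, -, h⟩ := exists_superstring x P
    omega

/-- Combines the exchange argument, with the empty string as the dummy vertex since it overlaps with
nothing, and the shrinking of strings. -/
theorem exists_path_shrunkStrings_iff (hc : c₀ ≠ c₁) {r : ℕ} {T : List (List α)} (hT : T.Nodup)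
    (hr : ∀ x ∈ T, ∀ y ∈ T, x ≠ y → ov x y < r) :
    (∃ P : List (List α), P.Nodup ∧ P ⊆ T ∧ r ≤ pathWeight ov P) ↔
      ∃ P : List (List α), P.Nodup ∧ P ⊆ shrunkStrings c₀ c₁ r T ∧ 7 * r ≤ pathWeight ov P := by
  obtain ⟨h₁, h₂, -⟩ := cover_spec ov hT
  rw [exists_path_kept_iff (e := []) hT h₁ h₂ (by simp)]
  refine (exists_path_map_shrinkString hc fun x hx y hy hxy => ?_).symm
  exact (hr x (keptStrings_subset hT hx) y (keptStrings_subset hT hy) hxy).le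

theorem kernelOfFactorFree_iff (hc : c₀ ≠ c₁) {T : List (List α)} (hT : FactorFree T) {r L : ℕ}
    (hr : r = totalLength T - L) :
    (∃ s : List α, s.length ≤ L ∧ IsSuperstring s T) ↔
      ∃ s : List α, s.length ≤ (kernelOfFactorFree c₀ c₁ r T).2 ∧
        IsSuperstring s (kernelOfFactorFree c₀ c₁ r T).1 := by
  have hno : ¬ ∃ s : List α, s.length ≤ 0 ∧ IsSuperstring s [[c₀]] := by
    rintro ⟨s, hs, h⟩
    have := (h [c₀] (by simp)).length_le
    simp at this
    omega
  have hyes : ∃ s : List α, s.length ≤ 0 ∧ IsSuperstring s [] := ⟨[], by simp, by simp [IsSuperstring]⟩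
  rcases Nat.eq_zero_or_pos r with h₀ | h₀
  · have : kernelOfFactorFree c₀ c₁ r T = ([], 0) := by simp [kernelOfFactorFree, h₀]
    rw [this]
    refine iff_of_true ?_ hyes
    rw [exists_superstring_iff hT]
    exact ⟨T, .refl _, by omega⟩
  rw [exists_superstring_iff_path hT (r := r) (by omega)]
  rcases kernelOfFactorFree_cases (c₀ := c₀) (c₁ := c₁) r T with
    ⟨h, h'⟩ | ⟨h, -, h'⟩ | ⟨h, -, h₁, -, -, h₂⟩
  · rw [h]
    refine iff_of_true ?_ hyes
    rcases h' with h' | ⟨x, hx, y, hy, hxy, h'⟩ | h'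
    · omega
    · exact ⟨[x, y], by simpa using hxy, by simp [hx, hy], by simpa [pathWeight] using h'⟩
    · obtain ⟨h₁, -, h₃⟩ := cover_spec ov hT.nodup
      refine ⟨(cover ov T).2, (h₁.nodup_iff.2 hT.nodup).of_append_left,
        fun x hx => h₁.subset (List.mem_append_left _ hx), by omega⟩
  · rw [h]
    refine iff_of_false ?_ hno
    rcases h' with h' | ⟨h₁, h'⟩
    · rintro ⟨P, h₁, h₂, h₃⟩
      have h₄ := (h₁.subperm h₂).length_le
      match P with
      | [] => simp [pathWeight] at h₃; omega
      | [x] => simp [pathWeight] at h₃; omega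
      | x :: y :: P => simp at h₄; omega
    · rw [exists_path_shrunkStrings_iff hc hT.nodup h₁]
      rintro ⟨P, h₂, h₃, h₄⟩
      have := pathWeight_le_totalLength h₂ h₃
      omega
  · rw [h, exists_path_shrunkStrings_iff hc hT.nodup h₁]
    exact (exists_superstring_iff_path
      (factorFree_map_shrinkString hc r (nodup_keptStrings hT.nodup))
      (by simp only [shrunkStrings] at h₂ ⊢; omega)).symm

/-- The kernel has the same answer as the instance. -/
theorem kernel_iff (hc : c₀ ≠ c₁) (I : List (List α) × ℕ) :
    (∃ s : List α, s.length ≤ I.2 ∧ IsSuperstring s I.1) ↔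
      ∃ s : List α, s.length ≤ (kernel c₀ c₁ I).2 ∧ IsSuperstring s (kernel c₀ c₁ I).1 := by
  rw [kernel, ← kernelOfFactorFree_iff hc (factorFree_reduce I.1) rfl]
  simp only [isSuperstring_reduce]

/-- All letters of the kernel are letters of the instance, or `c₀` or `c₁`, and `c₁` is used only
if the instance has two different letters. -/
theorem mem_kernel {D : α → Prop} (h₀ : D c₀) (h₁ : D c₁ ∨ ∀ z, D z → z = c₀)
    {I : List (List α) × ℕ} (hI : ∀ x ∈ I.1, ∀ a ∈ x, D a) :
    ∀ x ∈ (kernel c₀ c₁ I).1, ∀ a ∈ x, D a := by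
  have hT : ∀ x ∈ reduce I.1, ∀ a ∈ x, D a := fun x hx => hI x ((reduce_sublist _).subset hx)
  have hff := factorFree_reduce I.1
  rw [kernel]
  generalize totalLength (reduce I.1) - I.2 = r
  revert hT hff
  generalize reduce I.1 = T
  intro hT hff
  rcases kernelOfFactorFree_cases (c₀ := c₀) (c₁ := c₁) r T with
    ⟨h, -⟩ | ⟨h, -⟩ | ⟨h, -, -, -, hlen, -⟩
  · simp [h]
  · simpa [h] using h₀
  · rw [h]
    -- If `c₀` were the only letter, two members of `T` would be powers of `c₀`, and the shorter one
    -- a prefix of the other.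
    have h₁' : D c₁ := by
      refine h₁.resolve_right fun hD => ?_
      match T, hlen with
      | x :: y :: T, _ =>
        have hx : x = List.replicate x.length c₀ :=
          List.eq_replicate_of_mem fun a ha => hD a (hT x (by simp) a ha)
        have hy : y = List.replicate y.length c₀ :=
          List.eq_replicate_of_mem fun a ha => hD a (hT y (by simp) a ha)
        have hxy : x ≠ y := by
          have := hff.nodup
          simp at this
          tauto
        rcases le_total x.length y.length with hl | hl
        · refine hxy (hff.eq_of_infix x (by simp) y (by simp) (List.IsPrefix.isInfix ?_))
          rw [hx, hy]
          simpa [List.prefix_replicate_iff] using hl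
        · refine hxy (hff.eq_of_infix y (by simp) x (by simp) (List.IsPrefix.isInfix ?_)).symm
          rw [hx, hy]
          simpa [List.prefix_replicate_iff] using hl
    intro x hx a ha
    obtain ⟨y, hy, rfl⟩ := List.mem_map.1 hx
    rcases mem_of_mem_code ha with rfl | rfl | ha
    · exact h₀
    · exact h₁'
    have hyT := keptStrings_subset hff.nodup hy
    simp only [gadget, List.mem_append, List.mem_cons, List.mem_map, Sum.inl.injEq,
      exists_eq_right, reduceCtorEq, false_or] at ha
    rcases ha with ha | ha | ha
    · exact hT y hyT a (List.mem_of_mem_take ha)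
    · obtain ⟨b, -, rfl⟩ := List.mem_map.1 ha
      split_ifs
      · exact h₁'
      · exact h₀
    · exact hT y hyT a (List.mem_of_mem_drop ha)

/-- With `X.length + 1 ≤ 2 * r` the candidates number at most `(2 * r) ^ 3`; the matched vertices
themselves account for the remaining `2 * r ^ 3`. -/
theorem length_keptStrings_le {r : ℕ} {T : List (List α)} (hT : T.Nodup)
    (h : (cover ov T).2.length < 2 * r) : (keptStrings r T).length ≤ 10 * r ^ 3 := by
  have h₁ := (cover_spec ov hT).1.nodup_iff.2 hT
  refine (length_kept_le h₁.of_append_right).trans ?_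
  have h₂ : ((cover ov T).2.length + 1) * (((cover ov T).2.length + 1) * (2 * r)) ≤
      (2 * r) * ((2 * r) * (2 * r)) := by gcongr <;> omega
  have h₃ : r ≤ r ^ 3 := Nat.le_self_pow (by omega) r
  have h₄ : (2 * r) * ((2 * r) * (2 * r)) = 8 * r ^ 3 := by ring
  omega

theorem length_bits_le {n k : ℕ} (h : n < 2 ^ k) : n.bits.length ≤ k := by
  rw [Nat.size_eq_bits_len]
  exact Nat.size_le.2 h

/-- An index below `10 * r ^ 3 ≤ 2 ^ (3 * r + 4)` has at most `3 * r + 4` digits. This crude linear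
bound suffices, since the two ends have length up to `r` anyway: `7 * (2 * r + 2 + 3 * r + 4) ≤ 77 *
r` for `r ≥ 1`. -/
theorem length_mem_shrunkStrings_le {r : ℕ} {T : List (List α)} (hT : T.Nodup)
    (h : (cover ov T).2.length < 2 * r) :
    ∀ x ∈ shrunkStrings c₀ c₁ r T, x.length ≤ 77 * r := by
  intro x hx
  obtain ⟨y, hy, rfl⟩ := List.mem_map.1 hx
  refine (length_shrinkString_le r _ y).trans ?_
  have h₁ := List.idxOf_lt_length_of_mem hy
  have h₂ := length_keptStrings_le hT h
  have h₃ : r ^ 3 ≤ 2 ^ (3 * r) := by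
    rw [mul_comm, pow_mul]
    exact Nat.pow_le_pow_left Nat.lt_two_pow_self.le 3
  have h₄ := length_bits_le (n := (keptStrings r T).idxOf y) (k := 3 * r + 4)
    (by rw [pow_add]; omega)
  omega

/-- The length of the word that represents the kernel, and its parameter. -/
theorem kernel_size_le (I : List (List α) × ℕ) :
    ((kernel c₀ c₁ I).1.map fun x => x.length + 1).sum + (kernel c₀ c₁ I).2.bits.length ≤
      2000 * ((totalLength I.1 - I.2) ^ 4 + 1) ∧
    totalLength (kernel c₀ c₁ I).1 - (kernel c₀ c₁ I).2 ≤
      2000 * ((totalLength I.1 - I.2) ^ 4 + 1) := by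
  -- Removing substrings can only lower the parameter.
  have hr : totalLength (reduce I.1) - I.2 ≤ totalLength I.1 - I.2 :=
    Nat.sub_le_sub_right (totalLength_reduce_le _) _
  have hff := (factorFree_reduce I.1).nodup
  have hr4 := Nat.pow_le_pow_left hr 4
  rw [kernel]
  revert hr4 hff
  generalize reduce I.1 = T
  generalize totalLength T - I.2 = r
  generalize (totalLength I.1 - I.2) ^ 4 = R
  intro hff hr4
  rcases kernelOfFactorFree_cases (c₀ := c₀) (c₁ := c₁) r T with
    ⟨h, -⟩ | ⟨h, -⟩ | ⟨h, h₀, -, h₁, -, -⟩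
  · simp [h, totalLength]
  · simp [h, totalLength]
    omega
  · have h₂ := length_keptStrings_le hff h₁
    have h₃ := length_mem_shrunkStrings_le (c₀ := c₀) (c₁ := c₁) hff h₁
    have h₄ : r ≤ r ^ 4 := Nat.le_self_pow (by omega) r
    have h₅ : ((shrunkStrings c₀ c₁ r T).map fun x => x.length + 1).sum ≤ 780 * r ^ 4 := by
      have h₆ : ((shrunkStrings c₀ c₁ r T).map fun x => x.length + 1).sum ≤
          ((shrunkStrings c₀ c₁ r T).map fun x => x.length + 1).length • (78 * r) := by
        refine List.sum_le_card_nsmul _ _ fun n hn => ?_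
        obtain ⟨x, hx, rfl⟩ := List.mem_map.1 hn
        have := h₃ x hx
        omega
      refine h₆.trans ?_
      rw [List.length_map, shrunkStrings, List.length_map, smul_eq_mul]
      calc _ ≤ 10 * r ^ 3 * (78 * r) := Nat.mul_le_mul_right _ h₂
        _ = _ := by ring
    have h₇ : totalLength (shrunkStrings c₀ c₁ r T) ≤
        ((shrunkStrings c₀ c₁ r T).map fun x => x.length + 1).sum :=
      List.sum_le_sum fun x _ => Nat.le_succ _
    -- It is enough to bound the number of digits by the number itself, which is at most `780 * r ^
    -- 4`; together with the strings this stays below 2000.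
    have h₈ := length_bits_le (Nat.lt_two_pow_self (n := totalLength (shrunkStrings c₀ c₁ r T) - 7 * r))
    rw [h]
    dsimp only
    omega

end Kernel

end ShortestSuperstring

/-! ### The kernelization runs in polynomial time -/

namespace StackProg

open ShortestSuperstring (ov reduce reduce_sublist sortBy sortBy_perm best
  kept cover cover_spec totalLength block label shrinkString code gadget keptStrings
  shrunkStrings kernelOfFactorFree kernel)

theorem size_perm {α : Type} [Enc α] {l m : List α} (h : l.Perm m) : size l = size m := by
  induction h with
  | nil => rfl
  | cons a _ ih => simp [ih]
  | swap a b l => simp; omega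
  | trans _ _ ih₁ ih₂ => rw [ih₁, ih₂]

namespace PolyTime

variable {γ α β : Type} [Enc γ] [Enc α] [Enc β]

theorem totalLength {l : γ → List (List α)} (hl : PolyTime l) :
    PolyTime (fun a => totalLength (l a)) :=
  sum_map (f := fun _ (x : List α) => x.length) hl (length snd)

theorem sortBy {k : γ → β → ℕ} {l : γ → List β} (hk : PolyTime fun q : γ × β => k q.1 q.2)
    (hl : PolyTime l) : PolyTime (fun a => sortBy (k a) (l a)) := by
  obtain ⟨p, hp⟩ := hl.polySize
  refine foldr (h := fun a v m => m.filter (fun u => decide (k a v ≤ k a u)) ++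
    v :: m.filter (fun u => !decide (k a v ≤ k a u))) hl (PolyTime.const []) ?_
    ⟨p, fun a m hm => ?_⟩
  · have h : PolyTime fun q : (γ × β × List β) × β => decide (k q.1.1 q.1.2.1 ≤ k q.1.1 q.2) :=
      le (hk.comp ((fst.comp fst).pair (fst.comp (snd.comp fst)))) (hk.comp ((fst.comp fst).pair snd))
    exact PolyTime.append
      (filter (p := fun q u => decide (k q.1 q.2.1 ≤ k q.1 u)) (snd.comp snd) h)
      (PolyTime.cons (fst.comp snd)
        (filter (p := fun q u => !decide (k q.1 q.2.1 ≤ k q.1 u)) (snd.comp snd) h.not))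
  · change size (ShortestSuperstring.sortBy (k a) m) ≤ _
    rw [size_perm (sortBy_perm _ _)]
    exact (size_sublist hm.sublist).trans (hp a)

theorem best {w : β → β → ℕ} {e : β} {M : γ → ℕ} {X I : γ → List β}
    (hw : PolyTime fun q : β × β => w q.1 q.2) (hM : PolyTime M) (hX : PolyTime X)
    (hI : PolyTime I) : PolyTime (fun a => best w e (M a) (X a) (I a)) := by
  have hX' : PolyTime (fun a => e :: X a) := PolyTime.cons (PolyTime.const e) hX
  refine flatMap (f := fun c a => (e :: X c).flatMap fun b =>
    (ShortestSuperstring.sortBy (fun v => w a v + w v b) (I c)).take (M c)) hX' ?_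
  refine flatMap (f := fun (q : γ × β) b =>
    (ShortestSuperstring.sortBy (fun v => w q.2 v + w v b) (I q.1)).take (M q.1)) (hX'.comp fst) ?_
  refine take (hM.comp (fst.comp fst)) (sortBy (k := fun (q : (γ × β) × β) v =>
    w q.1.2 v + w v q.2) ?_ (hI.comp (fst.comp fst)))
  exact add (hw.comp ((snd.comp (fst.comp fst)).pair snd)) (hw.comp (snd.pair (snd.comp fst)))

theorem kept [DecidableEq β] {w : β → β → ℕ} {e : β} {M : γ → ℕ} {X I : γ → List β}
    (hw : PolyTime fun q : β × β => w q.1 q.2) (hM : PolyTime M) (hX : PolyTime X)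
    (hI : PolyTime I) : PolyTime (fun a => kept w e (M a) (X a) (I a)) :=
  hX.append (filter (p := fun a v => decide (v ∈ ShortestSuperstring.best w e (M a) (X a) (I a))) hI
    (mem snd ((best hw hM hX hI).comp fst)))

/-- The lists are required to be free of repetitions only to bound the intermediate states: by
`cover_spec` the two parts together are then a permutation of the vertices read so far. -/
theorem cover [DecidableEq β] {w : β → β → ℕ} {l : γ → List β}
    (hw : PolyTime fun q : β × β => w q.1 q.2) (hl : PolyTime l) (hl' : ∀ a, (l a).Nodup) :
    PolyTime (fun a => cover w (l a)) := by
  obtain ⟨p, hp⟩ := hl.polySize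
  refine foldr (h := fun _ x (T : List β × List β) => listCase
    (T.1.filter fun y => decide (0 < w x y) || decide (0 < w y x)) (x :: T.1, T.2)
    fun y _ => (T.1.filter fun z => !decide (z = y),
      if 0 < w x y then x :: y :: T.2 else y :: x :: T.2)) hl (PolyTime.const _) ?_
    ⟨p + 2, fun a m hm => ?_⟩
  · have hx : PolyTime fun q : γ × β × List β × List β => q.2.1 := fst.comp snd
    have hI : PolyTime fun q : γ × β × List β × List β => q.2.2.1 := fst.comp (snd.comp snd)
    have hX : PolyTime fun q : γ × β × List β × List β => q.2.2.2 := snd.comp (snd.comp snd)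
    refine PolyTime.listCase (g := fun q y _ => (q.2.2.1.filter fun z => !decide (z = y),
      if 0 < w q.2.1 y then q.2.1 :: y :: q.2.2.2 else y :: q.2.1 :: q.2.2.2)) ?_
      ((PolyTime.cons hx hI).pair hX) ?_
    · refine filter (p := fun q y => decide (0 < w q.2.1 y) || decide (0 < w y q.2.1)) hI ?_
      exact or (lt (PolyTime.const 0) (hw.comp ((hx.comp fst).pair snd)))
        (lt (PolyTime.const 0) (hw.comp (snd.pair (hx.comp fst))))
    · have hy : PolyTime fun q : (γ × β × List β × List β) × β × List β => q.2.1 := fst.comp snd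
      refine PolyTime.pair ?_ (PolyTime.ite ?_ ?_ ?_)
      · exact filter (p := fun (q : (γ × β × List β × List β) × β × List β) z =>
          !decide (z = q.2.1)) (hI.comp fst) (PolyTime.eq snd (hy.comp fst)).not
      · exact lt (PolyTime.const 0) (hw.comp ((hx.comp fst).pair hy))
      · exact PolyTime.cons (hx.comp fst) (PolyTime.cons hy (hX.comp fst))
      · exact PolyTime.cons hy (PolyTime.cons (hx.comp fst) (hX.comp fst))
  · change size (ShortestSuperstring.cover w m) ≤ _
    have h₁ := size_perm (cover_spec w ((hl' a).sublist hm.sublist)).1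
    have h₂ := size_append (ShortestSuperstring.cover w m).2 (ShortestSuperstring.cover w m).1
    have h₃ := (size_sublist hm.sublist).trans (hp a)
    rw [size_pair]
    simp only [Polynomial.eval_add, Polynomial.eval_ofNat]
    omega

theorem block_inl (c₀ c₁ : α) {a : γ → α} (ha : PolyTime a) :
    PolyTime (fun q => block c₀ c₁ (.inl (a q))) :=
  PolyTime.cons (.const _) (PolyTime.cons (.const _) (PolyTime.cons (.const _)
    (PolyTime.cons (.const _) (PolyTime.cons (.const _) (PolyTime.cons ha (.const [c₁]))))))

theorem code_map (c₀ c₁ : α) {l : γ → List α} (hl : PolyTime l) :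
    PolyTime (fun q => code c₀ c₁ ((l q).map .inl)) := by
  refine (flatMap (f := fun _ a => block c₀ c₁ (.inl a)) hl (block_inl c₀ c₁ snd)).of_eq
    fun q => ?_
  rw [code, List.flatMap_map]

variable [DecidableEq α]

theorem ov {x y : γ → List α} (hx : PolyTime x) (hy : PolyTime y) :
    PolyTime (fun a => ov (x a) (y a)) := by
  have H : ∀ (a : γ) (m : List α), m.foldr (fun b (s : List α × ℕ) =>
      (b :: s.1, if b :: s.1 <+: y a then s.1.length + 1 else s.2)) ([], 0) =
      (m, ShortestSuperstring.ov m (y a)) := by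
    intro a m
    induction m with
    | nil => rfl
    | cons b m ih => rw [List.foldr_cons, ih]; rfl
  have h : PolyTime (fun a => ((x a).foldr (fun b (s : List α × ℕ) =>
      (b :: s.1, if b :: s.1 <+: y a then s.1.length + 1 else s.2)) ([], 0)).2) := by
    obtain ⟨p, hp⟩ := hx.polySize
    refine snd.comp (foldr (h := fun a b (s : List α × ℕ) =>
      (b :: s.1, if b :: s.1 <+: y a then s.1.length + 1 else s.2)) hx (PolyTime.const _) ?_
      ⟨3 * p + 2, fun a m hm => ?_⟩)
    · have h₁ : PolyTime fun q : γ × α × List α × ℕ => q.2.1 :: q.2.2.1 :=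
        PolyTime.cons (fst.comp snd) (fst.comp (snd.comp snd))
      exact h₁.pair (PolyTime.ite (isPrefix h₁ (hy.comp fst))
        (PolyTime.succ (length (fst.comp (snd.comp snd)))) (snd.comp (snd.comp snd)))
    · rw [H]
      obtain ⟨z, h₁, -, h₂⟩ := ShortestSuperstring.exists_ov m (y a)
      have h₃ := h₁.length_le
      have h₄ := length_le_size m
      have h₅ := (size_sublist hm.sublist).trans (hp a)
      simp only [size_pair, size_nat, Polynomial.eval_add, Polynomial.eval_mul,
        Polynomial.eval_ofNat]
      omega
  exact h.of_eq fun a => by rw [H]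

theorem reduce {l : γ → List (List α)} (hl : PolyTime l) : PolyTime (fun a => reduce (l a)) := by
  obtain ⟨p, hp⟩ := hl.polySize
  refine foldr (h := fun _ x (T : List (List α)) =>
    if T.any (fun y => decide (x <:+: y)) = true then T else x :: T.filter (fun y => !decide (y <:+: x))) hl (PolyTime.const []) ?_ ⟨p, fun a m hm => ?_⟩
  · have hx : PolyTime fun q : γ × List α × List (List α) => q.2.1 := fst.comp snd
    have hT : PolyTime fun q : γ × List α × List (List α) => q.2.2 := snd.comp snd
    refine PolyTime.ite ?_ hT (PolyTime.cons hx ?_)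
    · exact (any (p := fun q y => decide (q.2.1 <:+: y)) hT
        (isInfix (hx.comp fst) snd)).of_eq fun a => by simp only [Bool.decide_eq_true]
    · exact filter (p := fun q y => !decide (y <:+: q.2.1)) hT (isInfix snd (hx.comp fst)).not
  · exact (size_sublist (reduce_sublist m)).trans ((size_sublist hm.sublist).trans (hp a))

theorem shrinkString (c₀ c₁ : α) {r : γ → ℕ} {Q : γ → List (List α)} {x : γ → List α}
    (hr : PolyTime r) (hQ : PolyTime Q) (hx : PolyTime x) :
    PolyTime (fun a => shrinkString c₀ c₁ (r a) (Q a) (x a)) := by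
  have hl : PolyTime (fun a => label c₀ c₁ (Q a) (x a)) :=
    map (f := fun _ b => if b = true then c₁ else c₀) (bits (idxOf hx hQ))
      (PolyTime.ite (snd.of_eq fun a => by simp) (PolyTime.const c₁) (PolyTime.const c₀))
  refine ((code_map c₀ c₁ (take hr hx)).append ((PolyTime.const (block c₀ c₁ (.inr false))).append
    ((code_map c₀ c₁ hl).append ((PolyTime.const (block c₀ c₁ (.inr true))).append
    (code_map c₀ c₁ (drop (sub (length hx) hr) hx)))))).of_eq fun a => ?_
  simp only [ShortestSuperstring.shrinkString, gadget, ShortestSuperstring.code_append,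
    ShortestSuperstring.code_cons]

theorem keptStrings {r : γ → ℕ} {T : γ → List (List α)} (hr : PolyTime r) (hT : PolyTime T)
    (hT' : ∀ a, (T a).Nodup) : PolyTime (fun a => keptStrings (r a) (T a)) :=
  have hw : PolyTime fun q : List α × List α => ShortestSuperstring.ov q.1 q.2 := ov fst snd
  have h := cover hw hT hT'
  kept hw (const_mul 2 hr) h.snd' h.fst'

theorem shrunkStrings (c₀ c₁ : α) {r : γ → ℕ} {T : γ → List (List α)} (hr : PolyTime r)
    (hT : PolyTime T) (hT' : ∀ a, (T a).Nodup) :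
    PolyTime (fun a => shrunkStrings c₀ c₁ (r a) (T a)) :=
  have h := keptStrings hr hT hT'
  map (f := fun a x => ShortestSuperstring.shrinkString c₀ c₁ (r a)
    (ShortestSuperstring.keptStrings (r a) (T a)) x) h
    (shrinkString c₀ c₁ (hr.comp fst) (h.comp fst) snd)

theorem kernelOfFactorFree (c₀ c₁ : α) {r : γ → ℕ} {T : γ → List (List α)} (hr : PolyTime r)
    (hT : PolyTime T) (hT' : ∀ a, (T a).Nodup) :
    PolyTime (fun a => kernelOfFactorFree c₀ c₁ (r a) (T a)) := by
  have hw : PolyTime fun q : List α × List α => ShortestSuperstring.ov q.1 q.2 := ov fst snd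
  have hU := shrunkStrings c₀ c₁ hr hT hT'
  refine PolyTime.ite (PolyTime.eq hr (PolyTime.const 0)) (PolyTime.const _)
    (PolyTime.ite ?_ (PolyTime.const _) (PolyTime.ite ?_ (PolyTime.const _)
    (PolyTime.ite ?_ (PolyTime.const _) (PolyTime.ite ?_ (PolyTime.const _) ?_))))
  · refine (any (p := fun a x => (T a).any fun y => !decide (x = y) &&
      decide (r a ≤ ShortestSuperstring.ov x y)) hT ?_).of_eq
      fun a => by simp only [Bool.decide_eq_true]
    refine any (p := fun (q : γ × List α) y => !decide (q.2 = y) &&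
      decide (r q.1 ≤ ShortestSuperstring.ov q.2 y)) (hT.comp fst) ?_
    exact and (PolyTime.eq (snd.comp fst) snd).not
      (le (hr.comp (fst.comp fst)) (hw.comp ((snd.comp fst).pair snd)))
  · exact le (const_mul 2 hr) (length (cover hw hT hT').snd')
  · exact le (length hT) (PolyTime.const 1)
  · exact lt (totalLength hU) (const_mul 7 hr)
  · exact hU.pair (sub (totalLength hU) (const_mul 7 hr))

end PolyTime

/-! ### The kernelization on words -/

/-- The separator of two strings. -/
def sep : Atom := ⟨0⟩

/-- A binary digit. -/
def digit (b : Bool) : Atom := if b = true then ⟨2⟩ else ⟨1⟩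

/-- The word of an instance. -/
def unparse (I : List (List Atom) × List Bool) : List Atom :=
  I.1.flatMap (fun x => x ++ [sep]) ++ I.2.map digit

/-- The word is read from the right. A separator ends a string, so from this side it opens a new
one, and letters are then put in front of the string opened last. A letter with no string open is
dropped; this concerns malformed words only. -/
def parseStep (a : Atom) (s : List (List Atom) × List Bool) : List (List Atom) × List Bool :=
  if a = sep then ([] :: s.1, s.2)
  else if a = digit false then (s.1, false :: s.2)
  else if a = digit true then (s.1, true :: s.2)
  else listCase s.1 ([], s.2) fun x t => ((a :: x) :: t, s.2)

/-- Recovers an instance from its word. -/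
def parse (w : List Atom) : List (List Atom) × List Bool := w.foldr parseStep ([], [])

theorem parse_unparse {I : List (List Atom) × List Bool} (hI : ∀ x ∈ I.1, ∀ a ∈ x, 3 ≤ a.id) :
    parse (unparse I) = I := by
  obtain ⟨S, l⟩ := I
  simp only at hI
  rw [unparse, parse, List.foldr_append]
  have h : (l.map digit).foldr parseStep ([], []) = ([], l) := by
    clear hI
    induction l with
    | nil => rfl
    | cons b l ih => rw [List.map_cons, List.foldr_cons, ih]; cases b <;> rfl
  rw [h]
  clear h
  induction S with
  | nil => rfl
  | cons x S ih =>
    rw [List.flatMap_cons, List.foldr_append, ih fun y hy => hI y (by simp [hy]), List.foldr_append]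
    have hx := hI x (by simp)
    clear hI ih
    induction x with
    | nil => rfl
    | cons a x ih =>
      rw [List.foldr_cons, ih fun b hb => hx b (by simp [hb])]
      have ha := hx a (by simp)
      have h₁ : ∀ n, n < 3 → a ≠ ⟨n⟩ := by
        rintro n hn rfl
        simp at ha
        omega
      simp [parseStep, sep, digit, h₁, listCase]

theorem polyTime_parse : PolyTime parse := by
  open PolyTime in
  refine foldr_add (h := fun _ a s => parseStep a s) PolyTime.id (PolyTime.const _) ?_
    ⟨3, fun a b s => ?_⟩
  · have ha : PolyTime fun q : List Atom × Atom × List (List Atom) × List Bool => q.2.1 :=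
      fst.comp snd
    have hS : PolyTime fun q : List Atom × Atom × List (List Atom) × List Bool => q.2.2.1 :=
      fst.comp (snd.comp snd)
    have hl : PolyTime fun q : List Atom × Atom × List (List Atom) × List Bool => q.2.2.2 :=
      snd.comp (snd.comp snd)
    refine PolyTime.ite (PolyTime.eq ha (PolyTime.const _))
      ((PolyTime.cons (PolyTime.const _) hS).pair hl) (PolyTime.ite (PolyTime.eq ha
      (PolyTime.const _)) (hS.pair (PolyTime.cons (PolyTime.const _) hl)) (PolyTime.ite
      (PolyTime.eq ha (PolyTime.const _)) (hS.pair (PolyTime.cons (PolyTime.const _) hl))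
      (PolyTime.listCase (g := fun q x t => ((q.2.1 :: x) :: t, q.2.2.2)) hS
      ((PolyTime.const _).pair hl) ?_)))
    exact (PolyTime.cons (PolyTime.cons (ha.comp fst) (fst.comp snd)) (snd.comp snd)).pair
      (hl.comp fst)
  · obtain ⟨S, l⟩ := s
    unfold parseStep
    split_ifs
    · simp; omega
    · simp; omega
    · simp; omega
    · cases S with
      | nil => simp [listCase]
      | cons x S => simp [listCase]; omega

theorem polyTime_unparse : PolyTime unparse := by
  open PolyTime in
  refine PolyTime.append (flatMap (f := fun _ x => x ++ [sep]) fst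
    (snd.append (PolyTime.const _))) (map (f := fun _ b => digit b) snd ?_)
  exact PolyTime.ite (snd.of_eq fun a => by simp) (PolyTime.const _) (PolyTime.const _)

/-- The kernelization, as a function on words. -/
def kernelWord (w : List Atom) : List Atom :=
  let T := reduce (parse w).1
  let J := kernelOfFactorFree ⟨3⟩ ⟨4⟩
    -- Capping `ℓ` at the total length does not change the truncated difference and keeps it
    -- polynomial in unary.
    (totalLength T - cutOfBits (totalLength T) (parse w).2) T
  unparse (J.1, J.2.bits)

theorem polyTime_kernelWord : PolyTime kernelWord := by
  open PolyTime in
  have hT : PolyTime (fun w => ShortestSuperstring.reduce (parse w).1) :=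
    reduce (fst.comp polyTime_parse)
  have hr := sub (totalLength hT) (PolyTime.cutOfBits (totalLength hT) polyTime_parse.snd')
  have hJ := kernelOfFactorFree ⟨3⟩ ⟨4⟩ hr hT
    fun w => (ShortestSuperstring.factorFree_reduce _).nodup
  exact polyTime_unparse.comp (hJ.fst'.pair (bits hJ.snd'))

theorem kernelWord_unparse {I : List (List Atom) × ℕ} (hI : ∀ x ∈ I.1, ∀ a ∈ x, 3 ≤ a.id) :
    kernelWord (unparse (I.1, I.2.bits)) =
      unparse ((kernel ⟨3⟩ ⟨4⟩ I).1, (kernel ⟨3⟩ ⟨4⟩ I).2.bits) := by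
  rw [kernelWord, parse_unparse hI]
  dsimp only
  rw [cutOfBits_bits, ← Nat.sub_eq_sub_min]
  rfl

end StackProg

/-! ### Changing the alphabet -/

namespace ShortestSuperstring

open StackProg (Atom unparse sep digit)

section Alphabet
variable {A B : Type}

/-- Replaces the letters of an instance. -/
def mapInst (e : A → B) (I : List (List A) × ℕ) : List (List B) × ℕ := (I.1.map (List.map e), I.2)

theorem totalLength_mapInst (e : A → B) (I : List (List A) × ℕ) :
    totalLength (mapInst e I).1 = totalLength I.1 := by
  simp [totalLength, mapInst, Function.comp_def]

theorem exists_mapInst_eq {e : A → B} {J : List (List B) × ℕ}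
    (hJ : ∀ x ∈ J.1, ∀ b ∈ x, b ∈ Set.range e) : ∃ I, mapInst e I = J := by
  have h : J.1 ∈ Set.range (List.map (List.map e)) := by
    rw [Set.range_list_map]
    intro x hx
    rw [Set.range_list_map]
    exact hJ x hx
  obtain ⟨S, hS⟩ := h
  exact ⟨(S, J.2), Prod.ext hS rfl⟩

/-- A superstring over the larger alphabet may use letters outside the range of `e`; a left inverse
of `e` sends them to arbitrary letters, which does not disturb the substrings in question. -/
theorem mapInst_iff {e : A → B} (he : Function.Injective e) (I : List (List A) × ℕ) :
    (∃ s : List B, s.length ≤ (mapInst e I).2 ∧ IsSuperstring s (mapInst e I).1) ↔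
      ∃ s : List A, s.length ≤ I.2 ∧ IsSuperstring s I.1 := by
  constructor
  · rintro ⟨s, hs, h⟩
    rcases isEmpty_or_nonempty A with hA | hA
    · refine ⟨[], by simp, fun x _ => ?_⟩
      cases x with
      | nil => exact List.infix_rfl
      | cons a x => exact hA.elim a
    · refine ⟨s.map (Function.invFun e), by simpa [mapInst] using hs, fun x hx => ?_⟩
      have := (h (x.map e) (List.mem_map_of_mem hx)).map (Function.invFun e)
      rwa [List.map_map, Function.invFun_comp he, List.map_id] at this
  · rintro ⟨s, hs, h⟩
    refine ⟨s.map e, by simpa [mapInst] using hs, fun x hx => ?_⟩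
    obtain ⟨y, hy, rfl⟩ := List.mem_map.1 hx
    exact (h y hy).map e

theorem length_encode (I : List (List A) × ℕ) :
    (encode I).length = (I.1.map fun x => x.length + 1).sum + I.2.bits.length := by
  simp [encode, List.length_flatMap]

/-- The symbols for the letters of the words that represent instances. -/
def letterCode (e : A → Atom) : Option (A ⊕ Bool) → Atom
  | none => sep
  | some (.inl a) => e a
  | some (.inr b) => digit b

theorem letterCode_injective {e : A → Atom} (he : Function.Injective e) (he' : ∀ a, 3 ≤ (e a).id) :
    Function.Injective (letterCode e) := by
  have h : ∀ a n, n < 3 → e a ≠ ⟨n⟩ := by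
    intro a n hn h
    have := he' a
    rw [h] at this
    simp at this
    omega
  rintro (_ | a | b) (_ | a' | b') hab
  all_goals first | rfl | skip
  · exact absurd hab.symm (h a' 0 (by omega))
  · cases b' <;> simp [letterCode, sep, digit] at hab
  · exact absurd hab (h a 0 (by omega))
  · rw [he hab]
  · cases b' <;> exact absurd hab (h a _ (by omega))
  · cases b <;> simp [letterCode, sep, digit] at hab
  · cases b <;> exact absurd hab.symm (h a' _ (by omega))
  · cases b <;> cases b' <;> simp [letterCode, digit] at hab ⊢

theorem map_encode (e : A → Atom) (I : List (List A) × ℕ) :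
    (encode I).map (letterCode e) = unparse ((mapInst e I).1, (mapInst e I).2.bits) := by
  simp [encode, unparse, mapInst, List.map_flatMap, List.flatMap_map, Function.comp_def, letterCode]

/-- An enumeration of the alphabet. -/
theorem exists_letters (A : Type) [Finite A] : ∃ e : A → Atom, Function.Injective e ∧
    (∀ a, 3 ≤ (e a).id) ∧ (Nonempty A → ⟨3⟩ ∈ Set.range e ∧
      (⟨4⟩ ∈ Set.range e ∨ ∀ z, z ∈ Set.range e → z = ⟨3⟩)) := by
  obtain ⟨n, ⟨f⟩⟩ := Finite.exists_equiv_fin A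
  have hmem : ∀ i < n, (⟨i + 3⟩ : Atom) ∈ Set.range fun a => (⟨f a + 3⟩ : Atom) :=
    fun i hi => ⟨f.symm ⟨i, hi⟩, by simp⟩
  refine ⟨fun a => ⟨f a + 3⟩, fun a b h => ?_, fun a => by simp, fun ⟨a⟩ => ⟨?_, ?_⟩⟩
  · simpa [Fin.val_inj] using h
  · exact hmem 0 (f a).pos
  · rcases Nat.lt_or_ge 1 n with hn | hn
    · exact .inl (hmem 1 hn)
    · right
      rintro _ ⟨b, rfl⟩
      have := (f b).isLt
      simp
      omega

/-- The kernel is computed over the infinite alphabet with the letters 3 and 4, so it has to be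
checked that it uses letters of `A` only. If `A` is empty, all strings are empty, the parameter is
0, and the kernel contains no string. -/
theorem exists_mapInst_eq_kernel {e : A → Atom} (he : Nonempty A → ⟨3⟩ ∈ Set.range e ∧
      (⟨4⟩ ∈ Set.range e ∨ ∀ z, z ∈ Set.range e → z = ⟨3⟩)) (I : List (List A) × ℕ) :
    ∃ J, mapInst e J = kernel ⟨3⟩ ⟨4⟩ (mapInst e I) := by
  rcases isEmpty_or_nonempty A with hA | hA
  · refine ⟨([], 0), ?_⟩
    have h : totalLength (mapInst e I).1 = 0 := by
      rw [totalLength_mapInst, totalLength, List.sum_eq_zero_iff]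
      intro n hn
      obtain ⟨x, -, rfl⟩ := List.mem_map.1 hn
      cases x with
      | nil => rfl
      | cons a x => exact hA.elim a
    have h' := totalLength_reduce_le (mapInst e I).1
    have h₀ : totalLength (reduce (mapInst e I).1) - (mapInst e I).2 = 0 := by omega
    rw [kernel, kernelOfFactorFree, if_pos h₀]
    rfl
  · refine exists_mapInst_eq (mem_kernel (he hA).1 (he hA).2 fun x hx a ha => ?_)
    obtain ⟨y, -, rfl⟩ := List.mem_map.1 hx
    obtain ⟨b, -, rfl⟩ := List.mem_map.1 ha
    exact ⟨b, rfl⟩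

end Alphabet

/-- Shortest Superstring has a kernel of size `O(r ^ 4)`. -/
theorem exists_kernel :
    ∃ (C : ℕ) (p : Polynomial ℕ), ∀ (A : Type) [Finite A],
      (shortestSuperstring A).AdmitsKernel (fun r => C * (r ^ 4 + 1)) p := by
  -- The polynomial is fixed before the alphabet is chosen, since `kernelWord` does not depend on
  -- it.
  obtain ⟨p, hp⟩ := StackProg.polyTime_kernelWord.exists_machine
  refine ⟨2000, p, fun A _ => ?_⟩
  obtain ⟨e, he, he₃, he'⟩ := exists_letters A
  choose K hK using exists_mapInst_eq_kernel he'
  refine ⟨K, ?_, fun (I : List (List A) × ℕ) => ?_⟩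
  · refine hp (Option (A ⊕ Bool)) _ _ encode encode K (letterCode e)
      (Function.invFun (letterCode e)) (Function.leftInverse_invFun (letterCode_injective he he₃))
      fun I => ?_
    rw [map_encode, map_encode, StackProg.kernelWord_unparse, hK]
    intro x hx a ha
    obtain ⟨y, -, rfl⟩ := List.mem_map.1 hx
    obtain ⟨b, -, rfl⟩ := List.mem_map.1 ha
    exact he₃ b
  · have h₁ := kernel_iff (c₀ := (⟨3⟩ : StackProg.Atom)) (c₁ := ⟨4⟩) (by simp) (mapInst e I)
    have h₂ := kernel_size_le (c₀ := (⟨3⟩ : StackProg.Atom)) (c₁ := ⟨4⟩) (mapInst e I)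
    rw [← hK, mapInst_iff he, mapInst_iff he] at h₁
    rw [← hK, totalLength_mapInst, totalLength_mapInst] at h₂
    refine ⟨h₁, ?_, h₂.2⟩
    refine le_trans (le_of_eq ?_) h₂.1
    refine (length_encode (K I)).trans ?_
    simp [mapInst, Function.comp_def]

end ShortestSuperstring

theorem theorem3 :
    ∃ (C : ℕ) (p : Polynomial ℕ), ∀ (A : Type) [Finite A],
      (shortestSuperstring A).AdmitsKernel (fun r => C * (r ^ 4 + 1)) p :=
  ShortestSuperstring.exists_kernel
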